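/- Let $f:\mathbb{R}^d\to\mathbb{R}$ ($d\ge 1$) be twice differentiable, with $kI\preceq\nabla^2 f(w)\preceq MI$ for all $w\in\mathbb{R}^d$, where $0<k\le M<\infty$, and let $w^*$ be a minimizer of $f$. Let $\beta\in(0,1/2]$. *Sketch.* For integers $N,e,b,n$, let $S_1,\dots,S_{N+e}\in\mathbb{R}^{n\times b}$ be i.i.d. Count-Sketch matrices: independently for every row, a column is chosen uniformly at random from $\{1,\dots,b\}$ and a sign uniformly from $\{\pm1\}$; that entry of the row is the chosen sign and the other entries of the row are $0$. The integer $e$ is the number of straggling blocks that are tolerated, $e\le\zeta N$ for a constant $\zeta\ge 0$. For a set $J\subseteq\{1,\dots,N+e\}$ of $N$ blocks, chosen independently of the $S_i$ (the blocks that are returned; the other $e$ are stragglers and are ignored), the OverSketch matrix is $S=\frac{1}{\sqrt N}(S_i)_{i\in J}\in\mathbb{R}^{n\times Nb}$. *Step.* Given $w_t\in\mathbb{R}^d$ and $A_t\in\mathbb{R}^{n\times d}$ with $A_t^TA_t=\nabla^2f(w_t)$, put $\hat H_t=A_t^TSS^TA_t$ and, if $\hat H_t$ is invertible, $p_t=-\hat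 H_t^{-1}\nabla f(w_t)$, $w_{t+1}=w_t+\alpha_tp_t$, where $\alpha_t$ is the largest $\alpha\le 1$ such that $f(w_t+\alpha p_t)\le f(w_t)+\alpha\beta\,p_t^T\nabla f(w_t)$. **Theorem.** Let $\mu>0$ and $\zeta\ge0$. There is $c_0>0$, depending only on $\mu,\zeta$, such that for all constants $c_2\ge c_1\ge c_0$ there is $C_0>0$ such that for every constant $C\ge C_0$ there is $\tau>0$, depending only on $\mu,\zeta,c_1,c_2,C$, with the following property. Let $0<\epsilon<1$ and suppose that the sketch dimension and the number of column blocks satisfy $$Nb+eb\;\ge\; C\,\frac{d^{1+\mu}}{\epsilon^2},\qquad \frac{c_1}{\epsilon}\le N+e\le\frac{c_2}{\epsilon}.$$ Then for all $f,k,M,\beta,w^*$ as above, every $w_t\in\mathbb{R}^d$, every $n$, every $A_t\in\mathbb{R}^{n\times d}$ with $A_t^TA_t=\nabla^2 f(w_t)$ and every set $J$ of $N$ returned blocks, with probability at least $1-1/d^\tau$ the matrix $\hat H_t$ is invertible, the step size $\alpha_t$ exists, $$\alpha_t\ \ge\ \min\Big\{1,\ \frac{2(1-\beta)(1-\epsilon)k}{M}\Big\},$$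 and $$f(w_{t+1})-f(w^*)\le(1-\rho)\,\big(f(w_t)-f(w^*)\big),\qquad \rho=\frac{2\alpha_t\beta k}{M(1+\epsilon)}.$$ -/

import Mathlib

open MeasureTheory ProbabilityTheory

noncomputable section

/-- Euclidean space `ℝ^d`. -/
abbrev Vec (d : ℕ) : Type := EuclideanSpace ℝ (Fin d)

/-- The Hessian matrix `∇² f(w)`: the Jacobian matrix of the gradient of `f` at `w`. -/
def hessian {d : ℕ} (f : Vec d → ℝ) (w : Vec d) : Matrix (Fin d) (Fin d) ℝ :=
  Matrix.of fun i j => (fderiv ℝ (gradient f) w (EuclideanSpace.single j 1)) i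

/-- `f` is twice differentiable on `ℝ^d`. -/
def TwiceDifferentiable {d : ℕ} (f : Vec d → ℝ) : Prop :=
  Differentiable ℝ f ∧ Differentiable ℝ (gradient f)

/-- `∇² f(w) ⪰ k I` for all `w`. -/
def IsStronglyConvexHess {d : ℕ} (k : ℝ) (f : Vec d → ℝ) : Prop :=
  ∀ w, (hessian f w - k • (1 : Matrix (Fin d) (Fin d) ℝ)).PosSemidef

/-- `∇² f(w) ⪯ M I` for all `w`. -/
def IsSmoothHess {d : ℕ} (M : ℝ) (f : Vec d → ℝ) : Prop :=
  ∀ w, (M • (1 : Matrix (Fin d) (Fin d) ℝ) - hessian f w).PosSemidef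

/-- The random choices behind one `n × b` Count-Sketch matrix: for every row `j`, a column
`(ω j).1` and a sign `(ω j).2` (`true` for `+1`, `false` for `-1`). -/
abbrev CountSketchSeed (n b : ℕ) : Type := Fin n → Fin b × Bool

/-- The Count-Sketch matrix built from the choices `ω`: row `j` has a single nonzero entry, the
chosen sign, in the chosen column. -/
def countSketch {n b : ℕ} (ω : CountSketchSeed n b) : Matrix (Fin n) (Fin b) ℝ :=
  Matrix.of fun j l => if (ω j).1 = l then (if (ω j).2 then 1 else -1) else 0

/-- The law of the choices for one Count-Sketch matrix: independently for every row, a uniform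
column and an independent uniform sign. -/
def countSketchLaw (n b : ℕ) : Measure (CountSketchSeed n b) :=
  Measure.pi fun _ => uniformOn Set.univ

/-- The random choices behind `K` Count-Sketch blocks. -/
abbrev OverSketchSeed (K n b : ℕ) : Type := Fin K → CountSketchSeed n b

/-- The law of the choices for `K` independent Count-Sketch blocks. -/
def overSketchLaw (K n b : ℕ) : Measure (OverSketchSeed K n b) :=
  Measure.pi fun _ => countSketchLaw n b

/-- The OverSketch matrix `N^{-1/2} (S_i)_{i ∈ J}`, whose column blocks are the Count-Sketch
matrices `S_i` of the blocks `i ∈ J` that were returned (the other blocks are stragglers and are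
ignored). Its columns are indexed by a block `i ∈ J` and a column of that block. -/
def overSketch {K n b : ℕ} (N : ℕ) (J : Finset (Fin K)) (ω : OverSketchSeed K n b) :
    Matrix (Fin n) (J × Fin b) ℝ :=
  Matrix.of fun j il => (1 / Real.sqrt N) * countSketch (ω il.1) j il.2

/-- The sketched Hessian `Aᵀ S Sᵀ A`. -/
def sketchedHessian {n d : ℕ} {ι : Type*} [Fintype ι] (A : Matrix (Fin n) (Fin d) ℝ)
    (S : Matrix (Fin n) ι ℝ) : Matrix (Fin d) (Fin d) ℝ :=
  A.transpose * S * S.transpose * A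

/-- The update direction `p = - H⁻¹ ∇f(w)` for an (approximate) Hessian `H`. -/
def newtonDirection {d : ℕ} (f : Vec d → ℝ) (H : Matrix (Fin d) (Fin d) ℝ) (w : Vec d) : Vec d :=
  -WithLp.toLp 2 (H⁻¹.mulVec (WithLp.ofLp (gradient f w)))

/-- The step sizes `α ≤ 1` with `f(w + α p) ≤ f(w) + α β pᵀ ∇f(w)`; the line search takes the
greatest one. -/
def armijoSteps {d : ℕ} (f : Vec d → ℝ) (β : ℝ) (w p : Vec d) : Set ℝ :=
  {α | α ≤ 1 ∧ f (w + α • p) ≤ f w + α * β * inner ℝ p (gradient f w)}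

/-- The good event for one step of OverSketched Newton from `w` with sketched Hessian `H`:
the update is well defined (`H` is invertible and the line search has a greatest admissible step
`α`), the step satisfies the lower bound, and the suboptimality contracts by the factor `1 - ρ`. -/
def GoodStep {d : ℕ} (f : Vec d → ℝ) (k M β ε : ℝ) (wstar w : Vec d)
    (H : Matrix (Fin d) (Fin d) ℝ) : Prop :=
  IsUnit H.det ∧
    ∃ α : ℝ, IsGreatest (armijoSteps f β w (newtonDirection f H w)) α ∧
      min 1 (2 * (1 - β) * (1 - ε) * k / M) ≤ α ∧
      f (w + α • newtonDirection f H w) - f wstar ≤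
        (1 - 2 * α * β * k / (M * (1 + ε))) * (f w - f wstar)

end

/-!
Whitening writes `A = U B` with `Uᵀ U = 1`, so that the Hessian is `Bᵀ B`
(`exists_isometry_factor`). The sketched Hessian is then `Bᵀ G B` with `G = Uᵀ S Sᵀ U`
(`sketchGram`), and everything reduces to `‖G - 1‖ ≤ ε`: in that case the sketched Hessian lies
between `(1 - ε) ∇²f` and `(1 + ε) ∇²f`, the smoothness of `f` makes the Armijo condition hold for
the claimed step, and the Polyak–Łojasiewicz inequality turns the Armijo decrease into contraction
(`goodStep_of_approx`).

To bound `‖G - 1‖`, note that each row of `S` has norm one, so `G - 1` only contains pairs of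
distinct rows that collide in a bucket. It is four times the average, over the bipartitions `η` of
the rows, of the sums `crossSum` of the pairs separated by `η` (`sketchGram_sub_one_eq`).
Given the random choices on one side, `crossSum` is a sum of independent randomly signed rank-one
matrices, to which a matrix Bennett inequality applies (`pairedSum_tail`). It needs two facts about
the fixed side, which follow from the same inequality: no bucket is heavy (`bucketSum_tail`), and
the sketch of that side has operator norm at most of order `log d` (`bucketMatrix_norm_tail`).
The resulting tail holds for each `η` separately; a second moment bound
(`unifAvg_sq_norm_crossSum_le`) is what allows averaging over `η` without a union bound
(`sketchGram_tail`). The gain `d ^ μ` in the sketch dimension makes the ratio inside the Bennett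
bound a negative power of `d`, while the exponent is of order `ε N`, a constant at least of order
`c₁`; this yields a failure probability `d ^ (-min μ 1)` (`failure_terms_le`).

The matrix Bennett inequality (`matrix_bennett`) is obtained from the matrix Laplace transform. In
place of Lieb's concavity theorem, one step of the induction over the summands
(`unifAvg_trace_exp_add_le`) uses `tr exp (H + X) ≤ tr (exp H exp X)` (Golden–Thompson) and, after
averaging over `X`, the gradient inequality `tr (exp H (1 + B)) ≤ tr exp (H + B)` (Klein). Subtracting
the dimension from `tr exp` leaves an intrinsic dimension in the bound, so that neither the number
of rows of `A` nor the number of columns of `S` enters it.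

All laws involved are uniform on finite types, and expectations are written as averages `unifAvg`.
-/

open scoped Matrix Matrix.Norms.L2Operator BigOperators

/-! ### Golden–Thompson inequality -/

section TraceInequalities

variable {m : Type*} [Fintype m] [DecidableEq m]

omit [DecidableEq m] in
theorem Matrix.trace_mul_le_half_add (X Y : Matrix m m ℝ) :
    (X * Y).trace ≤ ((X * Xᵀ).trace + (Yᵀ * Y).trace) / 2 := by
  have h : 0 ≤ ((X - Yᵀ) * (X - Yᵀ)ᵀ).trace := by
    have := (Matrix.posSemidef_self_mul_conjTranspose (X - Yᵀ)).trace_nonneg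
    simpa [Matrix.conjTranspose_eq_transpose_of_trivial] using this
  have h2 : (Yᵀ * Xᵀ).trace = (X * Y).trace := by
    rw [← Matrix.transpose_mul, Matrix.trace_transpose]
  rw [Matrix.transpose_sub, Matrix.transpose_transpose, sub_mul, mul_sub, mul_sub,
    Matrix.trace_sub, Matrix.trace_sub, Matrix.trace_sub, h2] at h
  linarith

theorem Matrix.trace_mul_pow_comm (X Y : Matrix m m ℝ) (k : ℕ) :
    ((X * Y) ^ k).trace = ((Y * X) ^ k).trace := by
  cases k with
  | zero => simp
  | succ k =>
    have : (X * Y) ^ (k + 1) = X * ((Y * X) ^ k * Y) := by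
      induction k with
      | zero => simp
      | succ k ih => rw [pow_succ' (X * Y), ih, pow_succ' (Y * X)]; simp only [mul_assoc]
    rw [this, Matrix.trace_mul_comm, mul_assoc, ← pow_succ]

/-- The two inequalities feed each other by induction on the exponent of `2`; they say that
squaring the factors inside a trace of a power increases it. -/
theorem Matrix.trace_mul_pow_two_pow_le (k : ℕ) :
    (∀ P Q : Matrix m m ℝ, Pᵀ = P → Qᵀ = Q →
      ((P * Q) ^ 2 ^ (k + 1)).trace ≤ ((P ^ 2 * Q ^ 2) ^ 2 ^ k).trace) ∧
    (∀ P Q : Matrix m m ℝ, Pᵀ = P → Qᵀ = Q →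
      ((P * Q) ^ 2 ^ k).trace ≤ (P ^ 2 ^ k * Q ^ 2 ^ k).trace) := by
  induction k with
  | zero =>
    refine ⟨fun P Q hP hQ => ?_, fun P Q hP hQ => by simp⟩
    have := Matrix.trace_mul_le_half_add (P * Q) (P * Q)
    have e1 : (P * Q * (P * Q)ᵀ).trace = (P ^ 2 * Q ^ 2).trace := by
      rw [Matrix.transpose_mul, hP, hQ, Matrix.trace_mul_comm, mul_assoc, Matrix.trace_mul_comm,
        pow_two, pow_two]
      simp only [mul_assoc]
    have e2 : ((P * Q)ᵀ * (P * Q)).trace = (P ^ 2 * Q ^ 2).trace := by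
      rw [Matrix.trace_mul_comm, e1]
    simp only [pow_zero, pow_one, zero_add]
    rw [pow_two (P * Q)]
    linarith
  | succ k ih =>
    obtain ⟨ihA, ihB⟩ := ih
    have hA : ∀ P Q : Matrix m m ℝ, Pᵀ = P → Qᵀ = Q →
        ((P * Q) ^ 2 ^ (k + 2)).trace ≤ ((P ^ 2 * Q ^ 2) ^ 2 ^ (k + 1)).trace := by
      intro P Q hP hQ
      have s1 : (Q * P * Q)ᵀ = Q * P * Q := by
        simp [Matrix.transpose_mul, hP, hQ, mul_assoc]
      have t1 : (Q * P ^ 2 * Q)ᵀ = Q * P ^ 2 * Q := by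
        simp [Matrix.transpose_mul, hP, hQ, mul_assoc, Matrix.transpose_pow]
      have t2 : (P * Q ^ 2 * P)ᵀ = P * Q ^ 2 * P := by
        simp [Matrix.transpose_mul, hP, hQ, mul_assoc, Matrix.transpose_pow]
      have u1 : (P ^ 2 * (Q * P * Q) ^ 2) = (P ^ 2 * Q) * (P * Q ^ 2 * P * Q) := by
        simp only [pow_two, mul_assoc]
      have u2 : (P * Q ^ 2 * P * Q) * (P ^ 2 * Q) = (P * Q ^ 2 * P) * (Q * P ^ 2 * Q) := by
        simp only [pow_two, mul_assoc]
      have v1 : (((P * Q ^ 2 * P)) ^ 2 ^ (k + 1)).trace = ((P ^ 2 * Q ^ 2) ^ 2 ^ (k + 1)).trace := by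
        rw [Matrix.trace_mul_pow_comm, ← mul_assoc, ← pow_two]
      have v2 : (((Q * P ^ 2 * Q)) ^ 2 ^ (k + 1)).trace = ((P ^ 2 * Q ^ 2) ^ 2 ^ (k + 1)).trace := by
        rw [mul_assoc, Matrix.trace_mul_pow_comm, mul_assoc, ← pow_two]
      calc ((P * Q) ^ 2 ^ (k + 2)).trace = ((P * (Q * P * Q)) ^ 2 ^ (k + 1)).trace := by
            rw [show k + 2 = (k + 1) + 1 from rfl, pow_succ 2 (k + 1), mul_comm (2 ^ (k + 1)) 2,
              pow_mul, pow_two]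
            simp only [mul_assoc]
        _ ≤ ((P ^ 2 * (Q * P * Q) ^ 2) ^ 2 ^ k).trace := ihA _ _ hP s1
        _ = (((P * Q ^ 2 * P) * (Q * P ^ 2 * Q)) ^ 2 ^ k).trace := by
            rw [u1, Matrix.trace_mul_pow_comm, u2]
        _ ≤ ((P * Q ^ 2 * P) ^ 2 ^ k * (Q * P ^ 2 * Q) ^ 2 ^ k).trace := ihB _ _ t2 t1
        _ ≤ _ := by
            have := Matrix.trace_mul_le_half_add ((P * Q ^ 2 * P) ^ 2 ^ k) ((Q * P ^ 2 * Q) ^ 2 ^ k)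
            rw [Matrix.transpose_pow, t2, Matrix.transpose_pow, t1, ← pow_add, ← pow_add,
              ← two_mul, ← pow_succ', v1, v2] at this
            linarith
    refine ⟨hA, fun P Q hP hQ => ?_⟩
    refine (ihA P Q hP hQ).trans ?_
    have := ihB (P ^ 2) (Q ^ 2) (by rw [Matrix.transpose_pow, hP]) (by rw [Matrix.transpose_pow, hQ])
    rwa [← pow_mul, ← pow_mul, ← pow_succ'] at this

open NormedSpace

theorem Matrix.norm_exp_le [Nonempty m] (X : Matrix m m ℝ) : ‖exp X‖ ≤ Real.exp ‖X‖ := by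
  have : NormOneClass (Matrix m m ℝ) := ⟨by
    rw [← Matrix.diagonal_one, Matrix.l2_opNorm_diagonal]; simp⟩
  rw [congrFun (exp_eq_tsum (𝔸 := Matrix m m ℝ) ℝ) X, Real.exp_eq_exp_ℝ,
    congrFun (exp_eq_tsum (𝔸 := ℝ) ℝ) ‖X‖]
  refine (norm_tsum_le_tsum_norm (norm_expSeries_summable' (𝕂 := ℝ) X)).trans ?_
  refine Summable.tsum_le_tsum (fun n => ?_) (norm_expSeries_summable' (𝕂 := ℝ) X)
    (expSeries_summable' (𝕂 := ℝ) ‖X‖)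
  rw [norm_smul, norm_inv, RCLike.norm_natCast, smul_eq_mul]
  gcongr
  exact norm_pow_le X n

theorem norm_pow_sub_pow_le {R : Type*} [NormedRing R] [NormOneClass R] (P Q : R) (c : ℝ)
    (hP : ‖P‖ ≤ c) (hQ : ‖Q‖ ≤ c) (hc : 1 ≤ c) (n : ℕ) :
    ‖P ^ n - Q ^ n‖ ≤ n * ‖P - Q‖ * c ^ n := by
  induction n with
  | zero => simp
  | succ n ih =>
    have e : P ^ (n + 1) - Q ^ (n + 1) = P * (P ^ n - Q ^ n) + (P - Q) * Q ^ n := by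
      rw [pow_succ', pow_succ']; noncomm_ring
    have h1 : ‖Q ^ n‖ ≤ c ^ n := (norm_pow_le _ _).trans (by gcongr)
    have h2 : c ^ n ≤ c ^ (n + 1) := pow_le_pow_right₀ hc (Nat.le_succ n)
    calc ‖P ^ (n + 1) - Q ^ (n + 1)‖ ≤ ‖P‖ * ‖P ^ n - Q ^ n‖ + ‖P - Q‖ * ‖Q ^ n‖ := by
          rw [e]
          exact (norm_add_le _ _).trans (add_le_add (norm_mul_le _ _) (norm_mul_le _ _))
      _ ≤ c * (n * ‖P - Q‖ * c ^ n) + ‖P - Q‖ * c ^ (n + 1) := by gcongr; exact h1.trans h2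
      _ = _ := by push_cast; ring

open Filter Topology in
/-- Lie–Trotter product formula along the powers of two. -/
theorem Matrix.tendsto_trotter [Nonempty m] (A B : Matrix m m ℝ) :
    Tendsto (fun k : ℕ => (exp ((2 ^ k : ℝ)⁻¹ • A) * exp ((2 ^ k : ℝ)⁻¹ • B)) ^ 2 ^ k) atTop
      (𝓝 (exp (A + B))) := by
  have : NormOneClass (Matrix m m ℝ) := ⟨by
    rw [← Matrix.diagonal_one, Matrix.l2_opNorm_diagonal]; simp⟩
  let E : ℝ → Matrix m m ℝ := fun t => exp (t • A) * exp (t • B) - exp (t • (A + B))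
  have hd (X : Matrix m m ℝ) : HasDerivAt (fun t : ℝ => exp (t • X)) X 0 := by
    have := hasDerivAt_exp_smul_const (𝕂 := ℝ) X (0 : ℝ)
    simpa using this
  have hE : HasDerivAt E 0 0 := by
    exact HasDerivAt.congr_deriv (f := E) (((hd A).mul (hd B)).sub (hd (A + B))) (by simp)
  have hE0 : E 0 = 0 := by simp [E]
  have h2 : Tendsto (fun k : ℕ => ((2 : ℝ) ^ k)⁻¹) atTop (𝓝[≠] 0) := by
    refine tendsto_nhdsWithin_iff.2 ⟨?_, Eventually.of_forall fun k => by simp⟩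
    exact tendsto_inv_atTop_zero.comp (tendsto_pow_atTop_atTop_of_one_lt (by norm_num))
  have h3 : Tendsto (fun k : ℕ => (2 : ℝ) ^ k * ‖E ((2 ^ k)⁻¹)‖) atTop (𝓝 0) := by
    have := (hE.tendsto_slope.comp h2).norm
    simp only [norm_zero] at this
    refine this.congr fun k => ?_
    simp [slope, hE0, norm_smul]
  set c := ‖A‖ + ‖B‖ with hc
  have h4 : Tendsto (fun k : ℕ => (2 : ℝ) ^ k * ‖E ((2 ^ k)⁻¹)‖ * Real.exp c) atTop (𝓝 0) := by
    simpa using h3.mul_const (Real.exp c)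
  rw [tendsto_iff_norm_sub_tendsto_zero]
  refine squeeze_zero (fun _ => norm_nonneg _) (fun k => ?_) h4
  have e1 : exp (A + B) = (exp ((2 ^ k : ℝ)⁻¹ • (A + B))) ^ 2 ^ k := by
    rw [← Matrix.exp_nsmul, ← Nat.cast_smul_eq_nsmul ℝ, smul_smul]
    simp
  have e2 : Real.exp c = (Real.exp ((2 ^ k : ℝ)⁻¹ * c)) ^ 2 ^ k := by
    rw [← Real.exp_nat_mul]; congr 1; push_cast; field_simp
  have hk : 0 ≤ ((2 : ℝ) ^ k)⁻¹ := by positivity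
  have n1 (X : Matrix m m ℝ) : ‖exp ((2 ^ k : ℝ)⁻¹ • X)‖ ≤ Real.exp ((2 ^ k : ℝ)⁻¹ * ‖X‖) := by
    refine (Matrix.norm_exp_le _).trans ?_
    rw [norm_smul, Real.norm_of_nonneg hk]
  rw [e1, e2]
  have := norm_pow_sub_pow_le (exp ((2 ^ k : ℝ)⁻¹ • A) * exp ((2 ^ k : ℝ)⁻¹ • B))
    (exp ((2 ^ k : ℝ)⁻¹ • (A + B))) (Real.exp ((2 ^ k : ℝ)⁻¹ * c)) ?_ ?_ ?_ (2 ^ k)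
  · push_cast at this; exact this
  · refine (norm_mul_le _ _).trans ?_
    rw [hc, mul_add, Real.exp_add]
    exact mul_le_mul (n1 A) (n1 B) (norm_nonneg _) (Real.exp_pos _).le
  · refine (n1 _).trans (Real.exp_le_exp.2 ?_)
    exact mul_le_mul_of_nonneg_left (norm_add_le _ _) hk
  · exact Real.one_le_exp (by positivity)

open Filter Topology in
/-- **Golden–Thompson inequality** for real symmetric matrices. -/
theorem Matrix.trace_exp_add_le (A B : Matrix m m ℝ) (hA : Aᵀ = A) (hB : Bᵀ = B) :
    (exp (A + B)).trace ≤ (exp A * exp B).trace := by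
  rcases isEmpty_or_nonempty m with h | h
  · simp [Matrix.trace]
  have h1 : Tendsto
      (fun k : ℕ => ((exp ((2 ^ k : ℝ)⁻¹ • A) * exp ((2 ^ k : ℝ)⁻¹ • B)) ^ 2 ^ k).trace) atTop
      (𝓝 (exp (A + B)).trace) := by
    have hc : Continuous (fun X : Matrix m m ℝ => X.trace) := by
      unfold Matrix.trace; fun_prop
    exact (hc.tendsto _).comp (Matrix.tendsto_trotter A B)
  refine le_of_tendsto h1 (Eventually.of_forall fun k => ?_)
  have hs (X : Matrix m m ℝ) (hX : Xᵀ = X) : (exp ((2 ^ k : ℝ)⁻¹ • X))ᵀ = exp ((2 ^ k : ℝ)⁻¹ • X) := by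
    rw [← Matrix.exp_transpose, Matrix.transpose_smul, hX]
  have hp (X : Matrix m m ℝ) : (exp ((2 ^ k : ℝ)⁻¹ • X)) ^ 2 ^ k = exp X := by
    rw [← Matrix.exp_nsmul, ← Nat.cast_smul_eq_nsmul ℝ, smul_smul]
    simp
  have := (Matrix.trace_mul_pow_two_pow_le k).2 _ _ (hs A hA) (hs B hB)
  rwa [hp, hp] at this

end TraceInequalities

/-! ### Spectral inequalities for the exponential -/

section Spectral

open NormedSpace

variable {m : Type*} [Fintype m] [DecidableEq m]

/-- Spectral theorem for a real symmetric matrix, together with the diagonalization of its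
exponential. -/
theorem Matrix.exists_spectral (X : Matrix m m ℝ) (hX : Xᵀ = X) :
    ∃ (U : Matrix m m ℝ) (h : m → ℝ), U * Uᵀ = 1 ∧ Uᵀ * U = 1 ∧ X = U * Matrix.diagonal h * Uᵀ ∧
      exp X = U * Matrix.diagonal (fun i => Real.exp (h i)) * Uᵀ := by
  have hH : X.IsHermitian := by
    rw [Matrix.IsHermitian, Matrix.conjTranspose_eq_transpose_of_trivial, hX]
  have hU := Matrix.mem_unitaryGroup_iff.1 hH.eigenvectorUnitary.2
  have hU' := Matrix.mem_unitaryGroup_iff'.1 hH.eigenvectorUnitary.2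
  obtain ⟨U, hUdef⟩ : ∃ U, U = (hH.eigenvectorUnitary : Matrix m m ℝ) := ⟨_, rfl⟩
  rw [← hUdef] at hU hU'
  rw [Matrix.star_eq_conjTranspose, Matrix.conjTranspose_eq_transpose_of_trivial] at hU hU'
  have hs : X = U * Matrix.diagonal hH.eigenvalues * Uᵀ := by
    have := hH.spectral_theorem
    rw [Unitary.conjStarAlgAut_apply, ← hUdef] at this
    exact this
  refine ⟨U, hH.eigenvalues, hU, hU', hs, ?_⟩
  have hinv : U⁻¹ = Uᵀ := Matrix.inv_eq_right_inv hU
  have hunit : IsUnit U := by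
    rw [Matrix.isUnit_iff_isUnit_det]; exact Matrix.isUnit_det_of_right_inverse hU
  conv_lhs => rw [hs, ← hinv, Matrix.exp_conj _ _ hunit, Matrix.exp_diagonal, hinv]
  congr 3
  funext i
  rw [Pi.coe_exp, Real.exp_eq_exp_ℝ]

theorem Matrix.posSemidef_conj_diagonal (U : Matrix m m ℝ) (f : m → ℝ) (hf : ∀ i, 0 ≤ f i) :
    (U * Matrix.diagonal f * Uᵀ).PosSemidef := by
  have := (Matrix.PosSemidef.diagonal (d := f) hf).mul_mul_conjTranspose_same U
  rwa [Matrix.conjTranspose_eq_transpose_of_trivial] at this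

omit [DecidableEq m] in
theorem Matrix.PosSemidef.conj_diag_nonneg {P : Matrix m m ℝ} (hP : P.PosSemidef)
    (U : Matrix m m ℝ) (i : m) : 0 ≤ (Uᵀ * P * U) i i := by
  have := hP.mul_mul_conjTranspose_same Uᵀ
  rw [Matrix.conjTranspose_eq_transpose_of_trivial, Matrix.transpose_transpose] at this
  exact this.diag_nonneg

theorem Matrix.quadratic_eq_conj (X U : Matrix m m ℝ) (h : m → ℝ) (hU : U * Uᵀ = 1) (hU' : Uᵀ * U = 1)
    (hX : X = U * Matrix.diagonal h * Uᵀ) (a b c : ℝ) :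
    a • (1 : Matrix m m ℝ) + b • X + c • (X * X) =
      U * Matrix.diagonal (fun i => a + b * h i + c * (h i * h i)) * Uᵀ := by
  have h1 : (1 : Matrix m m ℝ) = U * Matrix.diagonal (fun _ => 1) * Uᵀ := by
    rw [Matrix.diagonal_one, mul_one, hU]
  have h2 : X * X = U * Matrix.diagonal (fun i => h i * h i) * Uᵀ := by
    rw [hX, ← Matrix.diagonal_mul_diagonal]
    calc U * diagonal h * Uᵀ * (U * diagonal h * Uᵀ)
        = U * diagonal h * (Uᵀ * U) * diagonal h * Uᵀ := by simp only [mul_assoc]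
      _ = _ := by rw [hU']; simp only [mul_assoc, mul_one]
  have h3 : Matrix.diagonal (fun i => a + b * h i + c * (h i * h i)) =
      a • Matrix.diagonal (fun _ : m => (1 : ℝ)) + b • Matrix.diagonal h +
        c • Matrix.diagonal (fun i => h i * h i) := by
    ext i j
    by_cases hij : i = j
    · subst hij; simp
    · simp [hij]
  rw [h2, h3]
  conv_lhs => rw [h1, hX]
  simp only [mul_add, add_mul, Matrix.mul_smul, Matrix.smul_mul]

theorem Matrix.conj_conj_diag (X U : Matrix m m ℝ) (h : m → ℝ) (hU' : Uᵀ * U = 1)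
    (hX : X = U * Matrix.diagonal h * Uᵀ) : Uᵀ * X * U = Matrix.diagonal h := by
  rw [hX]
  calc Uᵀ * (U * diagonal h * Uᵀ) * U = (Uᵀ * U) * diagonal h * (Uᵀ * U) := by
        simp only [mul_assoc]
    _ = _ := by rw [hU']; simp

/-- The tangent line inequality for the exponential, lifted to matrices. -/
theorem Matrix.posSemidef_exp_sub_tangent (X : Matrix m m ℝ) (hX : Xᵀ = X) (c : ℝ) :
    (exp X - Real.exp c • ((1 - c) • (1 : Matrix m m ℝ) + X)).PosSemidef := by
  obtain ⟨U, h, hU, hU', hs, he⟩ := Matrix.exists_spectral X hX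
  have e := Matrix.quadratic_eq_conj X U h hU hU' hs (Real.exp c * (1 - c)) (Real.exp c) 0
  have e2 : Real.exp c • ((1 - c) • (1 : Matrix m m ℝ) + X) =
      (Real.exp c * (1 - c)) • (1 : Matrix m m ℝ) + Real.exp c • X + (0 : ℝ) • (X * X) := by
    rw [zero_smul, add_zero, smul_add, smul_smul]
  rw [e2, e, he, ← sub_mul, ← mul_sub, Matrix.diagonal_sub]
  refine Matrix.posSemidef_conj_diagonal _ _ fun i => ?_
  have h1 := Real.add_one_le_exp (h i - c)
  have h2 : Real.exp (h i) = Real.exp c * Real.exp (h i - c) := by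
    rw [← Real.exp_add]; congr 1; ring
  have h3 := mul_le_mul_of_nonneg_left h1 (Real.exp_pos c).le
  rw [h2]; nlinarith

theorem Real.exp_le_one_add_add_sq (x s : ℝ) (h : |x| ≤ s) :
    Real.exp x ≤ 1 + x + Real.exp s * (x * x) := by
  have h1 := Complex.norm_exp_sub_sum_le_norm_mul_exp (x : ℂ) 2
  have h2 : Complex.exp x - ∑ m ∈ Finset.range 2, (x : ℂ) ^ m / (m.factorial : ℂ) =
      ((Real.exp x - (1 + x) : ℝ) : ℂ) := by
    simp [Finset.sum_range_succ]
  rw [h2, Complex.norm_real, Complex.norm_real, Real.norm_eq_abs, Real.norm_eq_abs] at h1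
  have h3 : |x| ^ 2 = x * x := by rw [sq_abs]; ring
  have h4 := le_abs_self (Real.exp x - (1 + x))
  have h5 : |x| ^ 2 * Real.exp |x| ≤ |x| ^ 2 * Real.exp s := by gcongr
  rw [h3] at h1 h5
  linarith

theorem Matrix.posSemidef_quadratic_sub_exp (X : Matrix m m ℝ) (hX : Xᵀ = X) (s : ℝ) (hs0 : 0 ≤ s)
    (hs : (s ^ 2 • (1 : Matrix m m ℝ) - X * X).PosSemidef) :
    (1 + X + Real.exp s • (X * X) - exp X).PosSemidef := by
  obtain ⟨U, h, hU, hU', hd, he⟩ := Matrix.exists_spectral X hX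
  have e := Matrix.quadratic_eq_conj X U h hU hU' hd 1 1 (Real.exp s)
  rw [one_smul, one_smul] at e
  rw [e, he, ← sub_mul, ← mul_sub, Matrix.diagonal_sub]
  refine Matrix.posSemidef_conj_diagonal _ _ fun i => ?_
  have e2 := Matrix.quadratic_eq_conj X U h hU hU' hd (s ^ 2) 0 (-1)
  have h1 := hs.conj_diag_nonneg U i
  have e3 : s ^ 2 • (1 : Matrix m m ℝ) - X * X =
      s ^ 2 • (1 : Matrix m m ℝ) + (0 : ℝ) • X + (-1 : ℝ) • (X * X) := by
    rw [zero_smul, add_zero, neg_one_smul, sub_eq_add_neg]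
  rw [e3, Matrix.conj_conj_diag _ U _ hU' e2, Matrix.diagonal_apply_eq] at h1
  have h2 : |h i| ≤ s := abs_le_of_sq_le_sq (by nlinarith) hs0
  have := Real.exp_le_one_add_add_sq (h i) s h2
  linarith

theorem Matrix.trace_exp_le_of_le_one (V : Matrix m m ℝ) (hV : V.PosSemidef)
    (hV1 : ((1 : Matrix m m ℝ) - V).PosSemidef) :
    (exp V).trace ≤ Fintype.card m + Real.exp 1 * V.trace := by
  have hsym : Vᵀ = V := by
    have := hV.1; rwa [Matrix.IsHermitian, Matrix.conjTranspose_eq_transpose_of_trivial] at this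
  obtain ⟨U, h, hU, hU', hd, he⟩ := Matrix.exists_spectral V hsym
  have htr (f : m → ℝ) : (U * Matrix.diagonal f * Uᵀ).trace = ∑ i, f i := by
    rw [Matrix.trace_mul_cycle, hU', one_mul, Matrix.trace_diagonal]
  have e : (Fintype.card m : ℝ) + Real.exp 1 * ∑ i, h i = ∑ i, (1 + Real.exp 1 * h i) := by
    rw [Finset.sum_add_distrib, Finset.mul_sum]; simp
  have etr : V.trace = ∑ i, h i := by rw [hd, htr]
  rw [he, htr, etr, e]
  refine Finset.sum_le_sum fun i _ => ?_
  have h0 : 0 ≤ h i := by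
    have := hV.conj_diag_nonneg U i
    rwa [Matrix.conj_conj_diag _ U _ hU' hd, Matrix.diagonal_apply_eq] at this
  have h1 : h i ≤ 1 := by
    have := hV1.conj_diag_nonneg U i
    have e3 : (1 : Matrix m m ℝ) - V = (1 : ℝ) • 1 + (-1 : ℝ) • V + (0 : ℝ) • (V * V) := by
      simp [sub_eq_add_neg]
    rw [e3, Matrix.conj_conj_diag _ U _ hU' (Matrix.quadratic_eq_conj V U h hU hU' hd 1 (-1) 0),
      Matrix.diagonal_apply_eq] at this
    linarith
  -- convexity of `exp` on `[0, 1]`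
  have hconv := convexOn_exp.2 (Set.mem_univ (0 : ℝ)) (Set.mem_univ (1 : ℝ))
    (show 0 ≤ 1 - h i by linarith) h0 (by ring)
  simp at hconv
  linarith

/-- Convexity of `X ↦ tr exp X`, in the form of its gradient inequality (Klein). -/
theorem Matrix.trace_exp_add_gradient_le (H Y : Matrix m m ℝ) (hH : Hᵀ = H) (hY : Yᵀ = Y) :
    (exp H).trace + (exp H * (Y - H)).trace ≤ (exp Y).trace := by
  obtain ⟨U, h, hU, hU', hd, he⟩ := Matrix.exists_spectral H hH
  have htr (f : m → ℝ) : (U * Matrix.diagonal f * Uᵀ).trace = ∑ i, f i := by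
    rw [Matrix.trace_mul_cycle, hU', one_mul, Matrix.trace_diagonal]
  have hE (Z : Matrix m m ℝ) : (exp H * Z).trace = ∑ i, Real.exp (h i) * (Uᵀ * Z * U) i i := by
    rw [he, mul_assoc, mul_assoc, Matrix.trace_mul_comm, mul_assoc]
    simp [Matrix.trace, Matrix.diagonal_mul, mul_assoc]
  have hT : (exp Y).trace = ∑ i, (Uᵀ * exp Y * U) i i := by
    rw [show ∑ i, (Uᵀ * exp Y * U) i i = (Uᵀ * exp Y * U).trace from rfl, Matrix.trace_mul_cycle,
      hU, one_mul]
  rw [hE, hT, he, htr, ← Finset.sum_add_distrib]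
  refine Finset.sum_le_sum fun i _ => ?_
  have h1 := (Matrix.posSemidef_exp_sub_tangent Y hY (h i)).conj_diag_nonneg U i
  have h2 : (Uᵀ * H * U) i i = h i := by
    rw [Matrix.conj_conj_diag _ U _ hU' hd, Matrix.diagonal_apply_eq]
  have h3 : Uᵀ * (exp Y - Real.exp (h i) • ((1 - h i) • (1 : Matrix m m ℝ) + Y)) * U =
      Uᵀ * exp Y * U - Real.exp (h i) • ((1 - h i) • (1 : Matrix m m ℝ) + Uᵀ * Y * U) := by
    simp only [mul_sub, sub_mul, mul_add, add_mul, Matrix.mul_smul, Matrix.smul_mul, mul_one, hU']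
  rw [h3] at h1
  simp only [Matrix.sub_apply, Matrix.smul_apply, Matrix.add_apply, Matrix.one_apply_eq,
    smul_eq_mul, mul_one] at h1
  rw [mul_sub, sub_mul, Matrix.sub_apply, h2]
  nlinarith

theorem Matrix.PosSemidef.transpose_eq {n : Type*} {P : Matrix n n ℝ} (hP : P.PosSemidef) :
    Pᵀ = P := by
  have := hP.1; rwa [Matrix.IsHermitian, Matrix.conjTranspose_eq_transpose_of_trivial] at this

theorem Matrix.PosSemidef.trace_mul_nonneg {P Q : Matrix m m ℝ} (hP : P.PosSemidef)
    (hQ : Q.PosSemidef) : 0 ≤ (P * Q).trace := by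
  obtain ⟨U, h, hU, hU', hd, -⟩ := Matrix.exists_spectral P hP.transpose_eq
  have h0 (i) : 0 ≤ h i := by
    have := hP.conj_diag_nonneg U i
    rwa [Matrix.conj_conj_diag _ U _ hU' hd, Matrix.diagonal_apply_eq] at this
  have : (P * Q).trace = ∑ i, h i * (Uᵀ * Q * U) i i := by
    rw [hd, mul_assoc, mul_assoc, Matrix.trace_mul_comm, mul_assoc]
    simp [Matrix.trace, Matrix.diagonal_mul, mul_assoc]
  rw [this]
  exact Finset.sum_nonneg fun i _ => mul_nonneg (h0 i) (hQ.conj_diag_nonneg U i)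

theorem Matrix.posSemidef_exp (X : Matrix m m ℝ) (hX : Xᵀ = X) : (exp X).PosSemidef := by
  obtain ⟨U, h, hU, hU', hd, he⟩ := Matrix.exists_spectral X hX
  rw [he]
  exact Matrix.posSemidef_conj_diagonal _ _ fun i => (Real.exp_pos _).le

theorem Matrix.trace_exp_mono (H Y : Matrix m m ℝ) (hH : Hᵀ = H) (hY : Yᵀ = Y)
    (h : (Y - H).PosSemidef) : (exp H).trace ≤ (exp Y).trace := by
  have h1 := Matrix.trace_exp_add_gradient_le H Y hH hY
  have h2 := (Matrix.posSemidef_exp H hH).trace_mul_nonneg h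
  linarith

theorem Matrix.PosSemidef.dotProduct_mulVec_le_trace {P : Matrix m m ℝ} (hP : P.PosSemidef)
    (z : m → ℝ) : z ⬝ᵥ P *ᵥ z ≤ P.trace * (z ⬝ᵥ z) := by
  obtain ⟨U, h, hU, hU', hd, -⟩ := Matrix.exists_spectral P hP.transpose_eq
  have h0 (i) : 0 ≤ h i := by
    have := hP.conj_diag_nonneg U i
    rwa [Matrix.conj_conj_diag _ U _ hU' hd, Matrix.diagonal_apply_eq] at this
  have h1 : z ⬝ᵥ P *ᵥ z = ∑ i, h i * ((Uᵀ *ᵥ z) i * (Uᵀ *ᵥ z) i) := by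
    have : z ⬝ᵥ P *ᵥ z = (Uᵀ *ᵥ z) ⬝ᵥ (Matrix.diagonal h *ᵥ (Uᵀ *ᵥ z)) := by
      rw [hd, ← Matrix.mulVec_mulVec, ← Matrix.mulVec_mulVec, Matrix.dotProduct_mulVec,
        ← Matrix.mulVec_transpose]
    rw [this]
    simp only [dotProduct, Matrix.mulVec_diagonal]
    exact Finset.sum_congr rfl fun i _ => by ring
  have h2 : z ⬝ᵥ z = ∑ i, (Uᵀ *ᵥ z) i * (Uᵀ *ᵥ z) i := by
    have : (Uᵀ *ᵥ z) ⬝ᵥ (Uᵀ *ᵥ z) = z ⬝ᵥ z := by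
      rw [Matrix.dotProduct_mulVec, Matrix.vecMul_transpose, Matrix.mulVec_mulVec, hU,
        Matrix.one_mulVec]
    rw [← this]; rfl
  have h3 : P.trace = ∑ i, h i := by
    rw [hd, Matrix.trace_mul_cycle, hU', one_mul, Matrix.trace_diagonal]
  rw [h1, h3, Finset.sum_mul]
  refine Finset.sum_le_sum fun i _ => mul_le_mul_of_nonneg_left ?_ (h0 i)
  rw [h2]
  exact Finset.single_le_sum (f := fun i => (Uᵀ *ᵥ z) i * (Uᵀ *ᵥ z) i)
    (fun j _ => mul_self_nonneg _) (Finset.mem_univ i)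

end Spectral

/-! ### Uniform averages -/

section Average

variable {Y Z E F : Type*} [Fintype Y] [Fintype Z] [AddCommGroup E] [Module ℝ E]
  [AddCommGroup F] [Module ℝ F]

/-- The average of `f` over a finite type, that is its expectation under the uniform law
(`0` on the empty type). -/
noncomputable def unifAvg (f : Y → E) : E := (Fintype.card Y : ℝ)⁻¹ • ∑ y, f y

theorem unifAvg_add (f g : Y → E) : unifAvg (fun y => f y + g y) = unifAvg f + unifAvg g := by
  simp [unifAvg, Finset.sum_add_distrib]

theorem unifAvg_sub (f g : Y → E) : unifAvg (fun y => f y - g y) = unifAvg f - unifAvg g := by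
  simp [unifAvg, smul_sub]

theorem unifAvg_sum {ι : Type*} (s : Finset ι) (f : ι → Y → E) :
    unifAvg (fun y => ∑ i ∈ s, f i y) = ∑ i ∈ s, unifAvg (f i) := by
  simp only [unifAvg, ← Finset.smul_sum]
  rw [Finset.sum_comm]

theorem map_unifAvg (L : E →ₗ[ℝ] F) (f : Y → E) : L (unifAvg f) = unifAvg fun y => L (f y) := by
  simp [unifAvg, map_sum]

theorem unifAvg_smul (c : ℝ) (f : Y → E) : unifAvg (fun y => c • f y) = c • unifAvg f :=
  (map_unifAvg (LinearMap.lsmul ℝ E c) f).symm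

theorem unifAvg_mul_left (c : ℝ) (f : Y → ℝ) : unifAvg (fun y => c * f y) = c * unifAvg f :=
  unifAvg_smul c f

theorem unifAvg_mul_right (c : ℝ) (f : Y → ℝ) : unifAvg (fun y => f y * c) = unifAvg f * c := by
  simp only [mul_comm _ c, unifAvg_mul_left]

theorem unifAvg_const [Nonempty Y] (c : E) : unifAvg (fun _ : Y => c) = c := by
  have : (Fintype.card Y : ℝ) ≠ 0 := by positivity
  rw [unifAvg, Finset.sum_const, Finset.card_univ, ← Nat.cast_smul_eq_nsmul ℝ, smul_smul,
    inv_mul_cancel₀ this, one_smul]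

theorem unifAvg_mono {f g : Y → ℝ} (h : ∀ y, f y ≤ g y) : unifAvg f ≤ unifAvg g := by
  simp only [unifAvg, smul_eq_mul]
  gcongr
  exact h _

theorem unifAvg_nonneg {f : Y → ℝ} (h : ∀ y, 0 ≤ f y) : 0 ≤ unifAvg f := by
  simp only [unifAvg, smul_eq_mul]
  exact mul_nonneg (by positivity) (Finset.sum_nonneg fun y _ => h y)

theorem unifAvg_le_of_le {f : Y → ℝ} {c : ℝ} [Nonempty Y] (h : ∀ y, f y ≤ c) : unifAvg f ≤ c :=
  (unifAvg_mono h).trans_eq (unifAvg_const c)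

theorem unifAvg_equiv (e : Y ≃ Z) (f : Z → E) : unifAvg (fun y => f (e y)) = unifAvg f := by
  rw [unifAvg, unifAvg, Fintype.card_congr e, e.sum_comp]

theorem unifAvg_prod (f : Y × Z → E) : unifAvg f = unifAvg fun y => unifAvg fun z => f (y, z) := by
  simp only [unifAvg, Fintype.sum_prod_type, Fintype.card_prod, ← Finset.smul_sum, smul_smul]
  rw [Nat.cast_mul, mul_inv]

theorem unifAvg_comm (f : Y → Z → E) :
    (unifAvg fun y => unifAvg fun z => f y z) = unifAvg fun z => unifAvg fun y => f y z := by
  simp only [unifAvg, ← Finset.smul_sum, smul_smul]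
  rw [Finset.sum_comm, mul_comm]

/-- Resampling one coordinate does not change a uniform average. -/
theorem unifAvg_update {I : Type*} [Fintype I] [DecidableEq I] [Nonempty Y] (a : I)
    (f : (I → Y) → E) :
    unifAvg f = unifAvg fun ω => unifAvg fun y => f (Function.update ω a y) := by
  let e : (I → Y) × Y ≃ (I → Y) × Y :=
    { toFun := fun p => (Function.update p.1 a p.2, p.1 a)
      invFun := fun p => (Function.update p.1 a p.2, p.1 a)
      left_inv := fun p => by simp
      right_inv := fun p => by simp }
  have h1 := unifAvg_equiv e (fun p => f p.1)
  rw [unifAvg_prod, unifAvg_prod] at h1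
  simp only [unifAvg_const] at h1
  exact h1.symm

theorem posSemidef_unifAvg {n : Type*} [Fintype n] {f : Y → Matrix n n ℝ}
    (h : ∀ y, (f y).PosSemidef) : (unifAvg f).PosSemidef :=
  (Matrix.posSemidef_sum _ fun y _ => h y).smul (by positivity)

end Average

/-! ### Matrix Bennett inequality -/

section Bennett

open NormedSpace

variable {m : Type*} [Fintype m] [DecidableEq m] {I Y : Type*} [Fintype I] [DecidableEq I]
  [Fintype Y] [Nonempty Y]

theorem transpose_unifAvg {Y n : Type*} [Fintype Y] (f : Y → Matrix n n ℝ) :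
    (unifAvg f)ᵀ = unifAvg fun y => (f y)ᵀ := by
  simp [unifAvg, Matrix.transpose_sum]

omit [DecidableEq m] in
theorem trace_unifAvg {Y : Type*} [Fintype Y] (f : Y → Matrix m m ℝ) :
    (unifAvg f).trace = unifAvg fun y => (f y).trace :=
  map_unifAvg (Matrix.traceLinearMap m ℝ ℝ) f

omit [Nonempty Y] in
/-- One step of the matrix Laplace transform method. Golden–Thompson moves the average onto
`exp X`, and convexity of `tr exp` moves `𝔼 exp X - 1` back into the exponent. -/
theorem unifAvg_trace_exp_add_le (H : Matrix m m ℝ) (hH : Hᵀ = H) (X : Y → Matrix m m ℝ)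
    (hX : ∀ y, (X y)ᵀ = X y) :
    (unifAvg fun y => (exp (H + X y)).trace) ≤
      (exp (H + ((unifAvg fun y => exp (X y)) - 1))).trace := by
  set B := (unifAvg fun y => exp (X y)) - 1 with hB
  have hBs : Bᵀ = B := by
    rw [hB, Matrix.transpose_sub, transpose_unifAvg, Matrix.transpose_one]
    simp only [← Matrix.exp_transpose, hX]
  calc (unifAvg fun y => (exp (H + X y)).trace)
      ≤ unifAvg fun y => (exp H * exp (X y)).trace :=
        unifAvg_mono fun y => Matrix.trace_exp_add_le H (X y) hH (hX y)
    _ = (exp H * (1 + B)).trace := by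
        rw [hB, add_sub_cancel, ← trace_unifAvg]
        congr 1
        exact (map_unifAvg (LinearMap.mulLeft ℝ (exp H)) fun y => exp (X y)).symm
    _ = (exp H).trace + (exp H * ((H + B) - H)).trace := by
        rw [mul_add, Matrix.trace_add, mul_one, add_sub_cancel_left]
    _ ≤ _ := Matrix.trace_exp_add_gradient_le H (H + B) hH (by rw [Matrix.transpose_add, hH, hBs])

/-- Matrix Laplace transform bound for a sum of independent symmetric matrices. -/
theorem unifAvg_trace_exp_sum_le (X : I → Y → Matrix m m ℝ) (hX : ∀ k y, (X k y)ᵀ = X k y)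
    (s : Finset I) (H : Matrix m m ℝ) (hH : Hᵀ = H) :
    (unifAvg fun ω : I → Y => (exp (H + ∑ k ∈ s, X k (ω k))).trace) ≤
      (exp (H + ∑ k ∈ s, ((unifAvg fun y => exp (X k y)) - 1))).trace := by
  induction s using Finset.induction_on generalizing H with
  | empty => simp [unifAvg_const]
  | insert a s ha ih =>
    set B := (unifAvg fun y => exp (X a y)) - 1 with hB
    have hBs : Bᵀ = B := by
      rw [hB, Matrix.transpose_sub, transpose_unifAvg, Matrix.transpose_one]
      simp only [← Matrix.exp_transpose, hX]
    rw [unifAvg_update a]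
    have h1 (ω : I → Y) (y : Y) : H + ∑ k ∈ insert a s, X k (Function.update ω a y k) =
        (H + ∑ k ∈ s, X k (ω k)) + X a y := by
      rw [Finset.sum_insert ha, Function.update_self, add_comm (X a y), ← add_assoc]
      congr 2
      refine Finset.sum_congr rfl fun k hk => ?_
      rw [Function.update_of_ne (by rintro rfl; exact ha hk)]
    simp only [h1]
    have h2 (ω : I → Y) : (H + ∑ k ∈ s, X k (ω k))ᵀ = H + ∑ k ∈ s, X k (ω k) := by
      rw [Matrix.transpose_add, hH, Matrix.transpose_sum]; simp only [hX]
    have h3 (ω : I → Y) :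
        (unifAvg fun y => (exp (H + ∑ k ∈ s, X k (ω k) + X a y)).trace) ≤
          (exp (H + B + ∑ k ∈ s, X k (ω k))).trace := by
      have := unifAvg_trace_exp_add_le _ (h2 ω) (X a) (hX a)
      rwa [← hB, add_right_comm] at this
    refine (unifAvg_mono h3).trans ?_
    rw [Finset.sum_insert ha, ← hB, ← add_assoc]
    exact ih (H + B) (by rw [Matrix.transpose_add, hH, hBs])

variable {p q : Type*} [Fintype p] [Fintype q] [DecidableEq p] [DecidableEq q]

/-- The symmetric dilation of a rectangular matrix. -/
def dilation {p q : Type*} (M : Matrix p q ℝ) : Matrix (p ⊕ q) (p ⊕ q) ℝ :=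
  Matrix.fromBlocks 0 M Mᵀ 0

theorem dilation_transpose {p q : Type*} (M : Matrix p q ℝ) : (dilation M)ᵀ = dilation M := by
  simp [dilation, Matrix.fromBlocks_transpose]

/-- The symmetric dilation as a linear map. -/
def dilationLin (p q : Type*) : Matrix p q ℝ →ₗ[ℝ] Matrix (p ⊕ q) (p ⊕ q) ℝ where
  toFun := dilation
  map_add' M N := by simp [dilation, Matrix.fromBlocks_add]
  map_smul' c M := by simp [dilation, Matrix.fromBlocks_smul]

omit [DecidableEq p] [DecidableEq q] in
theorem trace_dilation (M : Matrix p q ℝ) : (dilation M).trace = 0 := by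
  simp [dilation, Matrix.trace, Matrix.diag]

theorem dilation_mul_self {p q : Type*} [Fintype p] [Fintype q] (M : Matrix p q ℝ) :
    dilation M * dilation M = Matrix.fromBlocks (M * Mᵀ) 0 0 (Mᵀ * M) := by
  simp [dilation, Matrix.fromBlocks_multiply]

omit [DecidableEq p] [DecidableEq q] in
theorem posSemidef_fromBlocks_diag {A : Matrix p p ℝ} {D : Matrix q q ℝ} (hA : A.PosSemidef)
    (hD : D.PosSemidef) : (Matrix.fromBlocks A 0 0 D).PosSemidef := by
  refine Matrix.PosSemidef.of_dotProduct_mulVec_nonneg ?_ fun x => ?_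
  · rw [Matrix.IsHermitian, Matrix.fromBlocks_conjTranspose, hA.1, hD.1]; simp
  · rw [← Sum.elim_comp_inl_inr x, Matrix.fromBlocks_mulVec]
    simp only [star_trivial, Matrix.zero_mulVec, add_zero, zero_add]
    rw [sumElim_dotProduct_sumElim]
    have h1 := hA.dotProduct_mulVec_nonneg (x ∘ Sum.inl)
    have h2 := hD.dotProduct_mulVec_nonneg (x ∘ Sum.inr)
    simp only [star_trivial] at h1 h2
    simpa using add_nonneg h1 h2

theorem dotProduct_self_eq_norm_sq {n : Type*} [Fintype n] (y : n → ℝ) :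
    y ⬝ᵥ y = ‖(WithLp.toLp 2 y : EuclideanSpace ℝ n)‖ ^ 2 := by
  rw [EuclideanSpace.real_norm_sq_eq]; simp [dotProduct, pow_two]

theorem dotProduct_self_mulVec_le {p q : Type*} [Fintype p] [Fintype q] [DecidableEq q]
    (M : Matrix p q ℝ) (x : q → ℝ) : (M *ᵥ x) ⬝ᵥ (M *ᵥ x) ≤ ‖M‖ ^ 2 * (x ⬝ᵥ x) := by
  have h := Matrix.l2_opNorm_mulVec M (WithLp.toLp 2 x)
  have h1 := pow_le_pow_left₀ (norm_nonneg _) h 2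
  rw [mul_pow] at h1
  rw [dotProduct_self_eq_norm_sq, dotProduct_self_eq_norm_sq]
  exact h1

theorem norm_le_of_dotProduct_self_mulVec_le {p q : Type*} [Fintype p] [Fintype q] [DecidableEq q]
    (M : Matrix p q ℝ) (t : ℝ) (ht : 0 ≤ t)
    (h : ∀ x, (M *ᵥ x) ⬝ᵥ (M *ᵥ x) ≤ t ^ 2 * (x ⬝ᵥ x)) : ‖M‖ ≤ t := by
  rw [Matrix.l2_opNorm_def]
  refine ContinuousLinearMap.opNorm_le_bound _ ht fun x => ?_
  refine le_of_sq_le_sq ?_ (by positivity)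
  have := h (WithLp.ofLp x)
  rw [dotProduct_self_eq_norm_sq, dotProduct_self_eq_norm_sq] at this
  rw [mul_pow]
  exact this

theorem l2_opNorm_transpose (M : Matrix p q ℝ) : ‖Mᵀ‖ = ‖M‖ := by
  have := Matrix.l2_opNorm_conjTranspose M
  rwa [Matrix.conjTranspose_eq_transpose_of_trivial] at this

omit [DecidableEq p] in
theorem posSemidef_smul_one_sub_transpose_mul (M : Matrix p q ℝ) (L : ℝ) (h : ‖M‖ ≤ L) :
    (L ^ 2 • (1 : Matrix q q ℝ) - Mᵀ * M).PosSemidef := by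
  refine Matrix.PosSemidef.of_dotProduct_mulVec_nonneg ?_ fun x => ?_
  · rw [Matrix.IsHermitian, Matrix.conjTranspose_eq_transpose_of_trivial]; simp
  · have h1 := dotProduct_self_mulVec_le M x
    have h0 : 0 ≤ x ⬝ᵥ x := Finset.sum_nonneg fun i _ => mul_self_nonneg _
    have h2 : ‖M‖ ^ 2 ≤ L ^ 2 := pow_le_pow_left₀ (norm_nonneg _) h 2
    have h3 : (M *ᵥ x) ⬝ᵥ (M *ᵥ x) = x ⬝ᵥ (Mᵀ * M) *ᵥ x := by
      rw [Matrix.dotProduct_mulVec, Matrix.vecMul_mulVec, ← Matrix.dotProduct_mulVec]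
    rw [star_trivial, Matrix.sub_mulVec, dotProduct_sub, Matrix.smul_mulVec, dotProduct_smul,
      Matrix.one_mulVec, smul_eq_mul, ← h3]
    nlinarith

theorem posSemidef_smul_one_sub_dilation_sq (M : Matrix p q ℝ) (L : ℝ) (h : ‖M‖ ≤ L) :
    (L ^ 2 • (1 : Matrix (p ⊕ q) (p ⊕ q) ℝ) - dilation M * dilation M).PosSemidef := by
  have e : L ^ 2 • (1 : Matrix (p ⊕ q) (p ⊕ q) ℝ) - dilation M * dilation M =
      Matrix.fromBlocks (L ^ 2 • 1 - M * Mᵀ) 0 0 (L ^ 2 • 1 - Mᵀ * M) := by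
    rw [dilation_mul_self, ← Matrix.fromBlocks_one, Matrix.fromBlocks_smul, sub_eq_add_neg,
      Matrix.fromBlocks_neg, Matrix.fromBlocks_add]
    simp [sub_eq_add_neg]
  rw [e]
  refine posSemidef_fromBlocks_diag ?_ (posSemidef_smul_one_sub_transpose_mul M L h)
  have := posSemidef_smul_one_sub_transpose_mul Mᵀ L (by rwa [l2_opNorm_transpose])
  rwa [Matrix.transpose_transpose] at this

/-- A large operator norm makes the trace exponential of the dilation large; subtracting the
dimension is what makes the resulting tail bound independent of the number of rows. -/
theorem exp_sub_le_trace_exp_dilation (M : Matrix p q ℝ) (θ t : ℝ) (hθ : 0 < θ) (ht : 0 ≤ t)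
    (h : t < ‖M‖) :
    Real.exp (θ * t) - 1 - θ * t ≤ (exp (θ • dilation M)).trace - Fintype.card (p ⊕ q) := by
  obtain ⟨x, hx⟩ : ∃ x, t ^ 2 * (x ⬝ᵥ x) < (M *ᵥ x) ⬝ᵥ (M *ᵥ x) := by
    by_contra! hcon
    exact absurd (norm_le_of_dotProduct_self_mulVec_le M t ht hcon) (not_le.2 h)
  set a := √((M *ᵥ x) ⬝ᵥ (M *ᵥ x)) with ha
  set c := √(x ⬝ᵥ x) with hc
  have hxx : 0 ≤ x ⬝ᵥ x := Finset.sum_nonneg fun i _ => mul_self_nonneg _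
  have hMM : 0 ≤ (M *ᵥ x) ⬝ᵥ (M *ᵥ x) := Finset.sum_nonneg fun i _ => mul_self_nonneg _
  have ha2 : (M *ᵥ x) ⬝ᵥ (M *ᵥ x) = a ^ 2 := (Real.sq_sqrt hMM).symm
  have hc2 : x ⬝ᵥ x = c ^ 2 := (Real.sq_sqrt hxx).symm
  have hapos : 0 < a := Real.sqrt_pos.2 (lt_of_le_of_lt (by positivity) hx)
  have hcpos : 0 < c := by
    refine Real.sqrt_pos.2 (lt_of_le_of_ne hxx fun h0 => ?_)
    have : x = 0 := dotProduct_self_eq_zero.1 h0.symm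
    rw [this] at hx
    simp at hx
  have hlt : t * c < a := by
    rw [ha2, hc2, ← mul_pow] at hx
    exact lt_of_pow_lt_pow_left₀ 2 hapos.le hx
  set lam := a / c with hlam
  have htl : t ≤ lam := by rw [hlam, le_div_iff₀ hcpos]; exact hlt.le
  set z : p ⊕ q → ℝ := Sum.elim (a⁻¹ • (M *ᵥ x)) (c⁻¹ • x) with hz
  have hzz : z ⬝ᵥ z = 2 := by
    rw [hz, sumElim_dotProduct_sumElim]
    simp only [smul_dotProduct, dotProduct_smul, ha2, hc2, smul_eq_mul]
    field_simp; norm_num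
  have hDz : z ⬝ᵥ dilation M *ᵥ z = 2 * lam := by
    rw [hz, dilation, Matrix.fromBlocks_mulVec]
    simp only [Sum.elim_comp_inl, Sum.elim_comp_inr, Matrix.zero_mulVec, add_zero, zero_add]
    rw [sumElim_dotProduct_sumElim]
    have e1 : x ⬝ᵥ Mᵀ *ᵥ (M *ᵥ x) = a ^ 2 := by
      rw [← ha2, Matrix.dotProduct_mulVec, Matrix.vecMul_transpose]
    simp only [Matrix.mulVec_smul, smul_dotProduct, dotProduct_smul, ha2, e1, smul_eq_mul, hlam]
    field_simp; norm_num
  have hsym : (θ • dilation M)ᵀ = θ • dilation M := by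
    rw [Matrix.transpose_smul, dilation_transpose]
  set D := θ • dilation M with hD
  have hDz' : z ⬝ᵥ D *ᵥ z = 2 * (θ * lam) := by
    rw [hD, Matrix.smul_mulVec, dotProduct_smul, hDz, smul_eq_mul]; ring
  have h1 := (Matrix.posSemidef_exp_sub_tangent D hsym (θ * lam)).dotProduct_mulVec_nonneg z
  rw [star_trivial, Matrix.sub_mulVec, dotProduct_sub, Matrix.smul_mulVec, dotProduct_smul,
    Matrix.add_mulVec, dotProduct_add, Matrix.smul_mulVec, dotProduct_smul, Matrix.one_mulVec,
    hzz, hDz'] at h1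
  simp only [smul_eq_mul] at h1
  have hP := Matrix.posSemidef_exp_sub_tangent D hsym 0
  rw [Real.exp_zero, one_smul, sub_zero, one_smul] at hP
  have h2 := hP.dotProduct_mulVec_le_trace z
  rw [Matrix.sub_mulVec, dotProduct_sub, Matrix.add_mulVec, dotProduct_add, Matrix.one_mulVec,
    hzz, hDz', Matrix.trace_sub, Matrix.trace_add, Matrix.trace_one, hD, Matrix.trace_smul,
    trace_dilation, smul_zero, ← hD] at h2
  -- `x ↦ exp x - 1 - x` is monotone on the nonnegative reals
  have h3 : Real.exp (θ * t) - 1 - θ * t ≤ Real.exp (θ * lam) - 1 - θ * lam := by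
    have hle : θ * t ≤ θ * lam := mul_le_mul_of_nonneg_left htl hθ.le
    have e1 := Real.add_one_le_exp (θ * lam - θ * t)
    have e2 : Real.exp (θ * lam) = Real.exp (θ * t) * Real.exp (θ * lam - θ * t) := by
      rw [← Real.exp_add]; congr 1; ring
    have e3 : 1 ≤ Real.exp (θ * t) := Real.one_le_exp (by positivity)
    rw [e2]
    nlinarith
  linarith

end Bennett

section BennettTail

open NormedSpace

variable {I Y : Type*} [Fintype I] [DecidableEq I] [Fintype Y] [Nonempty Y]
  {p q : Type*} [Fintype p] [Fintype q] [DecidableEq p] [DecidableEq q]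

theorem dotProduct_unifAvg_mulVec {Y n : Type*} [Fintype Y] [Fintype n] (f : Y → Matrix n n ℝ)
    (x : n → ℝ) : x ⬝ᵥ unifAvg f *ᵥ x = unifAvg fun y => x ⬝ᵥ f y *ᵥ x := by
  simp only [unifAvg, Matrix.smul_mulVec, Matrix.sum_mulVec, dotProduct_smul, dotProduct_sum]

omit [DecidableEq p] [DecidableEq q] in
theorem dotProduct_dilation_sq_mulVec (M : Matrix p q ℝ) (x : p ⊕ q → ℝ) :
    x ⬝ᵥ (dilation M * dilation M) *ᵥ x =
      (Mᵀ *ᵥ (x ∘ Sum.inl)) ⬝ᵥ (Mᵀ *ᵥ (x ∘ Sum.inl)) +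
        (M *ᵥ (x ∘ Sum.inr)) ⬝ᵥ (M *ᵥ (x ∘ Sum.inr)) := by
  conv_lhs => rw [← Sum.elim_comp_inl_inr x]
  rw [dilation_mul_self, Matrix.fromBlocks_mulVec, sumElim_dotProduct_sumElim]
  simp only [Sum.elim_comp_inl, Sum.elim_comp_inr, Matrix.zero_mulVec, add_zero, zero_add]
  congr 1
  · rw [← Matrix.mulVec_mulVec, Matrix.dotProduct_mulVec, ← Matrix.mulVec_transpose]
  · rw [← Matrix.mulVec_mulVec, Matrix.dotProduct_mulVec, Matrix.vecMul_transpose]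

omit [Nonempty Y] [DecidableEq I] in
/-- Bound on the trace exponential of the compensator. Here the sum of the squares is the
compensator; its trace, and not the dimension `p + q`, controls the excess over the dimension. -/
theorem trace_exp_compensator_le (A : I → Y → Matrix p q ℝ) (c v w : ℝ) (hc : 0 ≤ c)
    (hcv : c * v ≤ 1)
    (h1 : ∀ x, ∑ k, unifAvg (fun y => ((A k y)ᵀ *ᵥ x) ⬝ᵥ ((A k y)ᵀ *ᵥ x)) ≤ v * (x ⬝ᵥ x))
    (h2 : ∀ x, ∑ k, unifAvg (fun y => (A k y *ᵥ x) ⬝ᵥ (A k y *ᵥ x)) ≤ v * (x ⬝ᵥ x))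
    (hw : ∑ k, unifAvg (fun y => (A k y * (A k y)ᵀ).trace) ≤ w) :
    (exp (c • ∑ k, unifAvg fun y => dilation (A k y) * dilation (A k y))).trace ≤
      Fintype.card (p ⊕ q) + Real.exp 1 * (c * (2 * w)) := by
  set V := c • ∑ k, unifAvg fun y => dilation (A k y) * dilation (A k y) with hV
  have hsq (k y) : (dilation (A k y) * dilation (A k y)).PosSemidef := by
    have := Matrix.posSemidef_self_mul_conjTranspose (dilation (A k y))
    rwa [Matrix.conjTranspose_eq_transpose_of_trivial, dilation_transpose] at this
  have hVp : V.PosSemidef :=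
    (Matrix.posSemidef_sum _ fun k _ => posSemidef_unifAvg (hsq k)).smul hc
  have hq (x : p ⊕ q → ℝ) : x ⬝ᵥ V *ᵥ x ≤ x ⬝ᵥ x := by
    rw [hV, Matrix.smul_mulVec, Matrix.sum_mulVec, dotProduct_smul, dotProduct_sum]
    simp only [dotProduct_unifAvg_mulVec, dotProduct_dilation_sq_mulVec, unifAvg_add,
      Finset.sum_add_distrib]
    have hx : x ⬝ᵥ x = (x ∘ Sum.inl) ⬝ᵥ (x ∘ Sum.inl) + (x ∘ Sum.inr) ⬝ᵥ (x ∘ Sum.inr) := by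
      conv_lhs => rw [← Sum.elim_comp_inl_inr x, sumElim_dotProduct_sumElim]
    have a1 := h1 (x ∘ Sum.inl)
    have a2 := h2 (x ∘ Sum.inr)
    have a3 : 0 ≤ x ⬝ᵥ x := Finset.sum_nonneg fun i _ => mul_self_nonneg _
    rw [smul_eq_mul]
    calc _ ≤ c * (v * (x ⬝ᵥ x)) := by
          refine mul_le_mul_of_nonneg_left ?_ hc
          rw [hx, mul_add]; exact add_le_add a1 a2
      _ = (c * v) * (x ⬝ᵥ x) := by ring
      _ ≤ 1 * (x ⬝ᵥ x) := mul_le_mul_of_nonneg_right hcv a3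
      _ = _ := one_mul _
  have h1V : ((1 : Matrix (p ⊕ q) (p ⊕ q) ℝ) - V).PosSemidef := by
    refine Matrix.PosSemidef.of_dotProduct_mulVec_nonneg (Matrix.isHermitian_one.sub hVp.1) fun x => ?_
    rw [star_trivial, Matrix.sub_mulVec, dotProduct_sub, Matrix.one_mulVec]
    linarith [hq x]
  refine (Matrix.trace_exp_le_of_le_one V hVp h1V).trans ?_
  have htr : V.trace = c * (2 * ∑ k, unifAvg (fun y => (A k y * (A k y)ᵀ).trace)) := by
    rw [hV, Matrix.trace_smul, Matrix.trace_sum, smul_eq_mul, Finset.mul_sum _ _ (2 : ℝ)]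
    refine congrArg (c * ·) ?_
    refine Finset.sum_congr rfl fun k _ => ?_
    rw [trace_unifAvg, ← unifAvg_mul_left 2]
    refine congrArg (unifAvg (E := ℝ)) (funext fun y => ?_)
    rw [dilation_mul_self, Matrix.trace, Fintype.sum_sum_type]
    simp only [Matrix.diag, Matrix.fromBlocks_apply₁₁, Matrix.fromBlocks_apply₂₂]
    have : ((A k y)ᵀ * A k y).trace = (A k y * (A k y)ᵀ).trace := Matrix.trace_mul_comm _ _
    simp only [Matrix.trace, Matrix.diag] at this ⊢
    rw [this, two_mul]
  rw [htr]
  gcongr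

/-- **Matrix Bennett inequality**, with intrinsic dimension: the operator norm of a sum of
independent centered matrices, each of norm at most `L`, with row and column variances at most `v`
and total variance at most `w`. -/
theorem matrix_bennett (A : I → Y → Matrix p q ℝ) (L v w t : ℝ) (hL : 0 < L) (hv : 0 < v)
    (hvL : v < L ^ 2) (ht0 : 0 ≤ t) (ht : 4 * L ≤ t * Real.log (L ^ 2 / v))
    (h0 : ∀ k, unifAvg (A k) = 0) (hA : ∀ k y, ‖A k y‖ ≤ L)
    (h1 : ∀ x, ∑ k, unifAvg (fun y => ((A k y)ᵀ *ᵥ x) ⬝ᵥ ((A k y)ᵀ *ᵥ x)) ≤ v * (x ⬝ᵥ x))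
    (h2 : ∀ x, ∑ k, unifAvg (fun y => (A k y *ᵥ x) ⬝ᵥ (A k y *ᵥ x)) ≤ v * (x ⬝ᵥ x))
    (hw : ∑ k, unifAvg (fun y => (A k y * (A k y)ᵀ).trace) ≤ w) :
    (unifAvg fun ω : I → Y => if t < ‖∑ k, A k (ω k)‖ then (1 : ℝ) else 0) ≤
      8 * Real.exp 1 * (w / v) * (v / L ^ 2) ^ (t / (2 * L)) := by
  set ℓ := Real.log (L ^ 2 / v) with hℓ
  have hL2 : 0 < L ^ 2 := by positivity
  have hratio : 1 < L ^ 2 / v := by rw [lt_div_iff₀ hv]; linarith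
  have hℓpos : 0 < ℓ := Real.log_pos hratio
  have hexpℓ : Real.exp ℓ = L ^ 2 / v := Real.exp_log (by positivity)
  -- the choice `s = θ L = ℓ / 2` balances `exp (2 s) v = L ^ 2`
  set s := ℓ / 2 with hs
  have hspos : 0 < s := by positivity
  set θ := s / L with hθ
  have hθpos : 0 < θ := by positivity
  have hθL : θ * L = s := by rw [hθ]; field_simp
  set c := Real.exp s * θ ^ 2 with hc
  have hcpos : 0 < c := by positivity
  have hcv : c * v ≤ 1 := by
    have e1 : s ^ 2 ≤ Real.exp s := by
      have := Real.quadratic_le_exp_of_nonneg (show 0 ≤ s / 2 by positivity)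
      have h5 : s ≤ Real.exp (s / 2) := by nlinarith [sq_nonneg (s / 2 - 1)]
      have h6 : Real.exp s = Real.exp (s / 2) ^ 2 := by
        rw [← Real.exp_nat_mul]; congr 1; push_cast; ring
      rw [h6]; exact pow_le_pow_left₀ hspos.le h5 2
    have e2 : Real.exp s * Real.exp s = L ^ 2 / v := by
      rw [← Real.exp_add, ← hexpℓ]; congr 1; rw [hs]; ring
    have e3 : Real.exp s * s ^ 2 ≤ L ^ 2 / v := by
      rw [← e2]; gcongr
    have e4 : c * v = (Real.exp s * s ^ 2) * v / L ^ 2 := by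
      rw [hc, hθ]; field_simp
    rw [e4, div_le_one hL2]
    calc Real.exp s * s ^ 2 * v ≤ L ^ 2 / v * v := by gcongr
      _ = L ^ 2 := by field_simp
  obtain ⟨D, hD⟩ : ∃ D : I → Y → Matrix (p ⊕ q) (p ⊕ q) ℝ,
      D = fun k y => θ • dilation (A k y) := ⟨_, rfl⟩
  have hDs (k y) : (D k y)ᵀ = D k y := by
    rw [hD]; simp only [Matrix.transpose_smul, dilation_transpose]
  have hDD (k y) : D k y * D k y = θ ^ 2 • (dilation (A k y) * dilation (A k y)) := by
    rw [hD]; simp only [Matrix.smul_mul, Matrix.mul_smul, smul_smul, pow_two]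
  have hDavg (k) : unifAvg (D k) = 0 := by
    have e1 := map_unifAvg (dilationLin p q) (A k)
    rw [h0, map_zero] at e1
    rw [hD]
    change unifAvg (fun y => θ • dilationLin p q (A k y)) = 0
    rw [unifAvg_smul, ← e1, smul_zero]
  set V := c • ∑ k, unifAvg fun y => dilation (A k y) * dilation (A k y) with hV
  have hVs : Vᵀ = V := by
    rw [hV, Matrix.transpose_smul, Matrix.transpose_sum]
    simp only [transpose_unifAvg, Matrix.transpose_mul, dilation_transpose]
  have hBs : (∑ k, ((unifAvg fun y => exp (D k y)) - 1))ᵀ =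
      ∑ k, ((unifAvg fun y => exp (D k y)) - 1) := by
    rw [Matrix.transpose_sum]
    simp only [Matrix.transpose_sub, transpose_unifAvg, Matrix.transpose_one,
      ← Matrix.exp_transpose, hDs]
  have hVB : (V - ∑ k, ((unifAvg fun y => exp (D k y)) - 1)).PosSemidef := by
    have hk (k) : (Real.exp s • (unifAvg fun y => D k y * D k y) -
        ((unifAvg fun y => exp (D k y)) - 1)).PosSemidef := by
      have e1 : ∀ y, (1 + D k y + Real.exp s • (D k y * D k y) - exp (D k y)).PosSemidef := by
        intro y
        refine Matrix.posSemidef_quadratic_sub_exp (D k y) (hDs k y) s hspos.le ?_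
        have := (posSemidef_smul_one_sub_dilation_sq (A k y) L (hA k y)).smul (sq_nonneg θ)
        rwa [smul_sub, smul_smul, ← mul_pow, hθL, ← hDD] at this
      have e2 := posSemidef_unifAvg e1
      rw [unifAvg_sub, unifAvg_add, unifAvg_add, unifAvg_const, unifAvg_smul] at e2
      have e3 : (unifAvg fun y => D k y) = 0 := hDavg k
      rw [e3, add_zero] at e2
      convert e2 using 1
      abel
    have := Matrix.posSemidef_sum Finset.univ fun k _ => hk k
    rw [Finset.sum_sub_distrib] at this
    convert this using 2
    rw [hV, hc, ← Finset.smul_sum, mul_smul, Finset.smul_sum]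
    congr 1
    refine Finset.sum_congr rfl fun k _ => ?_
    simp only [hDD, unifAvg_smul]
  have hmgf : (unifAvg fun ω : I → Y => (exp (∑ k, D k (ω k))).trace) ≤
      Fintype.card (p ⊕ q) + Real.exp 1 * (c * (2 * w)) := by
    have e1 := unifAvg_trace_exp_sum_le D hDs Finset.univ 0 Matrix.transpose_zero
    simp only [zero_add] at e1
    refine e1.trans ((Matrix.trace_exp_mono _ V hBs hVs hVB).trans ?_)
    exact trace_exp_compensator_le A c v w hcpos.le hcv h1 h2 hw
  have hsum (ω : I → Y) : ∑ k, D k (ω k) = θ • dilation (∑ k, A k (ω k)) := by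
    have := map_sum (dilationLin p q) (fun k => A k (ω k)) Finset.univ
    rw [hD, ← Finset.smul_sum]
    exact congrArg _ this.symm
  have hθt : 2 ≤ θ * t := by
    have : θ * t = t * ℓ / (2 * L) := by rw [hθ, hs]; field_simp
    rw [this, le_div_iff₀ (by positivity)]; linarith
  -- for `x ≥ 2` one has `exp x - 1 - x ≥ exp x / 4`
  have hquarter : Real.exp (θ * t) / 4 ≤ Real.exp (θ * t) - 1 - θ * t := by
    have := Real.quadratic_le_exp_of_nonneg (show 0 ≤ θ * t by positivity)
    nlinarith
  have hpt (ω : I → Y) : Real.exp (θ * t) / 4 * (if t < ‖∑ k, A k (ω k)‖ then (1 : ℝ) else 0) ≤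
      (exp (∑ k, D k (ω k))).trace - Fintype.card (p ⊕ q) := by
    rw [hsum]
    split_ifs with h
    · rw [mul_one]
      exact hquarter.trans (exp_sub_le_trace_exp_dilation _ θ t hθpos ht0 h)
    · rw [mul_zero]
      have hsym : (θ • dilation (∑ k, A k (ω k)))ᵀ = θ • dilation (∑ k, A k (ω k)) := by
        rw [Matrix.transpose_smul, dilation_transpose]
      have := (Matrix.posSemidef_exp_sub_tangent _ hsym 0).trace_nonneg
      rw [Real.exp_zero, one_smul, sub_zero, one_smul, Matrix.trace_sub, Matrix.trace_add,
        Matrix.trace_one, Matrix.trace_smul, trace_dilation, smul_zero, add_zero] at this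
      exact this
  have hfin := unifAvg_mono hpt
  rw [unifAvg_mul_left, unifAvg_sub, unifAvg_const] at hfin
  have hw0 : 0 ≤ w := le_trans (Finset.sum_nonneg fun k _ => unifAvg_nonneg fun y => by
    have := (Matrix.posSemidef_self_mul_conjTranspose (A k y)).trace_nonneg
    rwa [Matrix.conjTranspose_eq_transpose_of_trivial] at this) hw
  have hexp : (v / L ^ 2) ^ (t / (2 * L)) = (Real.exp (θ * t))⁻¹ := by
    rw [show v / L ^ 2 = (L ^ 2 / v)⁻¹ by rw [inv_div], ← hexpℓ, ← Real.exp_neg, ← Real.exp_mul,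
      ← Real.exp_neg]
    congr 1
    rw [hθ, hs]; field_simp
  have hcw : c * w ≤ w / v := by
    rw [le_div_iff₀ hv]
    nlinarith [mul_le_mul_of_nonneg_right hcv hw0]
  rw [hexp]
  set P := unifAvg fun ω : I → Y => if t < ‖∑ k, A k (ω k)‖ then (1 : ℝ) else 0
  have he := Real.exp_pos (θ * t)
  have h8 : Real.exp (θ * t) * P ≤ 8 * Real.exp 1 * (w / v) := by
    have := Real.exp_pos 1
    nlinarith
  rw [← div_eq_mul_inv, le_div_iff₀ he, mul_comm]
  exact h8

end BennettTail

/-! ### Random signed sums of rank-one matrices -/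

section RankOne

variable {p q : Type*} [Fintype p] [Fintype q] [DecidableEq p] [DecidableEq q]

/-- The sign `±1` encoded by a Boolean. -/
def boolSign (s : Bool) : ℝ := if s then 1 else -1

theorem boolSign_mul_self (s : Bool) : boolSign s * boolSign s = 1 := by
  cases s <;> simp [boolSign]

theorem unifAvg_boolSign : unifAvg boolSign = 0 := by
  simp [unifAvg, boolSign]

omit [DecidableEq p] [DecidableEq q] in
theorem vecMulVec_mulVec_dotProduct (u : p → ℝ) (w : q → ℝ) (x : q → ℝ) :
    (Matrix.vecMulVec u w *ᵥ x) ⬝ᵥ (Matrix.vecMulVec u w *ᵥ x) = (w ⬝ᵥ x) ^ 2 * (u ⬝ᵥ u) := by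
  have : Matrix.vecMulVec u w *ᵥ x = (w ⬝ᵥ x) • u := by
    rw [Matrix.vecMulVec_mulVec]; ext i; simp [mul_comm]
  rw [this, smul_dotProduct, dotProduct_smul, smul_eq_mul, smul_eq_mul]; ring

omit [DecidableEq p] [DecidableEq q] in
theorem trace_vecMulVec_mul_transpose (u : p → ℝ) (w : q → ℝ) :
    (Matrix.vecMulVec u w * (Matrix.vecMulVec u w)ᵀ).trace = (u ⬝ᵥ u) * (w ⬝ᵥ w) := by
  rw [Matrix.transpose_vecMulVec, Matrix.vecMulVec_mul_vecMulVec, Matrix.trace_vecMulVec]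
  simp [mul_comm]

theorem dotProduct_self_nonneg_real {n : Type*} [Fintype n] (x : n → ℝ) : 0 ≤ x ⬝ᵥ x :=
  Finset.sum_nonneg fun _ _ => mul_self_nonneg _

omit [DecidableEq q] in
theorem sq_dotProduct_le (x y : q → ℝ) : (x ⬝ᵥ y) ^ 2 ≤ (x ⬝ᵥ x) * (y ⬝ᵥ y) := by
  simpa [dotProduct, pow_two] using Finset.sum_mul_sq_le_sq_mul_sq Finset.univ x y

omit [DecidableEq p] in
theorem norm_vecMulVec_le (u : p → ℝ) (w : q → ℝ) (L : ℝ) (hL : 0 ≤ L)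
    (h : (u ⬝ᵥ u) * (w ⬝ᵥ w) ≤ L ^ 2) : ‖Matrix.vecMulVec u w‖ ≤ L := by
  refine norm_le_of_dotProduct_self_mulVec_le _ L hL fun x => ?_
  rw [vecMulVec_mulVec_dotProduct]
  have h1 := sq_dotProduct_le w x
  have h2 : 0 ≤ u ⬝ᵥ u := dotProduct_self_nonneg_real u
  have h3 : 0 ≤ x ⬝ᵥ x := dotProduct_self_nonneg_real x
  calc (w ⬝ᵥ x) ^ 2 * (u ⬝ᵥ u) ≤ ((w ⬝ᵥ w) * (x ⬝ᵥ x)) * (u ⬝ᵥ u) := by gcongr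
    _ = ((u ⬝ᵥ u) * (w ⬝ᵥ w)) * (x ⬝ᵥ x) := by ring
    _ ≤ _ := by gcongr

variable {I Z : Type*} [Fintype I] [DecidableEq I] [Fintype Z] [Nonempty Z]

omit [Nonempty Z] [Fintype p] [Fintype q] [DecidableEq p] [DecidableEq q] in
theorem unifAvg_boolSign_smul (B : Z → Matrix p q ℝ) :
    (unifAvg fun y : Z × Bool => boolSign y.2 • B y.1) = 0 := by
  rw [unifAvg_prod]
  have (z : Z) : (unifAvg fun s : Bool => boolSign s • B z) = 0 := by
    have := map_unifAvg (LinearMap.toSpanSingleton ℝ (Matrix p q ℝ) (B z)) boolSign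
    simp only [LinearMap.toSpanSingleton_apply, unifAvg_boolSign, zero_smul] at this
    exact this.symm
  simp only [this]
  simp [unifAvg]

/-- The matrix Bennett inequality for sums of independent rank-one matrices with independent
random signs. -/
theorem rankOne_bennett (u : I → Z → p → ℝ) (w : I → Z → q → ℝ) (L v W t : ℝ) (hL : 0 < L)
    (hv : 0 < v) (hvL : v < L ^ 2) (ht0 : 0 ≤ t) (ht : 4 * L ≤ t * Real.log (L ^ 2 / v))
    (hA : ∀ k z, (u k z ⬝ᵥ u k z) * (w k z ⬝ᵥ w k z) ≤ L ^ 2)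
    (h1 : ∀ x, ∑ k, unifAvg (fun z => (u k z ⬝ᵥ x) ^ 2 * (w k z ⬝ᵥ w k z)) ≤ v * (x ⬝ᵥ x))
    (h2 : ∀ x, ∑ k, unifAvg (fun z => (w k z ⬝ᵥ x) ^ 2 * (u k z ⬝ᵥ u k z)) ≤ v * (x ⬝ᵥ x))
    (hw : ∑ k, unifAvg (fun z => (u k z ⬝ᵥ u k z) * (w k z ⬝ᵥ w k z)) ≤ W) :
    (unifAvg fun ω : I → Z × Bool =>
      if t < ‖∑ k, boolSign (ω k).2 • Matrix.vecMulVec (u k (ω k).1) (w k (ω k).1)‖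
      then (1 : ℝ) else 0) ≤
      8 * Real.exp 1 * (W / v) * (v / L ^ 2) ^ (t / (2 * L)) := by
  have hs (y : Bool) (M : Matrix p q ℝ) (x : q → ℝ) :
      ((boolSign y • M) *ᵥ x) ⬝ᵥ ((boolSign y • M) *ᵥ x) = (M *ᵥ x) ⬝ᵥ (M *ᵥ x) := by
    rw [Matrix.smul_mulVec, smul_dotProduct, dotProduct_smul, smul_smul, boolSign_mul_self, one_smul]
  have hs' (y : Bool) (M : Matrix p q ℝ) (x : p → ℝ) :
      ((boolSign y • M)ᵀ *ᵥ x) ⬝ᵥ ((boolSign y • M)ᵀ *ᵥ x) = (Mᵀ *ᵥ x) ⬝ᵥ (Mᵀ *ᵥ x) := by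
    rw [Matrix.transpose_smul, Matrix.smul_mulVec, smul_dotProduct, dotProduct_smul, smul_smul,
      boolSign_mul_self, one_smul]
  have hc (f : Z → ℝ) : (unifAvg fun y : Z × Bool => f y.1) = unifAvg f := by
    rw [unifAvg_prod]; simp only [unifAvg_const]
  refine matrix_bennett (fun k (y : Z × Bool) =>
    boolSign y.2 • Matrix.vecMulVec (u k y.1) (w k y.1)) L v W t hL hv hvL ht0 ht ?_ ?_ ?_ ?_ ?_
  · intro k
    exact unifAvg_boolSign_smul fun z => Matrix.vecMulVec (u k z) (w k z)
  · intro k y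
    rw [norm_smul]
    have : ‖boolSign y.2‖ = 1 := by cases y.2 <;> simp [boolSign]
    rw [this, one_mul]
    exact norm_vecMulVec_le _ _ _ hL.le (hA k y.1)
  · intro x
    simp only [hs', Matrix.transpose_vecMulVec, vecMulVec_mulVec_dotProduct]
    exact (Finset.sum_congr rfl fun k _ =>
      hc fun z => (u k z ⬝ᵥ x) ^ 2 * (w k z ⬝ᵥ w k z)).trans_le (h1 x)
  · intro x
    simp only [hs, vecMulVec_mulVec_dotProduct]
    exact (Finset.sum_congr rfl fun k _ =>
      hc fun z => (w k z ⬝ᵥ x) ^ 2 * (u k z ⬝ᵥ u k z)).trans_le (h2 x)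
  · have (k : I) (y : Z × Bool) : ((boolSign y.2 • Matrix.vecMulVec (u k y.1) (w k y.1)) *
        (boolSign y.2 • Matrix.vecMulVec (u k y.1) (w k y.1))ᵀ).trace =
        (u k y.1 ⬝ᵥ u k y.1) * (w k y.1 ⬝ᵥ w k y.1) := by
      rw [Matrix.transpose_smul, Matrix.smul_mul, Matrix.mul_smul, smul_smul, boolSign_mul_self,
        one_smul, trace_vecMulVec_mul_transpose]
    simp only [this]
    exact (Finset.sum_congr rfl fun k _ =>
      hc fun z => (u k z ⬝ᵥ u k z) * (w k z ⬝ᵥ w k z)).trans_le hw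

omit [DecidableEq p] [DecidableEq q] in
/-- Orthogonality of independent signed summands: the mean squared Frobenius norm is additive. -/
theorem unifAvg_trace_sum_mul_transpose (B : I → Z → Matrix p q ℝ) :
    (unifAvg fun ω : I → Z × Bool =>
      ((∑ k, boolSign (ω k).2 • B k (ω k).1) * (∑ k, boolSign (ω k).2 • B k (ω k).1)ᵀ).trace) =
      ∑ k, unifAvg fun z => (B k z * (B k z)ᵀ).trace := by
  have e1 (ω : I → Z × Bool) :
      ((∑ k, boolSign (ω k).2 • B k (ω k).1) * (∑ k, boolSign (ω k).2 • B k (ω k).1)ᵀ).trace =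
      ∑ k, ∑ j, ((boolSign (ω k).2 • B k (ω k).1) * (boolSign (ω j).2 • B j (ω j).1)ᵀ).trace := by
    simp only [Matrix.transpose_sum, Matrix.sum_mul, Matrix.mul_sum, Matrix.trace_sum]
    exact Finset.sum_comm
  simp only [e1, unifAvg_sum]
  refine Finset.sum_congr rfl fun k _ => ?_
  rw [Finset.sum_eq_single k]
  · have (ω : I → Z × Bool) : ((boolSign (ω k).2 • B k (ω k).1) *
        (boolSign (ω k).2 • B k (ω k).1)ᵀ).trace = (B k (ω k).1 * (B k (ω k).1)ᵀ).trace := by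
      rw [Matrix.transpose_smul, Matrix.smul_mul, Matrix.mul_smul, smul_smul, boolSign_mul_self,
        one_smul]
    simp only [this]
    rw [unifAvg_update k]
    simp only [Function.update_self, unifAvg_const]
    rw [unifAvg_prod]
    simp only [unifAvg_const]
  · intro j _ hj
    rw [unifAvg_update k]
    simp only [Function.update_self, Function.update_of_ne hj]
    have (ω : I → Z × Bool) : (unifAvg fun y : Z × Bool => ((boolSign y.2 • B k y.1) *
        (boolSign (ω j).2 • B j (ω j).1)ᵀ).trace) = 0 := by
      have h1 (y : Z × Bool) : ((boolSign y.2 • B k y.1) *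
          (boolSign (ω j).2 • B j (ω j).1)ᵀ).trace =
          boolSign y.2 * (B k y.1 * (boolSign (ω j).2 • B j (ω j).1)ᵀ).trace := by
        rw [Matrix.smul_mul, Matrix.trace_smul, smul_eq_mul]
      simp only [h1]
      rw [unifAvg_prod]
      simp only [unifAvg_mul_right, unifAvg_boolSign, zero_mul, unifAvg_const]
    simp only [this, unifAvg_const]
  · simp

omit [DecidableEq p] in
theorem sq_norm_le_trace (M : Matrix p q ℝ) : ‖M‖ ^ 2 ≤ (M * Mᵀ).trace := by
  have hp : (Mᵀ * M).PosSemidef := by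
    have := Matrix.posSemidef_conjTranspose_mul_self M
    rwa [Matrix.conjTranspose_eq_transpose_of_trivial] at this
  have h0 := hp.trace_nonneg
  rw [Matrix.trace_mul_comm M]
  refine (pow_le_pow_left₀ (norm_nonneg _) (norm_le_of_dotProduct_self_mulVec_le M
    (√(Mᵀ * M).trace) (Real.sqrt_nonneg _) fun x => ?_) 2).trans_eq (Real.sq_sqrt h0)
  rw [Real.sq_sqrt h0]
  have := hp.dotProduct_mulVec_le_trace x
  rwa [← Matrix.mulVec_mulVec, Matrix.dotProduct_mulVec, Matrix.vecMul_transpose] at this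

/-- Choosing every coordinate from one of two independent samples gives a sample of the same law. -/
theorem unifAvg_mix {Y E : Type*} [AddCommGroup E] [Module ℝ E] [Fintype Y] [Nonempty Y]
    (c : I → Bool) (f : (I → Y) → E) :
    unifAvg f = unifAvg fun ω' : I → Y => unifAvg fun ω : I → Y =>
      f fun k => if c k then ω k else ω' k := by
  let e : (I → Y) × (I → Y) ≃ (I → Y) × (I → Y) :=
    { toFun := fun p => (fun k => if c k then p.1 k else p.2 k, fun k => if c k then p.2 k else p.1 k)
      invFun := fun p =>
        (fun k => if c k then p.1 k else p.2 k, fun k => if c k then p.2 k else p.1 k)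
      left_inv := fun p => by ext k <;> by_cases h : c k <;> simp [h]
      right_inv := fun p => by ext k <;> by_cases h : c k <;> simp [h] }
  have h1 := unifAvg_equiv e (fun p => f p.1)
  rw [unifAvg_prod, unifAvg_prod, unifAvg_comm] at h1
  simp only [unifAvg_const] at h1
  exact h1.symm

end RankOne

/-! ### Buckets of a Count-Sketch -/

section Buckets

variable {κ ι δ β : Type*} [Fintype κ] [Fintype ι] [Fintype δ] [Fintype β] [DecidableEq κ]
  [DecidableEq ι] [DecidableEq δ] [DecidableEq β]

omit [DecidableEq ι] in
theorem sum_sq_row_dotProduct {U : Matrix ι δ ℝ} (hU : Uᵀ * U = 1) (x : δ → ℝ) :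
    ∑ i, (U i ⬝ᵥ x) ^ 2 = x ⬝ᵥ x := by
  have : (U *ᵥ x) ⬝ᵥ (U *ᵥ x) = x ⬝ᵥ x := by
    rw [Matrix.dotProduct_mulVec, Matrix.vecMul_mulVec, hU, Matrix.vecMul_one]
  rw [← this]
  simp only [dotProduct, Matrix.mulVec, pow_two]

omit [DecidableEq ι] in
theorem sum_row_dotProduct_self {U : Matrix ι δ ℝ} (hU : Uᵀ * U = 1) :
    ∑ i, U i ⬝ᵥ U i = Fintype.card δ := by
  have : (U * Uᵀ).trace = Fintype.card δ := by
    rw [Matrix.trace_mul_comm, hU, Matrix.trace_one]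
  rw [← this]
  simp only [Matrix.trace, Matrix.diag, Matrix.mul_apply, dotProduct, Matrix.transpose_apply]

omit [DecidableEq ι] in
theorem row_dotProduct_self_le_one {U : Matrix ι δ ℝ} (hU : Uᵀ * U = 1) (i : ι) :
    U i ⬝ᵥ U i ≤ 1 := by
  have h1 := sum_sq_row_dotProduct hU (U i)
  have h2 : (U i ⬝ᵥ U i) ^ 2 ≤ U i ⬝ᵥ U i := by
    refine le_of_le_of_eq ?_ h1
    exact Finset.single_le_sum (f := fun j => (U j ⬝ᵥ U i) ^ 2) (fun j _ => sq_nonneg _)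
      (Finset.mem_univ i)
  have h3 := dotProduct_self_nonneg_real (U i)
  nlinarith

/-- The row of the sketched matrix that belongs to bucket `l` of block `r`: the signed sum of the
rows of `U` sent to this bucket, restricted to the pairs `(r, i)` in `S`. -/
def bucketSum (U : Matrix ι δ ℝ) (S : Finset (κ × ι)) (ω : κ × ι → β × Bool) (r : κ) (l : β) :
    δ → ℝ :=
  ∑ i, (if (r, i) ∈ S ∧ (ω (r, i)).1 = l then boolSign (ω (r, i)).2 else 0) • U i

/-- All rows `bucketSum`, normalized by the square root of the number of blocks. -/
noncomputable def bucketMatrix (U : Matrix ι δ ℝ) (S : Finset (κ × ι)) (N : ℝ) (ω : κ × ι → β × Bool) :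
    Matrix (κ × β) δ ℝ :=
  Matrix.of fun rl => (√N)⁻¹ • bucketSum U S ω rl.1 rl.2

omit [Fintype δ] [Fintype β] [DecidableEq δ] in
theorem bucketMatrix_eq_sum (U : Matrix ι δ ℝ) (S : Finset (κ × ι)) (N : ℝ)
    (ω : κ × ι → β × Bool) :
    bucketMatrix U S N ω = ∑ k, boolSign (ω k).2 • Matrix.vecMulVec
      (if k ∈ S then (√N)⁻¹ • Pi.single (k.1, (ω k).1) (1 : ℝ) else 0) (U k.2) := by
  ext ⟨r, l⟩ j
  rw [Matrix.sum_apply, Fintype.sum_prod_type, Finset.sum_eq_single r]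
  · simp only [bucketMatrix, bucketSum, Matrix.of_apply, Pi.smul_apply, Finset.sum_apply,
      smul_eq_mul, Finset.mul_sum, Matrix.smul_apply, Matrix.vecMulVec_apply]
    refine Finset.sum_congr rfl fun i _ => ?_
    by_cases h1 : (r, i) ∈ S <;> by_cases h2 : (ω (r, i)).1 = l
    · simp [h1, h2]; ring
    · have : ¬ l = (ω (r, i)).1 := fun h => h2 h.symm
      simp [h1, h2, this]
    · simp [h1]
    · simp [h1]
  · intro r' _ hr
    refine Finset.sum_eq_zero fun i _ => ?_
    have : ¬ r = r' := fun h => hr h.symm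
    by_cases h1 : (r', i) ∈ S <;> simp [h1, Matrix.vecMulVec_apply, this]
  · simp

omit [DecidableEq ι] [DecidableEq β] [Fintype β] [Fintype δ] [DecidableEq δ] in
theorem sum_ite_fst_mem (J : Finset κ) (f : ι → ℝ) (c : ℝ) :
    ∑ k : κ × ι, (if k.1 ∈ J then c * f k.2 else 0) = J.card * c * ∑ i, f i := by
  rw [Fintype.sum_prod_type]
  have (r : κ) : ∑ i, (if r ∈ J then c * f i else 0) = if r ∈ J then c * ∑ i, f i else 0 := by
    split_ifs
    · rw [Finset.mul_sum]
    · simp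
  simp only [this, Finset.sum_ite_mem, Finset.univ_inter, Finset.sum_const, nsmul_eq_mul]
  ring

variable [Nonempty β]

/-- The rows of the sketch restricted to `S` have, up to a slowly growing factor, bounded operator
norm. -/
theorem bucketMatrix_norm_tail {U : Matrix ι δ ℝ} (hU : Uᵀ * U = 1) (J : Finset κ)
    (hJ : J.Nonempty) (S : Finset (κ × ι)) (hS : ∀ k ∈ S, k.1 ∈ J)
    (hd : (Fintype.card δ : ℝ) ≤ J.card * Fintype.card β) (T : ℝ) (hT : 2 * Real.exp 1 ≤ T) :
    (unifAvg fun ω : κ × ι → β × Bool =>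
      if T < ‖bucketMatrix U S J.card ω‖ then (1 : ℝ) else 0) ≤
      8 * Real.exp 1 * Fintype.card δ * Real.exp (-(T / Real.exp 1)) := by
  have hN : (0 : ℝ) < J.card := by exact_mod_cast hJ.card_pos
  have he : 1 ≤ Real.exp 1 := Real.one_le_exp zero_le_one
  have he0 := Real.exp_pos 1
  have hb : (0 : ℝ) < Fintype.card β := by exact_mod_cast Fintype.card_pos
  set c : ℝ := (√(J.card : ℝ))⁻¹ with hc
  have hc2 : c * c = (J.card : ℝ)⁻¹ := by
    rw [hc, ← mul_inv, Real.mul_self_sqrt hN.le]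
  let u : κ × ι → β → κ × β → ℝ := fun k z =>
    if k ∈ S then c • Pi.single (k.1, z) (1 : ℝ) else 0
  let w : κ × ι → β → δ → ℝ := fun k _ => U k.2
  have huu (k z) : u k z ⬝ᵥ u k z ≤ if k.1 ∈ J then (J.card : ℝ)⁻¹ else 0 := by
    by_cases hk : k ∈ S
    · simp [u, hk, hS k hk, hc2]
    · simp only [u, hk, if_false, zero_dotProduct]; split_ifs <;> first | exact le_rfl | positivity
  have hux (k z) (x : κ × β → ℝ) : (u k z ⬝ᵥ x) ^ 2 ≤ (J.card : ℝ)⁻¹ * (x (k.1, z)) ^ 2 := by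
    by_cases hk : k ∈ S
    · simp only [u, hk, if_true, smul_dotProduct, single_dotProduct, one_mul, smul_eq_mul]
      rw [mul_pow, pow_two c, hc2]
    · simp only [u, hk, if_false, zero_dotProduct, zero_pow two_ne_zero]; positivity
  have hlog : Real.log (Real.exp 1 ^ 2 / 1) = 2 := by
    rw [div_one, ← Real.exp_nat_mul, Real.log_exp]; norm_num
  have key := rankOne_bennett (I := κ × ι) (Z := β) u w (Real.exp 1) 1 (Fintype.card δ) T he0
    one_pos (by nlinarith [Real.add_one_le_exp (1 : ℝ)]) (by linarith) (by rw [hlog]; linarith)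
    ?_ ?_ ?_ ?_
  · simp only [bucketMatrix_eq_sum]
    refine key.trans_eq ?_
    rw [div_one, one_div, ← Real.exp_nat_mul, ← Real.exp_neg, ← Real.exp_mul]
    congr 2
    push_cast; field_simp
  · intro k z
    have h1 := row_dotProduct_self_le_one hU k.2
    have h0 := dotProduct_self_nonneg_real (U k.2)
    have h2 : u k z ⬝ᵥ u k z ≤ 1 := by
      refine (huu k z).trans ?_
      split_ifs
      · exact inv_le_one_of_one_le₀ (by exact_mod_cast hJ.card_pos)
      · exact zero_le_one
    have h3 : (u k z ⬝ᵥ u k z) * (w k z ⬝ᵥ w k z) ≤ 1 * 1 :=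
      mul_le_mul h2 h1 h0 zero_le_one
    nlinarith
  · intro x
    have h0 : 0 ≤ x ⬝ᵥ x := dotProduct_self_nonneg_real x
    calc ∑ k, unifAvg (fun z => (u k z ⬝ᵥ x) ^ 2 * (w k z ⬝ᵥ w k z))
        ≤ ∑ k : κ × ι, unifAvg (fun z => ((J.card : ℝ)⁻¹ * (x (k.1, z)) ^ 2) * (U k.2 ⬝ᵥ U k.2)) :=
          Finset.sum_le_sum fun k _ => unifAvg_mono fun z =>
            mul_le_mul_of_nonneg_right (hux k z x) (dotProduct_self_nonneg_real _)
      _ = (Fintype.card δ / (J.card * Fintype.card β)) * (x ⬝ᵥ x) := by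
          simp only [unifAvg_mul_right, unifAvg_mul_left]
          rw [Fintype.sum_prod_type]
          simp only [← Finset.mul_sum, sum_row_dotProduct_self hU]
          rw [← Finset.sum_mul, ← Finset.mul_sum]
          simp only [unifAvg, smul_eq_mul, ← Finset.mul_sum]
          have : x ⬝ᵥ x = ∑ r, ∑ z, x (r, z) ^ 2 := by
            rw [dotProduct, Fintype.sum_prod_type]; simp only [pow_two]
          rw [this]; field_simp
      _ ≤ 1 * (x ⬝ᵥ x) := by
          refine mul_le_mul_of_nonneg_right ?_ h0
          rw [div_le_one (by positivity)]; exact hd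
  · intro x
    calc ∑ k, unifAvg (fun z => (w k z ⬝ᵥ x) ^ 2 * (u k z ⬝ᵥ u k z))
        ≤ ∑ k : κ × ι, (if k.1 ∈ J then (J.card : ℝ)⁻¹ * (U k.2 ⬝ᵥ x) ^ 2 else 0) := by
          refine Finset.sum_le_sum fun k _ => unifAvg_le_of_le fun z => ?_
          refine (mul_le_mul_of_nonneg_left (huu k z) (sq_nonneg _)).trans_eq ?_
          simp only [w]
          split_ifs
          · rw [mul_comm]
          · rw [mul_zero]
      _ = 1 * (x ⬝ᵥ x) := by
          rw [sum_ite_fst_mem J (fun i => (U i ⬝ᵥ x) ^ 2), sum_sq_row_dotProduct hU,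
            mul_inv_cancel₀ hN.ne']
  · calc ∑ k, unifAvg (fun z => (u k z ⬝ᵥ u k z) * (w k z ⬝ᵥ w k z))
        ≤ ∑ k : κ × ι, (if k.1 ∈ J then (J.card : ℝ)⁻¹ * (U k.2 ⬝ᵥ U k.2) else 0) := by
          refine Finset.sum_le_sum fun k _ => unifAvg_le_of_le fun z => ?_
          refine (mul_le_mul_of_nonneg_right (huu k z) (dotProduct_self_nonneg_real _)).trans_eq ?_
          simp only [w]
          split_ifs
          · rfl
          · rw [zero_mul]
      _ = Fintype.card δ := by
          rw [sum_ite_fst_mem J (fun i => U i ⬝ᵥ U i), sum_row_dotProduct_self hU,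
            mul_inv_cancel₀ hN.ne', one_mul]

/-- The signed sum of the rows in a single bucket rarely has norm more than a constant `K`.
Read as an operator from a one-dimensional space, it is a sum of rank-one matrices. -/
theorem bucketSum_tail {U : Matrix ι δ ℝ} (hU : Uᵀ * U = 1) [Nonempty δ]
    (S : Finset (κ × ι)) (r : κ) (l : β)
    (hd : (Fintype.card δ : ℝ) < Fintype.card β) (K : ℝ) (hK0 : 0 ≤ K)
    (hK : 4 ≤ K * Real.log (Fintype.card β / Fintype.card δ)) :
    (unifAvg fun ω : κ × ι → β × Bool =>
      if K ^ 2 < bucketSum U S ω r l ⬝ᵥ bucketSum U S ω r l then (1 : ℝ) else 0) ≤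
      8 * Real.exp 1 * (Fintype.card δ / Fintype.card β : ℝ) ^ (K / 2) := by
  have hdp : (1 : ℝ) ≤ Fintype.card δ := by exact_mod_cast Fintype.card_pos
  have hb : (0 : ℝ) < Fintype.card β := by exact_mod_cast Fintype.card_pos
  set d : ℝ := (Fintype.card δ : ℝ) with hd'
  set b : ℝ := (Fintype.card β : ℝ) with hb'
  let g : κ × ι → β → ℝ := fun k z => if k.1 = r then (if z = l then 1 else 0) else 0
  have hg01 (k z) : 0 ≤ g k z ∧ g k z ≤ 1 := by
    simp only [g]; split_ifs <;> norm_num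
  let u : κ × ι → β → Unit → ℝ := fun k z _ => if k ∈ S ∧ k.1 = r ∧ z = l then 1 else 0
  let w : κ × ι → β → δ → ℝ := fun k _ => U k.2
  have huu (k z) : u k z ⬝ᵥ u k z ≤ g k z := by
    simp only [u, g, dotProduct, Finset.univ_unique, Finset.sum_singleton]
    by_cases h1 : k ∈ S <;> by_cases h2 : k.1 = r <;> by_cases h3 : z = l <;> simp [h1, h2, h3]
  have hux (k z) (x : Unit → ℝ) : (u k z ⬝ᵥ x) ^ 2 ≤ g k z * (x ⬝ᵥ x) := by
    simp only [u, g, dotProduct, Finset.univ_unique, Finset.sum_singleton]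
    have := mul_self_nonneg (x default)
    by_cases h1 : k ∈ S <;> by_cases h2 : k.1 = r <;> by_cases h3 : z = l <;>
      simp [h1, h2, h3, pow_two, mul_self_nonneg]
  have hgsum (f : ι → ℝ) : ∑ k : κ × ι, unifAvg (fun z => g k z * f k.2) = b⁻¹ * ∑ i, f i := by
    have (k : κ × ι) : unifAvg (fun z => g k z * f k.2) =
        if k.1 = r then b⁻¹ * f k.2 else 0 := by
      rw [unifAvg_mul_right]
      by_cases h2 : k.1 = r <;> simp [g, h2, unifAvg, hb']
    simp only [this]
    rw [Fintype.sum_prod_type, Finset.sum_eq_single r]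
    · simp [Finset.mul_sum]
    · intro r' _ h; simp [h]
    · simp
  have hdb : d / b < 1 := by rw [div_lt_one hb]; exact hd
  have key := rankOne_bennett (I := κ × ι) (Z := β) u w 1 (d / b) (d / b) K one_pos
    (by positivity) (by simpa using hdb) hK0 (by rw [one_pow, one_div_div, mul_one]; exact hK)
    ?_ ?_ ?_ ?_
  · rw [div_self (by positivity), mul_one, one_pow, div_one, mul_one] at key
    refine le_trans (unifAvg_mono fun ω => ?_) key
    set Mω := ∑ k, boolSign (ω k).2 • Matrix.vecMulVec (u k (ω k).1) (w k (ω k).1) with hM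
    have hrow : Mωᵀ *ᵥ (fun _ => 1) = bucketSum U S ω r l := by
      ext j
      simp only [Matrix.mulVec, dotProduct, Finset.univ_unique, Finset.sum_singleton, mul_one,
        Matrix.transpose_apply, hM, Matrix.sum_apply]
      rw [Fintype.sum_prod_type, Finset.sum_eq_single r]
      · simp only [bucketSum, Finset.sum_apply]
        refine Finset.sum_congr rfl fun i _ => ?_
        by_cases h1 : (r, i) ∈ S <;> by_cases h2 : (ω (r, i)).1 = l <;>
          simp [u, w, Matrix.vecMulVec_apply, h1, h2]
      · intro r' _ h
        refine Finset.sum_eq_zero fun i _ => ?_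
        simp [u, Matrix.vecMulVec_apply, h]
      · simp
    have h1 := dotProduct_self_mulVec_le Mωᵀ (fun _ => 1)
    rw [hrow, l2_opNorm_transpose] at h1
    have h2 : (fun _ : Unit => (1 : ℝ)) ⬝ᵥ (fun _ => 1) = 1 := by simp
    rw [h2, mul_one] at h1
    split_ifs with h3 h4
    · exact le_rfl
    · exact absurd (h3.trans_le (h1.trans (pow_le_pow_left₀ (norm_nonneg _) (not_lt.1 h4) 2)))
        (lt_irrefl _)
    · exact zero_le_one
    · exact le_rfl
  · intro k z
    have h1 := row_dotProduct_self_le_one hU k.2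
    have h0 := dotProduct_self_nonneg_real (U k.2)
    have := mul_le_mul ((huu k z).trans (hg01 k z).2) h1 h0 zero_le_one
    simpa using this
  · intro x
    have h0 : 0 ≤ x ⬝ᵥ x := dotProduct_self_nonneg_real x
    calc ∑ k, unifAvg (fun z => (u k z ⬝ᵥ x) ^ 2 * (w k z ⬝ᵥ w k z))
        ≤ ∑ k : κ × ι, unifAvg (fun z => g k z * ((x ⬝ᵥ x) * (U k.2 ⬝ᵥ U k.2))) :=
          Finset.sum_le_sum fun k _ => unifAvg_mono fun z => by
            rw [← mul_assoc]
            exact mul_le_mul_of_nonneg_right (hux k z x) (dotProduct_self_nonneg_real _)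
      _ = d / b * (x ⬝ᵥ x) := by
          rw [hgsum fun i => (x ⬝ᵥ x) * (U i ⬝ᵥ U i), ← Finset.mul_sum,
            sum_row_dotProduct_self hU, ← hd']
          field_simp
  · intro x
    have h0 : 0 ≤ x ⬝ᵥ x := dotProduct_self_nonneg_real x
    calc ∑ k, unifAvg (fun z => (w k z ⬝ᵥ x) ^ 2 * (u k z ⬝ᵥ u k z))
        ≤ ∑ k : κ × ι, unifAvg (fun z => g k z * (U k.2 ⬝ᵥ x) ^ 2) :=
          Finset.sum_le_sum fun k _ => unifAvg_mono fun z => by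
            rw [mul_comm]
            exact mul_le_mul_of_nonneg_right (huu k z) (sq_nonneg _)
      _ = b⁻¹ * (x ⬝ᵥ x) := by
          rw [hgsum fun i => (U i ⬝ᵥ x) ^ 2, sum_sq_row_dotProduct hU]
      _ ≤ d / b * (x ⬝ᵥ x) := by
          refine mul_le_mul_of_nonneg_right ?_ h0
          rw [inv_eq_one_div]; gcongr
  · calc ∑ k, unifAvg (fun z => (u k z ⬝ᵥ u k z) * (w k z ⬝ᵥ w k z))
        ≤ ∑ k : κ × ι, unifAvg (fun z => g k z * (U k.2 ⬝ᵥ U k.2)) :=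
          Finset.sum_le_sum fun k _ => unifAvg_mono fun z =>
            mul_le_mul_of_nonneg_right (huu k z) (dotProduct_self_nonneg_real _)
      _ = d / b := by
          rw [hgsum fun i => U i ⬝ᵥ U i, sum_row_dotProduct_self hU, ← hd']
          field_simp
      _ ≤ d / b := le_rfl

end Buckets

/-! ### The decoupled quadratic form -/

section Cross

variable {κ ι δ β : Type*} [Fintype κ] [Fintype ι] [Fintype δ] [Fintype β] [DecidableEq κ]
  [DecidableEq ι] [DecidableEq δ] [DecidableEq β]

/-- The pairs (block in `J`, row) whose row lies on the side `a` of the bipartition `η`. -/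
def halfPairs (J : Finset κ) (η : ι → Bool) (a : Bool) : Finset (κ × ι) :=
  Finset.univ.filter fun k => k.1 ∈ J ∧ η k.2 = a

/-- The signed rank-one sum that pairs the rows of one side of the bipartition with prescribed
bucket rows `y`. -/
noncomputable def pairedSum (U : Matrix ι δ ℝ) (S : Finset (κ × ι)) (N : ℝ) (y : κ → β → δ → ℝ)
    (ω : κ × ι → β × Bool) : Matrix δ δ ℝ :=
  ∑ k, boolSign (ω k).2 • Matrix.vecMulVec (if k ∈ S then N⁻¹ • U k.2 else 0) (y k.1 (ω k).1)

/-- The part of the off-diagonal quadratic form of the sketch that pairs a row on the side `true`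
of the bipartition `η` with a row on the side `false`. -/
noncomputable def crossSum (U : Matrix ι δ ℝ) (J : Finset κ) (η : ι → Bool)
    (ω : κ × ι → β × Bool) : Matrix δ δ ℝ :=
  pairedSum U (halfPairs J η true) J.card (bucketSum U (halfPairs J η false) ω) ω

omit [Fintype δ] [Fintype β] [DecidableEq δ] in
/-- The two factors of the decoupled form depend on disjoint sets of random choices. -/
theorem crossSum_mix (U : Matrix ι δ ℝ) (J : Finset κ) (η : ι → Bool)
    (ω ω' : κ × ι → β × Bool) :
    crossSum U J η (fun k => if η k.2 then ω k else ω' k) =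
      pairedSum U (halfPairs J η true) J.card (bucketSum U (halfPairs J η false) ω') ω := by
  have hy : bucketSum U (halfPairs J η false) (fun k => if η k.2 then ω k else ω' k) =
      bucketSum U (halfPairs J η false) ω' := by
    funext r l
    refine Finset.sum_congr rfl fun i _ => ?_
    by_cases h : (r, i) ∈ halfPairs J η false
    · have : η i = false := (Finset.mem_filter.1 h).2.2
      simp [this]
    · simp [h]
  rw [crossSum, hy, pairedSum, pairedSum]
  refine Finset.sum_congr rfl fun k _ => ?_
  by_cases h : k ∈ halfPairs J η true
  · have : η k.2 = true := (Finset.mem_filter.1 h).2.2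
    simp [this]
  · simp [h]

variable [Nonempty β]

omit [Fintype δ] [DecidableEq δ] [DecidableEq ι] [DecidableEq β] [Nonempty β] in
theorem sum_unifAvg_le_of_bucket (J : Finset κ) (f : ι → ℝ) (g : κ → β → ℝ) (a : ℝ)
    (F : κ × ι → β → ℝ) (hF : ∀ k z, F k z ≤ if k.1 ∈ J then a * f k.2 * g k.1 z else 0) :
    ∑ k, unifAvg (F k) ≤ a * (Fintype.card β : ℝ)⁻¹ * (∑ i, f i) * ∑ r ∈ J, ∑ z, g r z := by
  calc ∑ k, unifAvg (F k)
      ≤ ∑ k : κ × ι, unifAvg fun z => if k.1 ∈ J then a * f k.2 * g k.1 z else 0 :=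
        Finset.sum_le_sum fun k _ => unifAvg_mono (hF k)
    _ = ∑ r, if r ∈ J then ∑ i, (Fintype.card β : ℝ)⁻¹ * (a * f i * ∑ z, g r z) else 0 := by
        rw [Fintype.sum_prod_type]
        refine Finset.sum_congr rfl fun r _ => ?_
        split_ifs with h
        · refine Finset.sum_congr rfl fun i _ => ?_
          simp [unifAvg, Finset.mul_sum]
        · simp [unifAvg]
    _ = _ := by
        rw [Finset.sum_ite_mem, Finset.univ_inter, Finset.mul_sum]
        refine Finset.sum_congr rfl fun r _ => ?_
        rw [← Finset.mul_sum, ← Finset.sum_mul, ← Finset.mul_sum]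
        ring

omit [Fintype κ] [Fintype ι] [Fintype β] [DecidableEq κ] [DecidableEq ι] [DecidableEq β]
  [Nonempty β] in
theorem sum_dotProduct_self_le {J : Finset κ} [Fintype β] {y : κ → β → δ → ℝ} {c : ℝ}
    (h : ∀ x, ∑ r ∈ J, ∑ z, (y r z ⬝ᵥ x) ^ 2 ≤ c * (x ⬝ᵥ x)) :
    ∑ r ∈ J, ∑ z, y r z ⬝ᵥ y r z ≤ c * Fintype.card δ := by
  have e : ∑ r ∈ J, ∑ z, y r z ⬝ᵥ y r z =
      ∑ j : δ, ∑ r ∈ J, ∑ z, (y r z ⬝ᵥ Pi.single j 1) ^ 2 := by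
    have h1 (v : δ → ℝ) : v ⬝ᵥ v = ∑ j, (v ⬝ᵥ Pi.single j 1) ^ 2 := by
      simp only [dotProduct_single, mul_one]
      simp only [dotProduct, pow_two]
    calc _ = ∑ r ∈ J, ∑ j, ∑ z, (y r z ⬝ᵥ Pi.single j 1) ^ 2 :=
          Finset.sum_congr rfl fun r _ => by
            rw [Finset.sum_comm]; exact Finset.sum_congr rfl fun z _ => h1 _
      _ = _ := Finset.sum_comm
  rw [e]
  calc _ ≤ ∑ j : δ, c := Finset.sum_le_sum fun j _ => by simpa using h (Pi.single j 1)
    _ = _ := by simp [mul_comm]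

omit [DecidableEq β] in
/-- Conditionally on one half of the rows, the decoupled form is a sum of independent signed
rank-one matrices, small by the Bennett inequality. -/
theorem pairedSum_tail [Nonempty δ] {U : Matrix ι δ ℝ} (hU : Uᵀ * U = 1) (J : Finset κ)
    (hJ : J.Nonempty) (S : Finset (κ × ι)) (hS : ∀ k ∈ S, k.1 ∈ J) (y : κ → β → δ → ℝ)
    (K T t : ℝ) (hK : 0 < K) (hT : 0 < T) (ht0 : 0 ≤ t)
    (hyK : ∀ r ∈ J, ∀ z, y r z ⬝ᵥ y r z ≤ K ^ 2)
    (hyT : ∀ x, ∑ r ∈ J, ∑ z, (y r z ⬝ᵥ x) ^ 2 ≤ J.card * T ^ 2 * (x ⬝ᵥ x))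
    (Q : ℝ) (hQ : Fintype.card δ * T ^ 2 * J.card / (Fintype.card β * K ^ 2) ≤ Q) (hQ1 : Q < 1)
    (htQ : 4 * K ≤ t * J.card * Real.log (1 / Q)) :
    (unifAvg fun ω : κ × ι → β × Bool =>
      if t < ‖pairedSum U S J.card y ω‖ then (1 : ℝ) else 0) ≤
      8 * Real.exp 1 * Fintype.card δ * Q ^ (t * J.card / (2 * K)) := by
  have hN : (0 : ℝ) < J.card := by exact_mod_cast hJ.card_pos
  have hdp : (1 : ℝ) ≤ Fintype.card δ := by exact_mod_cast Fintype.card_pos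
  have hb : (0 : ℝ) < Fintype.card β := by exact_mod_cast Fintype.card_pos
  have hyD := sum_dotProduct_self_le hyT
  set d : ℝ := (Fintype.card δ : ℝ) with hd'
  set b : ℝ := (Fintype.card β : ℝ) with hb'
  set N : ℝ := (J.card : ℝ) with hN'
  have hQ0 : 0 < Q := lt_of_lt_of_le (by positivity) hQ
  set L : ℝ := K / N with hL
  have hLp : 0 < L := by positivity
  -- the variance proxy is the largest one with ratio `v / L ^ 2 = Q`
  set v : ℝ := Q * L ^ 2 with hv
  have hvp : 0 < v := by positivity
  have hv1 : d * T ^ 2 / (N * b) ≤ v := by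
    have : d * T ^ 2 / (N * b) = (d * T ^ 2 * N / (b * K ^ 2)) * L ^ 2 := by
      rw [hL]; field_simp
    rw [this]; exact mul_le_mul_of_nonneg_right hQ (by positivity)
  have hvL : v < L ^ 2 := by
    rw [hv]; nlinarith [sq_pos_of_pos hLp]
  have hratio : v / L ^ 2 = Q := by rw [hv]; field_simp
  have hratio' : L ^ 2 / v = 1 / Q := by rw [hv]; field_simp
  let u : κ × ι → β → δ → ℝ := fun k _ => if k ∈ S then N⁻¹ • U k.2 else 0
  let w : κ × ι → β → δ → ℝ := fun k z => y k.1 z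
  have huu (k z) : u k z ⬝ᵥ u k z ≤ if k.1 ∈ J then N⁻¹ ^ 2 * (U k.2 ⬝ᵥ U k.2) else 0 := by
    have h0 := dotProduct_self_nonneg_real (U k.2)
    by_cases hk : k ∈ S
    · simp only [u, hk, hS k hk, if_true, smul_dotProduct, dotProduct_smul, smul_eq_mul]
      exact le_of_eq (by ring)
    · simp only [u, hk, if_false, zero_dotProduct]
      split_ifs <;> first | exact le_rfl | positivity
  have hux (k z) (x : δ → ℝ) :
      (u k z ⬝ᵥ x) ^ 2 ≤ if k.1 ∈ J then N⁻¹ ^ 2 * (U k.2 ⬝ᵥ x) ^ 2 else 0 := by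
    by_cases hk : k ∈ S
    · simp only [u, hk, hS k hk, if_true, smul_dotProduct, smul_eq_mul, mul_pow, le_refl]
    · simp only [u, hk, if_false, zero_dotProduct, zero_pow two_ne_zero]
      split_ifs <;> first | exact le_rfl | positivity
  have hwN : ∀ x : δ → ℝ, 0 ≤ x ⬝ᵥ x := dotProduct_self_nonneg_real
  have key := rankOne_bennett (I := κ × ι) (Z := β) u w L v (d * v) t hLp hvp hvL ht0 ?_ ?_ ?_ ?_ ?_
  · refine key.trans_eq ?_
    rw [hratio, mul_div_assoc, div_self hvp.ne', mul_one]
    congr 2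
    rw [hL]; field_simp
  · rw [hratio', hL]
    rw [mul_div_assoc', div_le_iff₀ hN]
    linarith
  · intro k z
    by_cases hk : k ∈ S
    · have h1 := row_dotProduct_self_le_one hU k.2
      have h2 := hyK k.1 (hS k hk) z
      have h3 : u k z ⬝ᵥ u k z ≤ N⁻¹ ^ 2 := by
        refine (huu k z).trans ?_
        rw [if_pos (hS k hk)]
        exact mul_le_of_le_one_right (by positivity) h1
      calc (u k z ⬝ᵥ u k z) * (w k z ⬝ᵥ w k z) ≤ N⁻¹ ^ 2 * K ^ 2 :=
            mul_le_mul h3 h2 (hwN _) (by positivity)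
        _ = L ^ 2 := by rw [hL]; field_simp
    · simp only [u, hk, if_false, zero_dotProduct, zero_mul]; positivity
  · intro x
    refine (sum_unifAvg_le_of_bucket J (fun i => (U i ⬝ᵥ x) ^ 2) (fun r z => y r z ⬝ᵥ y r z)
      (N⁻¹ ^ 2) _ fun k z => ?_).trans ?_
    · refine (mul_le_mul_of_nonneg_right (hux k z x) (hwN _)).trans_eq ?_
      simp only [w]; split_ifs <;> simp
    · rw [sum_sq_row_dotProduct hU]
      calc _ ≤ N⁻¹ ^ 2 * b⁻¹ * (x ⬝ᵥ x) * (N * T ^ 2 * d) :=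
            mul_le_mul_of_nonneg_left hyD (by have := hwN x; positivity)
        _ = d * T ^ 2 / (N * b) * (x ⬝ᵥ x) := by field_simp
        _ ≤ _ := mul_le_mul_of_nonneg_right hv1 (hwN x)
  · intro x
    refine (sum_unifAvg_le_of_bucket J (fun i => U i ⬝ᵥ U i) (fun r z => (y r z ⬝ᵥ x) ^ 2)
      (N⁻¹ ^ 2) _ fun k z => ?_).trans ?_
    · refine (mul_le_mul_of_nonneg_left (huu k z) (sq_nonneg _)).trans_eq ?_
      simp only [w]; split_ifs
      · ring
      · simp
    · rw [sum_row_dotProduct_self hU]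
      calc _ ≤ N⁻¹ ^ 2 * b⁻¹ * d * (N * T ^ 2 * (x ⬝ᵥ x)) :=
            mul_le_mul_of_nonneg_left (hyT x) (by positivity)
        _ = d * T ^ 2 / (N * b) * (x ⬝ᵥ x) := by field_simp
        _ ≤ _ := mul_le_mul_of_nonneg_right hv1 (hwN x)
  · refine (sum_unifAvg_le_of_bucket J (fun i => U i ⬝ᵥ U i) (fun r z => y r z ⬝ᵥ y r z)
      (N⁻¹ ^ 2) _ fun k z => ?_).trans ?_
    · refine (mul_le_mul_of_nonneg_right (huu k z) (hwN _)).trans_eq ?_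
      simp only [w]; split_ifs <;> simp
    · rw [sum_row_dotProduct_self hU]
      calc _ ≤ N⁻¹ ^ 2 * b⁻¹ * d * (N * T ^ 2 * d) :=
            mul_le_mul_of_nonneg_left hyD (by positivity)
        _ = d * (d * T ^ 2 / (N * b)) := by field_simp
        _ ≤ _ := mul_le_mul_of_nonneg_left hv1 (by positivity)

/-- On average over the random choices, the buckets carry the total length of the rows. -/
theorem unifAvg_sum_bucketSum_le {U : Matrix ι δ ℝ} (hU : Uᵀ * U = 1)
    (J : Finset κ) (S : Finset (κ × ι)) (hS : ∀ k ∈ S, k.1 ∈ J) :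
    (unifAvg fun ω : κ × ι → β × Bool =>
      ∑ r ∈ J, ∑ z, bucketSum U S ω r z ⬝ᵥ bucketSum U S ω r z) ≤
      J.card * Fintype.card δ := by
  have h1 (ω : κ × ι → β × Bool) : ∑ r ∈ J, ∑ z, bucketSum U S ω r z ⬝ᵥ bucketSum U S ω r z ≤
      (bucketMatrix U S 1 ω * (bucketMatrix U S 1 ω)ᵀ).trace := by
    have e : (bucketMatrix U S 1 ω * (bucketMatrix U S 1 ω)ᵀ).trace =
        ∑ r, ∑ z, bucketSum U S ω r z ⬝ᵥ bucketSum U S ω r z := by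
      rw [Matrix.trace, Fintype.sum_prod_type]
      simp [bucketMatrix, Matrix.mul_apply, dotProduct]
    rw [e]
    exact Finset.sum_le_univ_sum_of_nonneg fun r =>
      Finset.sum_nonneg fun z _ => dotProduct_self_nonneg_real _
  refine (unifAvg_mono h1).trans ?_
  simp only [bucketMatrix_eq_sum]
  rw [unifAvg_trace_sum_mul_transpose (fun (k : κ × ι) (z : β) => Matrix.vecMulVec
      (if k ∈ S then (√1)⁻¹ • (Pi.single (k.1, z) (1 : ℝ) : κ × β → ℝ) else 0) (U k.2))]
  calc _ ≤ ∑ k : κ × ι, (if k.1 ∈ J then 1 * (U k.2 ⬝ᵥ U k.2) else 0) := by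
        refine Finset.sum_le_sum fun k _ => unifAvg_le_of_le fun z => ?_
        rw [trace_vecMulVec_mul_transpose]
        have h0 := dotProduct_self_nonneg_real (U k.2)
        by_cases hk : k ∈ S
        · simp [hk, hS k hk]
        · simp only [hk, if_false, zero_dotProduct, zero_mul]
          split_ifs <;> first | exact le_rfl | positivity
    _ = _ := by
        rw [sum_ite_fst_mem J (fun i => U i ⬝ᵥ U i), sum_row_dotProduct_self hU, mul_one]

/-- Second moment of the decoupled form. -/
theorem unifAvg_sq_norm_crossSum_le {U : Matrix ι δ ℝ} (hU : Uᵀ * U = 1) (J : Finset κ)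
    (hJ : J.Nonempty) (η : ι → Bool) :
    (unifAvg fun ω : κ × ι → β × Bool => ‖crossSum U J η ω‖ ^ 2) ≤
      (Fintype.card δ : ℝ) ^ 2 / (J.card * Fintype.card β) := by
  have hN : (0 : ℝ) < J.card := by exact_mod_cast hJ.card_pos
  have hb : (0 : ℝ) < Fintype.card β := by exact_mod_cast Fintype.card_pos
  set S := halfPairs J η true with hSdef
  set S' := halfPairs J η false with hSdef'
  have hS : ∀ k ∈ S, k.1 ∈ J := fun k hk => (Finset.mem_filter.1 hk).2.1
  have hS' : ∀ k ∈ S', k.1 ∈ J := fun k hk => (Finset.mem_filter.1 hk).2.1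
  rw [unifAvg_mix (fun k : κ × ι => η k.2)]
  simp only [crossSum_mix]
  have hin (ω' : κ × ι → β × Bool) :
      (unifAvg fun ω : κ × ι → β × Bool => ‖pairedSum U S J.card (bucketSum U S' ω') ω‖ ^ 2) ≤
      (J.card : ℝ)⁻¹ ^ 2 * (Fintype.card β : ℝ)⁻¹ * Fintype.card δ *
        ∑ r ∈ J, ∑ z, bucketSum U S' ω' r z ⬝ᵥ bucketSum U S' ω' r z := by
    refine (unifAvg_mono fun ω => sq_norm_le_trace _).trans ?_
    simp only [pairedSum]
    rw [unifAvg_trace_sum_mul_transpose (fun (k : κ × ι) (z : β) => Matrix.vecMulVec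
      (if k ∈ S then (J.card : ℝ)⁻¹ • U k.2 else 0) (bucketSum U S' ω' k.1 z)),
      ← sum_row_dotProduct_self hU]
    refine sum_unifAvg_le_of_bucket J (fun i => U i ⬝ᵥ U i) _ _ _ fun k z => ?_
    rw [trace_vecMulVec_mul_transpose]
    have h0 := dotProduct_self_nonneg_real (U k.2)
    have h1 := dotProduct_self_nonneg_real (bucketSum U S' ω' k.1 z)
    by_cases hk : k ∈ S
    · simp only [hk, hS k hk, if_true, smul_dotProduct, dotProduct_smul, smul_eq_mul]
      exact le_of_eq (by ring)
    · simp only [hk, if_false, zero_dotProduct, zero_mul]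
      split_ifs <;> first | exact le_rfl | positivity
  refine (unifAvg_mono hin).trans ?_
  rw [unifAvg_mul_left]
  calc _ ≤ (J.card : ℝ)⁻¹ ^ 2 * (Fintype.card β : ℝ)⁻¹ * Fintype.card δ *
        (J.card * Fintype.card δ) :=
        mul_le_mul_of_nonneg_left (unifAvg_sum_bucketSum_le hU J S' hS') (by positivity)
    _ = _ := by field_simp

/-- Tail of the decoupled form: the contributions of heavy buckets, of an unbounded sketch of
one half of the rows, and of the Bennett inequality given that half. -/
theorem crossSum_tail [Nonempty δ] {U : Matrix ι δ ℝ} (hU : Uᵀ * U = 1) (J : Finset κ)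
    (hJ : J.Nonempty) (η : ι → Bool) (K T t Q : ℝ) (hK0 : 0 < K) (ht0 : 0 ≤ t)
    (hd : (Fintype.card δ : ℝ) < Fintype.card β)
    (hK : 4 ≤ K * Real.log (Fintype.card β / Fintype.card δ))
    (hT : 2 * Real.exp 1 ≤ T)
    (hQ : Fintype.card δ * T ^ 2 * J.card / (Fintype.card β * K ^ 2) ≤ Q) (hQ1 : Q < 1)
    (htQ : 4 * K ≤ t * J.card * Real.log (1 / Q)) :
    (unifAvg fun ω : κ × ι → β × Bool => if t < ‖crossSum U J η ω‖ then (1 : ℝ) else 0) ≤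
      J.card * Fintype.card β *
        (8 * Real.exp 1 * (Fintype.card δ / Fintype.card β : ℝ) ^ (K / 2)) +
      8 * Real.exp 1 * Fintype.card δ * Real.exp (-(T / Real.exp 1)) +
      8 * Real.exp 1 * Fintype.card δ * Q ^ (t * J.card / (2 * K)) := by
  have hN : (0 : ℝ) < J.card := by exact_mod_cast hJ.card_pos
  have hN1 : (1 : ℝ) ≤ J.card := by exact_mod_cast hJ.card_pos
  have hb : (0 : ℝ) < Fintype.card β := by exact_mod_cast Fintype.card_pos
  have hTp : 0 < T := lt_of_lt_of_le (by positivity) hT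
  set S := halfPairs J η true with hSdef
  set S' := halfPairs J η false with hSdef'
  have hS : ∀ k ∈ S, k.1 ∈ J := fun k hk => (Finset.mem_filter.1 hk).2.1
  have hS' : ∀ k ∈ S', k.1 ∈ J := fun k hk => (Finset.mem_filter.1 hk).2.1
  rw [unifAvg_mix (fun k : κ × ι => η k.2)]
  simp only [crossSum_mix]
  set P := 8 * Real.exp 1 * Fintype.card δ * Q ^ (t * J.card / (2 * K)) with hP
  have hQ0 : 0 ≤ Q := le_trans (by positivity) hQ
  have hP0 : 0 ≤ P := by positivity
  have hin (ω' : κ × ι → β × Bool) :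
      (unifAvg fun ω : κ × ι → β × Bool =>
        if t < ‖pairedSum U S J.card (bucketSum U S' ω') ω‖ then (1 : ℝ) else 0) ≤
      ∑ r ∈ J, ∑ z, (if K ^ 2 < bucketSum U S' ω' r z ⬝ᵥ bucketSum U S' ω' r z then (1 : ℝ) else 0)
        + (if T < ‖bucketMatrix U S' J.card ω'‖ then (1 : ℝ) else 0) + P := by
    have hA0 : 0 ≤ ∑ r ∈ J, ∑ z,
        (if K ^ 2 < bucketSum U S' ω' r z ⬝ᵥ bucketSum U S' ω' r z then (1 : ℝ) else 0) :=
      Finset.sum_nonneg fun r _ => Finset.sum_nonneg fun z _ => by split_ifs <;> norm_num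
    have hle1 : (unifAvg fun ω : κ × ι → β × Bool =>
        if t < ‖pairedSum U S J.card (bucketSum U S' ω') ω‖ then (1 : ℝ) else 0) ≤ 1 :=
      unifAvg_le_of_le fun ω => by split_ifs <;> norm_num
    by_cases h1 : T < ‖bucketMatrix U S' J.card ω'‖
    · rw [if_pos h1]; linarith
    rw [if_neg h1]
    by_cases h2 : ∀ r ∈ J, ∀ z, bucketSum U S' ω' r z ⬝ᵥ bucketSum U S' ω' r z ≤ K ^ 2
    · have : (unifAvg fun ω : κ × ι → β × Bool =>
          if t < ‖pairedSum U S J.card (bucketSum U S' ω') ω‖ then (1 : ℝ) else 0) ≤ P := by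
        refine pairedSum_tail hU J hJ S hS _ K T t hK0 hTp ht0 h2 (fun x => ?_) Q hQ hQ1 htQ
        have h3 := dotProduct_self_mulVec_le (bucketMatrix U S' J.card ω') x
        have h4 : (bucketMatrix U S' J.card ω' *ᵥ x) ⬝ᵥ (bucketMatrix U S' J.card ω' *ᵥ x) =
            (J.card : ℝ)⁻¹ * ∑ r, ∑ z, (bucketSum U S' ω' r z ⬝ᵥ x) ^ 2 := by
          rw [dotProduct, Fintype.sum_prod_type, Finset.mul_sum]
          refine Finset.sum_congr rfl fun r _ => ?_
          rw [Finset.mul_sum]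
          refine Finset.sum_congr rfl fun z _ => ?_
          have : (bucketMatrix U S' J.card ω' *ᵥ x) (r, z) =
              (√(J.card : ℝ))⁻¹ * (bucketSum U S' ω' r z ⬝ᵥ x) := by
            change ((√(J.card : ℝ))⁻¹ • bucketSum U S' ω' r z) ⬝ᵥ x = _
            rw [smul_dotProduct, smul_eq_mul]
          rw [this, mul_mul_mul_comm, ← mul_inv, Real.mul_self_sqrt hN.le, pow_two]
        rw [h4] at h3
        have h5 : ∑ r ∈ J, ∑ z, (bucketSum U S' ω' r z ⬝ᵥ x) ^ 2 ≤
            ∑ r, ∑ z, (bucketSum U S' ω' r z ⬝ᵥ x) ^ 2 :=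
          Finset.sum_le_univ_sum_of_nonneg fun r => Finset.sum_nonneg fun z _ => sq_nonneg _
        have h6 : ‖bucketMatrix U S' J.card ω'‖ ^ 2 ≤ T ^ 2 :=
          pow_le_pow_left₀ (norm_nonneg _) (not_lt.1 h1) 2
        rw [inv_mul_le_iff₀ hN] at h3
        calc _ ≤ _ := h5
          _ ≤ _ := h3
          _ ≤ J.card * (T ^ 2 * (x ⬝ᵥ x)) := by
            have := dotProduct_self_nonneg_real x
            gcongr
          _ = _ := by ring
      linarith
    · push Not at h2
      obtain ⟨r, hr, z, hz⟩ := h2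
      have : (1 : ℝ) ≤ ∑ r ∈ J, ∑ z,
          (if K ^ 2 < bucketSum U S' ω' r z ⬝ᵥ bucketSum U S' ω' r z then (1 : ℝ) else 0) := by
        refine le_trans ?_ (Finset.single_le_sum (f := fun r => ∑ z,
          (if K ^ 2 < bucketSum U S' ω' r z ⬝ᵥ bucketSum U S' ω' r z then (1 : ℝ) else 0))
          (fun r _ => Finset.sum_nonneg fun z _ => by split_ifs <;> norm_num) hr)
        refine le_trans ?_ (Finset.single_le_sum (f := fun z =>
          (if K ^ 2 < bucketSum U S' ω' r z ⬝ᵥ bucketSum U S' ω' r z then (1 : ℝ) else 0))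
          (fun z _ => by split_ifs <;> norm_num) (Finset.mem_univ z))
        simp [hz]
      linarith
  refine (unifAvg_mono hin).trans ?_
  rw [unifAvg_add, unifAvg_add, unifAvg_const]
  have hcard : (Fintype.card δ : ℝ) ≤ J.card * Fintype.card β := by nlinarith
  have hb1 := bucketMatrix_norm_tail (β := β) hU J hJ S' hS' hcard T hT
  have hb2 : (unifAvg fun ω' : κ × ι → β × Bool => ∑ r ∈ J, ∑ z,
      (if K ^ 2 < bucketSum U S' ω' r z ⬝ᵥ bucketSum U S' ω' r z then (1 : ℝ) else 0)) ≤
      J.card * Fintype.card β *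
        (8 * Real.exp 1 * (Fintype.card δ / Fintype.card β : ℝ) ^ (K / 2)) := by
    simp only [unifAvg_sum]
    calc _ ≤ ∑ r ∈ J, ∑ z : β,
          (8 * Real.exp 1 * (Fintype.card δ / Fintype.card β : ℝ) ^ (K / 2)) :=
          Finset.sum_le_sum fun r _ => Finset.sum_le_sum fun z _ =>
            bucketSum_tail hU S' r z hd K hK0.le hK
      _ = _ := by simp [mul_assoc]
  exact add_le_add (add_le_add hb2 hb1) le_rfl

end Cross

/-! ### Decoupling -/

section Decoupling

variable {κ ι δ β : Type*} [Fintype κ] [Fintype ι] [Fintype δ] [Fintype β] [DecidableEq κ]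
  [DecidableEq ι] [DecidableEq δ] [DecidableEq β]

/-- The product of signs of two rows of a block if they share a bucket, and `0` otherwise. -/
def collision (ω : κ × ι → β × Bool) (r : κ) (i j : ι) : ℝ :=
  if (ω (r, i)).1 = (ω (r, j)).1 then boolSign (ω (r, i)).2 * boolSign (ω (r, j)).2 else 0

/-- The Gram matrix `Uᵀ S Sᵀ U` of the sketch `S` made of the blocks in `J`. -/
noncomputable def sketchGram (U : Matrix ι δ ℝ) (J : Finset κ) (ω : κ × ι → β × Bool) :
    Matrix δ δ ℝ :=
  (J.card : ℝ)⁻¹ • ∑ r ∈ J, ∑ i, ∑ j, collision ω r i j • Matrix.vecMulVec (U i) (U j)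

omit [Fintype δ] [Fintype β] [DecidableEq δ] in
theorem crossSum_eq_sum (U : Matrix ι δ ℝ) (J : Finset κ) (η : ι → Bool)
    (ω : κ × ι → β × Bool) :
    crossSum U J η ω = (J.card : ℝ)⁻¹ • ∑ r ∈ J, ∑ i, ∑ j,
      ((if η i then 1 else 0) * (if η j then 0 else 1) : ℝ) •
        collision ω r i j • Matrix.vecMulVec (U i) (U j) := by
  ext a c
  simp only [crossSum, pairedSum, Matrix.sum_apply, Matrix.smul_apply, Matrix.vecMulVec_apply,
    bucketSum, Finset.sum_apply, Pi.smul_apply, smul_eq_mul]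
  rw [Fintype.sum_prod_type, Finset.mul_sum, ← Finset.sum_subset (Finset.subset_univ J)]
  · refine Finset.sum_congr rfl fun r hr => ?_
    rw [Finset.mul_sum]
    refine Finset.sum_congr rfl fun i _ => ?_
    rw [Finset.mul_sum, Finset.mul_sum, Finset.mul_sum]
    refine Finset.sum_congr rfl fun j _ => ?_
    by_cases h1 : η i = true <;> by_cases h2 : η j = true <;>
      by_cases h3 : (ω (r, i)).1 = (ω (r, j)).1
    all_goals simp [halfPairs, hr, h1, h2, h3, collision, eq_comm (a := (ω (r, j)).1)]
    ring
  · intro r _ hr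
    refine Finset.sum_eq_zero fun i _ => ?_
    simp [halfPairs, hr]

theorem unifAvg_separate (i j : ι) :
    (unifAvg fun η : ι → Bool => ((if η i then 1 else 0) * (if η j then 0 else 1) : ℝ)) =
      if i = j then 0 else 1 / 4 := by
  by_cases h : i = j
  · subst h
    have (η : ι → Bool) : ((if η i then 1 else 0) * (if η i then 0 else 1) : ℝ) = 0 := by
      split_ifs <;> simp
    simp only [this, if_true, unifAvg_const]
  · rw [if_neg h, unifAvg_update i]
    have h' : j ≠ i := fun e => h e.symm
    simp only [Function.update_self, Function.update_of_ne h', unifAvg_mul_right]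
    rw [unifAvg_mul_left, unifAvg_update j]
    simp only [Function.update_self, unifAvg_const]
    simp [unifAvg]
    norm_num

omit [Fintype κ] [Fintype β] [Fintype δ] in
/-- A uniformly random bipartition separates each pair of distinct rows in a given order with
probability `1 / 4`; rows paired with themselves contribute the identity. -/
theorem sketchGram_sub_one_eq [Fintype κ] {U : Matrix ι δ ℝ} (hU : Uᵀ * U = 1) (J : Finset κ)
    (hJ : J.Nonempty) (ω : κ × ι → β × Bool) :
    sketchGram U J ω - 1 = (4 : ℝ) • unifAvg fun η : ι → Bool => crossSum U J η ω := by
  have hN : (J.card : ℝ) ≠ 0 := by exact_mod_cast hJ.card_pos.ne'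
  have h1 (r : κ) : ∑ i, ∑ j, collision ω r i j • Matrix.vecMulVec (U i) (U j) =
      1 + ∑ i, ∑ j, (if i = j then 0 else (1 : ℝ)) • collision ω r i j •
        Matrix.vecMulVec (U i) (U j) := by
    have hdiag : (1 : Matrix δ δ ℝ) =
        ∑ i, ∑ j, (if i = j then (1 : ℝ) else 0) • collision ω r i j •
          Matrix.vecMulVec (U i) (U j) := by
      simp only [ite_smul, one_smul, zero_smul, Finset.sum_ite_eq, Finset.mem_univ, if_true]
      rw [← hU]
      ext a c
      simp [collision, boolSign_mul_self, Matrix.mul_apply, Matrix.sum_apply,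
        Matrix.vecMulVec_apply]
    rw [hdiag, ← Finset.sum_add_distrib]
    refine Finset.sum_congr rfl fun i _ => ?_
    rw [← Finset.sum_add_distrib]
    refine Finset.sum_congr rfl fun j _ => ?_
    rw [← add_smul]
    split_ifs <;> simp
  have hsm (i j : ι) (B : Matrix δ δ ℝ) : (unifAvg fun η : ι → Bool =>
      ((if η i then 1 else 0) * (if η j then 0 else 1) : ℝ) • B) =
      (if i = j then (0 : ℝ) else 1 / 4) • B := by
    rw [← unifAvg_separate i j]
    exact (map_unifAvg (LinearMap.toSpanSingleton ℝ (Matrix δ δ ℝ) B) _).symm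
  simp only [crossSum_eq_sum]
  rw [unifAvg_smul, sketchGram]
  simp only [unifAvg_sum, hsm, h1, Finset.sum_add_distrib]
  rw [Finset.sum_const, ← Nat.cast_smul_eq_nsmul ℝ, smul_add, smul_smul, inv_mul_cancel₀ hN,
    one_smul, add_sub_cancel_left, smul_comm (4 : ℝ)]
  congr 1
  simp only [Finset.smul_sum, smul_smul]
  refine Finset.sum_congr rfl fun r _ => Finset.sum_congr rfl fun i _ =>
    Finset.sum_congr rfl fun j _ => ?_
  congr 1
  split_ifs <;> ring

theorem norm_unifAvg_le {Y E : Type*} [Fintype Y] [NormedAddCommGroup E] [NormedSpace ℝ E]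
    (f : Y → E) : ‖unifAvg f‖ ≤ unifAvg fun y => ‖f y‖ := by
  rw [unifAvg, unifAvg, norm_smul, smul_eq_mul, Real.norm_of_nonneg (by positivity)]
  gcongr
  exact norm_sum_le _ _

variable [Nonempty β]

/-- If the sketch distorts the Gram matrix by more than `ε`, then the decoupled forms are large on
average over the bipartition. The average of `‖crossSum‖` over its tail is split by
`2 x 𝟙 ≤ a x² + 𝟙 / a` with `a = 1 / (ε d)`. -/
theorem sketchGram_tail [Nonempty δ] {U : Matrix ι δ ℝ} (hU : Uᵀ * U = 1) (J : Finset κ)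
    (hJ : J.Nonempty) (ε P : ℝ) (hε : 0 < ε)
    (hP : ∀ η : ι → Bool, (unifAvg fun ω : κ × ι → β × Bool =>
      if ε / 8 < ‖crossSum U J η ω‖ then (1 : ℝ) else 0) ≤ P) :
    (unifAvg fun ω : κ × ι → β × Bool => if ε < ‖sketchGram U J ω - 1‖ then (1 : ℝ) else 0) ≤
      4 * Fintype.card δ / (ε ^ 2 * (J.card * Fintype.card β)) + 4 * Fintype.card δ * P := by
  have hdp : (0 : ℝ) < Fintype.card δ := by exact_mod_cast Fintype.card_pos
  have hN : (0 : ℝ) < J.card := by exact_mod_cast hJ.card_pos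
  have hb : (0 : ℝ) < Fintype.card β := by exact_mod_cast Fintype.card_pos
  set d : ℝ := (Fintype.card δ : ℝ) with hd'
  let g : (ι → Bool) → (κ × ι → β × Bool) → ℝ := fun η ω =>
    (1 / (ε * d)) * ‖crossSum U J η ω‖ ^ 2 +
      (ε * d) * (if ε / 8 < ‖crossSum U J η ω‖ then (1 : ℝ) else 0)
  have hg0 (η ω) : 0 ≤ g η ω := by
    simp only [g]; split_ifs <;> positivity
  have hpt (ω : κ × ι → β × Bool) : (if ε < ‖sketchGram U J ω - 1‖ then (1 : ℝ) else 0) ≤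
      4 / ε * unifAvg fun η => g η ω := by
    have hnn : 0 ≤ 4 / ε * unifAvg fun η => g η ω :=
      mul_nonneg (by positivity) (unifAvg_nonneg fun η => hg0 η ω)
    split_ifs with h
    · have h1 : ‖sketchGram U J ω - 1‖ ≤ 4 * unifAvg fun η : ι → Bool => ‖crossSum U J η ω‖ := by
        rw [sketchGram_sub_one_eq hU J hJ, norm_smul, Real.norm_of_nonneg (by norm_num)]
        exact mul_le_mul_of_nonneg_left (norm_unifAvg_le _) (by norm_num)
      have h2 : (unifAvg fun η : ι → Bool => ‖crossSum U J η ω‖) ≤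
          unifAvg fun η => (ε / 8 + g η ω / 2) := by
        refine unifAvg_mono fun η => ?_
        simp only [g]
        set x := ‖crossSum U J η ω‖
        have hεd : 0 < ε * d := by positivity
        split_ifs with h3
        · have : 2 * x ≤ 1 / (ε * d) * x ^ 2 + ε * d := by
            have e1 : 1 / (ε * d) * x ^ 2 + ε * d - 2 * x = (x - ε * d) ^ 2 / (ε * d) := by
              field_simp; ring
            have e2 : 0 ≤ (x - ε * d) ^ 2 / (ε * d) := by positivity
            linarith
          linarith
        · have : 0 ≤ 1 / (ε * d) * x ^ 2 := by positivity
          linarith [not_lt.1 h3]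
      have h3 : (unifAvg fun η => (ε / 8 + g η ω / 2)) =
          ε / 8 + (unifAvg fun η => g η ω) * (1 / 2) := by
        rw [unifAvg_add, unifAvg_const]
        simp only [div_eq_mul_one_div (g _ ω) 2]
        rw [unifAvg_mul_right]
      rw [h3] at h2
      rw [div_mul_eq_mul_div, le_div_iff₀ hε]
      linarith
    · exact hnn
  refine (unifAvg_mono hpt).trans ?_
  rw [unifAvg_mul_left, unifAvg_comm]
  have hη (η : ι → Bool) : (unifAvg fun ω => g η ω) ≤
      1 / (ε * d) * (d ^ 2 / (J.card * Fintype.card β)) + ε * d * P := by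
    simp only [g]
    rw [unifAvg_add, unifAvg_mul_left, unifAvg_mul_left]
    have h1 := unifAvg_sq_norm_crossSum_le (β := β) hU J hJ η
    have h2 := hP η
    gcongr
  calc 4 / ε * unifAvg (fun η => unifAvg fun ω => g η ω)
      ≤ 4 / ε * (1 / (ε * d) * (d ^ 2 / (J.card * Fintype.card β)) + ε * d * P) :=
        mul_le_mul_of_nonneg_left (unifAvg_le_of_le hη) (by positivity)
    _ = _ := by field_simp

end Decoupling

/-! ### The law of the sketch as a uniform average -/

section Law

theorem countSketchLaw_singleton (n b : ℕ) (hb : 0 < b) (ω : CountSketchSeed n b) :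
    (countSketchLaw n b) {ω} = ((2 * b : ℕ) : ENNReal)⁻¹ ^ n := by
  have : NeZero b := ⟨hb.ne'⟩
  have hp : IsProbabilityMeasure (uniformOn (Set.univ : Set (Fin b × Bool))) :=
    isProbabilityMeasure_uniformOn Set.finite_univ Set.univ_nonempty
  rw [countSketchLaw, Measure.pi_singleton]
  have (i : Fin n) : uniformOn (Set.univ : Set (Fin b × Bool)) {ω i} =
      ((2 * b : ℕ) : ENNReal)⁻¹ := by
    rw [uniformOn_univ]
    simp [mul_comm]
  simp [this]

theorem overSketchLaw_real_eq_unifAvg (K n b : ℕ) (hb : 0 < b) (s : Set (OverSketchSeed K n b))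
    [DecidablePred (· ∈ s)] :
    (overSketchLaw K n b).real s =
      unifAvg fun ω : Fin K × Fin n → Fin b × Bool =>
        if (fun r i => ω (r, i)) ∈ s then (1 : ℝ) else 0 := by
  have : NeZero b := ⟨hb.ne'⟩
  have hp : IsProbabilityMeasure (uniformOn (Set.univ : Set (Fin b × Bool))) :=
    isProbabilityMeasure_uniformOn Set.finite_univ Set.univ_nonempty
  have hp1 : IsProbabilityMeasure (countSketchLaw n b) := by
    unfold countSketchLaw; infer_instance
  have hp2 : IsProbabilityMeasure (overSketchLaw K n b) := by
    unfold overSketchLaw; infer_instance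
  have hs (ω : OverSketchSeed K n b) :
      (overSketchLaw K n b).real {ω} = ((2 * b : ℝ)⁻¹ ^ n) ^ K := by
    rw [Measure.real, overSketchLaw, Measure.pi_singleton]
    simp [countSketchLaw_singleton n b hb]
  have h1 := unifAvg_equiv (Equiv.curry (Fin K) (Fin n) (Fin b × Bool))
    (fun ω : OverSketchSeed K n b => if ω ∈ s then (1 : ℝ) else 0)
  have h2 : (fun ω : Fin K × Fin n → Fin b × Bool =>
      if (fun r i => ω (r, i)) ∈ s then (1 : ℝ) else 0) = fun ω =>
      if Equiv.curry (Fin K) (Fin n) (Fin b × Bool) ω ∈ s then (1 : ℝ) else 0 := rfl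
  rw [h2, h1]
  have h3 : (overSketchLaw K n b).real s =
      ∑ ω ∈ Finset.univ.filter (· ∈ s), (overSketchLaw K n b).real {ω} := by
    rw [sum_measureReal_singleton]; simp
  rw [h3]
  simp only [hs, unifAvg, Finset.sum_const, nsmul_eq_mul, smul_eq_mul, Finset.sum_boole]
  rw [mul_comm]
  congr 1
  simp only [Fintype.card_pi, Fintype.card_prod, Fintype.card_fin, Fintype.card_bool,
    Finset.prod_const, Finset.card_univ]
  push_cast
  rw [inv_pow, inv_pow, mul_comm (2 : ℝ)]

end Law

/-! ### The line search with an approximate Hessian -/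

section Newton

theorem le_add_of_deriv_deriv_le (φ ψ ψ' : ℝ → ℝ) (c : ℝ) (hφ : ∀ t, HasDerivAt φ (ψ t) t)
    (hψ : ∀ t, HasDerivAt ψ (ψ' t) t) (hc : ∀ t, ψ' t ≤ c) : φ 1 ≤ φ 0 + ψ 0 + c / 2 := by
  have h1 : Antitone fun t => ψ t - c * t := by
    have hd (t : ℝ) : HasDerivAt (fun t => ψ t - c * t) (ψ' t - c) t := by
      exact ((hψ t).sub ((hasDerivAt_id t).const_mul c)).congr_deriv (by simp)
    refine antitone_of_deriv_nonpos (fun t => (hd t).differentiableAt) fun t => ?_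
    rw [(hd t).deriv]; linarith [hc t]
  have hd2 (t : ℝ) : HasDerivAt (fun t => φ t - ψ 0 * t - c / 2 * t ^ 2) (ψ t - ψ 0 - c * t) t := by
    have e1 := ((hφ t).sub ((hasDerivAt_id t).const_mul (ψ 0))).sub
      (((hasDerivAt_pow 2 t)).const_mul (c / 2))
    refine e1.congr_deriv ?_
    simp; ring
  have h2 : AntitoneOn (fun t => φ t - ψ 0 * t - c / 2 * t ^ 2) (Set.Icc 0 1) := by
    refine antitoneOn_of_deriv_nonpos (convex_Icc 0 1)
      (fun t _ => (hd2 t).continuousAt.continuousWithinAt)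
      (fun t _ => (hd2 t).differentiableAt.differentiableWithinAt) fun t ht => ?_
    rw [interior_Icc] at ht
    rw [(hd2 t).deriv]
    have := h1 ht.1.le
    simp only [mul_zero, sub_zero] at this
    linarith
  have := h2 (Set.left_mem_Icc.2 zero_le_one) (Set.right_mem_Icc.2 zero_le_one) zero_le_one
  simp at this
  linarith

variable {d : ℕ} {f : Vec d → ℝ}

theorem inner_fderiv_gradient (x v : Vec d) :
    inner ℝ (fderiv ℝ (gradient f) x v) v = v.ofLp ⬝ᵥ hessian f x *ᵥ v.ofLp := by
  have h1 : v = ∑ j, v.ofLp j • EuclideanSpace.single j (1 : ℝ) := by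
    ext i; simp [Finset.sum_apply, Pi.single_apply]
  have h2 : (fderiv ℝ (gradient f) x v).ofLp = hessian f x *ᵥ v.ofLp := by
    conv_lhs => rw [h1]
    rw [map_sum]
    ext i
    simp [hessian, Matrix.mulVec, dotProduct, mul_comm]
  rw [EuclideanSpace.inner_eq_star_dotProduct, h2, star_trivial]

theorem hasDerivAt_comp_line (hf : TwiceDifferentiable f) (w v : Vec d) (t : ℝ) :
    HasDerivAt (fun t : ℝ => f (w + t • v)) (inner ℝ (gradient f (w + t • v)) v) t ∧
      HasDerivAt (fun t : ℝ => inner ℝ (gradient f (w + t • v)) v)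
        (inner ℝ (fderiv ℝ (gradient f) (w + t • v) v) v) t := by
  have hl : HasDerivAt (fun t : ℝ => w + t • v) v t := by
    simpa using ((hasDerivAt_id t).smul_const v).const_add w
  constructor
  · have h1 := (hf.1 (w + t • v)).hasGradientAt.hasFDerivAt.comp_hasDerivAt t hl
    exact h1.congr_deriv (by simp)
  · have h2 := (hf.2 (w + t • v)).hasFDerivAt.comp_hasDerivAt t hl
    have h3 := h2.inner ℝ (hasDerivAt_const t v)
    simpa using h3

theorem ofLp_dotProduct_self {d : ℕ} (v : Vec d) : v.ofLp ⬝ᵥ v.ofLp = ‖v‖ ^ 2 := by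
  rw [EuclideanSpace.real_norm_sq_eq]; simp [dotProduct, pow_two]

theorem smooth_upper_bound {M : ℝ} (hf : TwiceDifferentiable f) (hM : IsSmoothHess M f)
    (w v : Vec d) : f (w + v) ≤ f w + inner ℝ (gradient f w) v + M * ‖v‖ ^ 2 / 2 := by
  have := le_add_of_deriv_deriv_le _ _ _ (M * ‖v‖ ^ 2)
    (fun t => (hasDerivAt_comp_line hf w v t).1) (fun t => (hasDerivAt_comp_line hf w v t).2)
    (fun t => ?_)
  · simpa using this
  · have := (hM (w + t • v)).dotProduct_mulVec_nonneg v.ofLp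
    rw [star_trivial, Matrix.sub_mulVec, dotProduct_sub, Matrix.smul_mulVec, Matrix.one_mulVec,
      dotProduct_smul, ofLp_dotProduct_self, smul_eq_mul] at this
    rw [inner_fderiv_gradient]; linarith

theorem strongConvex_lower_bound {k : ℝ} (hf : TwiceDifferentiable f)
    (hk : IsStronglyConvexHess k f) (w v : Vec d) :
    f w + inner ℝ (gradient f w) v + k * ‖v‖ ^ 2 / 2 ≤ f (w + v) := by
  have := le_add_of_deriv_deriv_le _ _ _ (-(k * ‖v‖ ^ 2))
    (fun t => (hasDerivAt_comp_line hf w v t).1.neg)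
    (fun t => (hasDerivAt_comp_line hf w v t).2.neg) (fun t => ?_)
  · simp only [Pi.neg_apply, one_smul, zero_smul, add_zero] at this
    linarith
  · have := (hk (w + t • v)).dotProduct_mulVec_nonneg v.ofLp
    rw [star_trivial, Matrix.sub_mulVec, dotProduct_sub, Matrix.smul_mulVec, Matrix.one_mulVec,
      dotProduct_smul, ofLp_dotProduct_self, smul_eq_mul] at this
    rw [inner_fderiv_gradient]; linarith

/-- The Polyak–Łojasiewicz inequality. -/
theorem sub_le_sq_norm_gradient {k : ℝ} (hk0 : 0 < k) (hf : TwiceDifferentiable f)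
    (hk : IsStronglyConvexHess k f) (w x : Vec d) :
    2 * k * (f w - f x) ≤ ‖gradient f w‖ ^ 2 := by
  have h1 := strongConvex_lower_bound hf hk w (x - w)
  rw [add_sub_cancel] at h1
  have h2 := abs_real_inner_le_norm (gradient f w) (x - w)
  have h3 := neg_abs_le (inner ℝ (gradient f w) (x - w))
  nlinarith [sq_nonneg (‖gradient f w‖ - k * ‖x - w‖)]

/-- A spectral approximation of the Hessian with relative error `ε` makes a good Newton step. -/
theorem goodStep_of_approx {k M β ε : ℝ} (hf : TwiceDifferentiable f) (hk0 : 0 < k) (hkM : k ≤ M)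
    (hk : IsStronglyConvexHess k f) (hM : IsSmoothHess M f) (hβ : 0 < β) (hβ2 : β ≤ 1 / 2)
    (hε : 0 < ε) (hε1 : ε < 1) (wstar w : Vec d)
    (H : Matrix (Fin d) (Fin d) ℝ) (hH : Hᵀ = H)
    (hlo : ∀ x : Fin d → ℝ, (1 - ε) * (x ⬝ᵥ hessian f w *ᵥ x) ≤ x ⬝ᵥ H *ᵥ x)
    (hhi : ∀ x : Fin d → ℝ, x ⬝ᵥ H *ᵥ x ≤ (1 + ε) * (x ⬝ᵥ hessian f w *ᵥ x)) :
    GoodStep f k M β ε wstar w H := by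
  have hM0 : 0 < M := hk0.trans_le hkM
  have hlo' (x : Fin d → ℝ) : (1 - ε) * k * (x ⬝ᵥ x) ≤ x ⬝ᵥ H *ᵥ x := by
    have := (hk w).dotProduct_mulVec_nonneg x
    rw [star_trivial, Matrix.sub_mulVec, dotProduct_sub, Matrix.smul_mulVec, Matrix.one_mulVec,
      dotProduct_smul, smul_eq_mul] at this
    have h2 := hlo x
    nlinarith
  have hhi' (x : Fin d → ℝ) : x ⬝ᵥ H *ᵥ x ≤ (1 + ε) * M * (x ⬝ᵥ x) := by
    have := (hM w).dotProduct_mulVec_nonneg x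
    rw [star_trivial, Matrix.sub_mulVec, dotProduct_sub, Matrix.smul_mulVec, Matrix.one_mulVec,
      dotProduct_smul, smul_eq_mul] at this
    have h2 := hhi x
    nlinarith
  have hunit : IsUnit H.det := by
    rw [← Matrix.isUnit_iff_isUnit_det, ← Matrix.mulVec_injective_iff_isUnit]
    refine (injective_iff_map_eq_zero (Matrix.mulVecLin H)).2 fun x hx => ?_
    have h1 := hlo' x
    rw [Matrix.mulVecLin_apply] at hx
    rw [hx, dotProduct_zero] at h1
    have h2 := dotProduct_self_nonneg_real x
    have h3 : 0 < (1 - ε) * k := mul_pos (by linarith) hk0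
    exact dotProduct_self_eq_zero.1 (le_antisymm (by nlinarith) h2)
  refine ⟨hunit, ?_⟩
  set g : Fin d → ℝ := (gradient f w).ofLp with hg
  set q : Fin d → ℝ := H⁻¹ *ᵥ g with hq
  set p : Vec d := newtonDirection f H w with hp
  have hpq : p = -WithLp.toLp 2 q := rfl
  have hHq : H *ᵥ q = g := by
    rw [hq, Matrix.mulVec_mulVec, Matrix.mul_nonsing_inv _ hunit, Matrix.one_mulVec]
  have hpg : inner ℝ (gradient f w) p = -(q ⬝ᵥ g) := by
    rw [EuclideanSpace.inner_eq_star_dotProduct, hpq, star_trivial]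
    simp [hg]
  have hpp : ‖p‖ ^ 2 = q ⬝ᵥ q := by
    rw [hpq, norm_neg, ← ofLp_dotProduct_self]
  have hqg : (1 - ε) * k * (q ⬝ᵥ q) ≤ q ⬝ᵥ g := by
    have := hlo' q; rwa [hHq] at this
  have hqq := dotProduct_self_nonneg_real q
  have hqg0 : 0 ≤ q ⬝ᵥ g :=
    le_trans (mul_nonneg (mul_nonneg (by linarith) hk0.le) hqq) hqg
  set α₀ := min 1 (2 * (1 - β) * (1 - ε) * k / M) with hα₀
  have hα₀pos : 0 < α₀ := by
    refine lt_min one_pos (div_pos (mul_pos (mul_pos ?_ ?_) hk0) hM0) <;> linarith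
  have hmem : α₀ ∈ armijoSteps f β w p := by
    refine ⟨min_le_left _ _, ?_⟩
    have h1 := smooth_upper_bound hf hM w (α₀ • p)
    rw [inner_smul_right, hpg, norm_smul, mul_pow, hpp, Real.norm_of_nonneg hα₀pos.le] at h1
    rw [real_inner_comm, hpg]
    have h2 : α₀ * M ≤ 2 * (1 - β) * (1 - ε) * k := by
      rw [← le_div_iff₀ hM0]; exact min_le_right _ _
    have h3 : α₀ * M * (q ⬝ᵥ q) ≤ 2 * (1 - β) * (q ⬝ᵥ g) := by
      calc α₀ * M * (q ⬝ᵥ q) ≤ 2 * (1 - β) * (1 - ε) * k * (q ⬝ᵥ q) := by gcongr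
        _ = 2 * (1 - β) * ((1 - ε) * k * (q ⬝ᵥ q)) := by ring
        _ ≤ _ := mul_le_mul_of_nonneg_left hqg (by linarith)
    have h4 := mul_le_mul_of_nonneg_left h3 hα₀pos.le
    linarith
  have hclosed : IsClosed (armijoSteps f β w p) := by
    have hc : Continuous f := hf.1.continuous
    have h1 : IsClosed {α : ℝ | α ≤ 1} := isClosed_le continuous_id continuous_const
    have h2 : IsClosed {α : ℝ | f (w + α • p) ≤ f w + α * β * inner ℝ p (gradient f w)} :=
      isClosed_le (by fun_prop) (by fun_prop)
    exact h1.inter h2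
  have hbdd : BddAbove (armijoSteps f β w p) := ⟨1, fun α hα => hα.1⟩
  have hgreat : IsGreatest (armijoSteps f β w p) (sSup (armijoSteps f β w p)) :=
    ⟨hclosed.csSup_mem ⟨α₀, hmem⟩ hbdd, fun α hα => le_csSup hbdd hα⟩
  set α := sSup (armijoSteps f β w p) with hα
  have hαge : α₀ ≤ α := hgreat.2 hmem
  refine ⟨α, hgreat, hαge, ?_⟩
  have hα0 : 0 ≤ α := hα₀pos.le.trans hαge
  have harm := hgreat.1.2
  rw [real_inner_comm, hpg] at harm
  set m := M * (1 + ε) with hm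
  have hmpos : 0 < m := mul_pos hM0 (by linarith)
  -- positivity of the quadratic form of `H` at `g - m q`
  have hgq : g ⬝ᵥ g ≤ m * (q ⬝ᵥ g) := by
    have h1 : 0 ≤ (g - m • q) ⬝ᵥ H *ᵥ (g - m • q) :=
      le_trans (mul_nonneg (mul_nonneg (by linarith) hk0.le) (dotProduct_self_nonneg_real _))
        (hlo' (g - m • q))
    have h2 : q ⬝ᵥ H *ᵥ g = g ⬝ᵥ g := by
      rw [Matrix.dotProduct_mulVec, ← Matrix.mulVec_transpose, hH, hHq]
    rw [Matrix.mulVec_sub, Matrix.mulVec_smul, hHq, sub_dotProduct, dotProduct_sub,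
      dotProduct_sub, smul_dotProduct, smul_dotProduct, dotProduct_smul, dotProduct_smul,
      h2] at h1
    simp only [smul_eq_mul] at h1
    have h3 := hhi' g
    have h4 : m * (g ⬝ᵥ g) ≤ m * (m * (q ⬝ᵥ g)) := by
      rw [hm] at h1 ⊢; linarith
    exact le_of_mul_le_mul_left h4 hmpos
  have hPL := sub_le_sq_norm_gradient hk0 hf hk w wstar
  rw [← ofLp_dotProduct_self] at hPL
  have h5 : 2 * k * (f w - f wstar) ≤ m * (q ⬝ᵥ g) := hPL.trans hgq
  have h6 : 2 * α * β * k / m * (f w - f wstar) ≤ α * β * (q ⬝ᵥ g) := by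
    rw [div_mul_eq_mul_div, div_le_iff₀ hmpos]
    have := mul_le_mul_of_nonneg_left h5 (mul_nonneg hα0 hβ.le)
    linarith
  rw [sub_mul, one_mul]
  linarith

end Newton

/-! ### The sketched Hessian as a spectral approximation -/

section Assembly

/-- Whitening: a factor of a positive definite matrix is an isometry times an invertible matrix. -/
theorem exists_isometry_factor {n d : ℕ} (A : Matrix (Fin n) (Fin d) ℝ)
    (H : Matrix (Fin d) (Fin d) ℝ) (hAH : Aᵀ * A = H) (k : ℝ) (hk : 0 < k)
    (hH : (H - k • (1 : Matrix (Fin d) (Fin d) ℝ)).PosSemidef) :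
    ∃ (U : Matrix (Fin n) (Fin d) ℝ) (B : Matrix (Fin d) (Fin d) ℝ), Uᵀ * U = 1 ∧ A = U * B := by
  have hsym : Hᵀ = H := by rw [← hAH, Matrix.transpose_mul, Matrix.transpose_transpose]
  obtain ⟨V, h, hV, hV', hd, -⟩ := Matrix.exists_spectral H hsym
  have hpos (i) : 0 < h i := by
    have h1 := hH.conj_diag_nonneg V i
    rw [mul_sub, sub_mul, Matrix.conj_conj_diag _ V _ hV' hd, Matrix.mul_smul, mul_one,
      Matrix.smul_mul, hV', Matrix.sub_apply, Matrix.diagonal_apply_eq, Matrix.smul_apply,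
      Matrix.one_apply_eq, smul_eq_mul, mul_one] at h1
    linarith
  refine ⟨A * (V * Matrix.diagonal fun i => (√(h i))⁻¹), Matrix.diagonal (fun i => √(h i)) * Vᵀ,
    ?_, ?_⟩
  · calc (A * (V * Matrix.diagonal fun i => (√(h i))⁻¹))ᵀ *
          (A * (V * Matrix.diagonal fun i => (√(h i))⁻¹))
        = (Matrix.diagonal fun i => (√(h i))⁻¹) * (Vᵀ * (Aᵀ * A) * V) *
          Matrix.diagonal fun i => (√(h i))⁻¹ := by
          simp only [Matrix.transpose_mul, Matrix.diagonal_transpose, Matrix.mul_assoc]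
      _ = 1 := by
          rw [hAH, Matrix.conj_conj_diag _ V _ hV' hd, Matrix.diagonal_mul_diagonal,
            Matrix.diagonal_mul_diagonal, ← Matrix.diagonal_one]
          congr 1
          funext i
          have h1 := Real.mul_self_sqrt (hpos i).le
          have h2 : √(h i) ≠ 0 := (Real.sqrt_pos.2 (hpos i)).ne'
          field_simp
          nlinarith
  · have h1 : (Matrix.diagonal fun i => (√(h i))⁻¹) * (Matrix.diagonal fun i => √(h i)) = 1 := by
      rw [Matrix.diagonal_mul_diagonal, ← Matrix.diagonal_one]
      congr 1
      funext i
      exact inv_mul_cancel₀ (Real.sqrt_pos.2 (hpos i)).ne'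
    calc A = A * (V * 1 * Vᵀ) := by rw [mul_one, hV, Matrix.mul_one]
      _ = _ := by rw [← h1]; simp only [Matrix.mul_assoc]

theorem sketchedHessian_overSketch {n d K b : ℕ} (U : Matrix (Fin n) (Fin d) ℝ) (N : ℕ)
    (J : Finset (Fin K)) (hJ : J.card = N) (ω : Fin K × Fin n → Fin b × Bool) :
    sketchedHessian U (overSketch N J fun r i => ω (r, i)) = sketchGram U J ω := by
  have hS (i j : Fin n) : ((overSketch N J fun r i => ω (r, i)) *
      (overSketch N J fun r i => ω (r, i))ᵀ) i j = (N : ℝ)⁻¹ * ∑ r ∈ J, collision ω r i j := by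
    rw [Matrix.mul_apply, Fintype.sum_prod_type, Finset.mul_sum,
      ← Finset.sum_coe_sort J (fun r => (N : ℝ)⁻¹ * collision ω r i j)]
    refine Finset.sum_congr rfl fun r _ => ?_
    have hsq : (1 / √(N : ℝ)) * (1 / √(N : ℝ)) = (N : ℝ)⁻¹ := by
      rw [one_div, ← mul_inv, Real.mul_self_sqrt (Nat.cast_nonneg N)]
    have hterm (l : Fin b) : (overSketch N J fun r i => ω (r, i)) i (r, l) *
        (overSketch N J fun r i => ω (r, i))ᵀ (r, l) j = (N : ℝ)⁻¹ *
        ((if (ω (r, i)).1 = l then boolSign (ω (r, i)).2 else 0) *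
          (if (ω (r, j)).1 = l then boolSign (ω (r, j)).2 else 0)) := by
      rw [← hsq]
      simp only [overSketch, countSketch, Matrix.transpose_apply, Matrix.of_apply, boolSign]
      ring
    simp only [hterm, ← Finset.mul_sum]
    congr 1
    simp only [ite_mul, zero_mul, Finset.sum_ite_eq, Finset.mem_univ, if_true, collision, mul_ite,
      mul_zero]
  have hG : sketchedHessian U (overSketch N J fun r i => ω (r, i)) =
      Uᵀ * ((overSketch N J fun r i => ω (r, i)) * (overSketch N J fun r i => ω (r, i))ᵀ) * U := by
    simp only [sketchedHessian, Matrix.mul_assoc]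
  rw [hG]
  generalize (overSketch N J fun r i => ω (r, i)) * (overSketch N J fun r i => ω (r, i))ᵀ = W at hS
  ext a c
  have hr : sketchGram U J ω a c =
      ∑ r ∈ J, ∑ i, ∑ j, (N : ℝ)⁻¹ * (collision ω r i j * (U i a * U j c)) := by
    simp only [sketchGram, hJ, Matrix.smul_apply, Matrix.sum_apply, Matrix.vecMulVec_apply,
      smul_eq_mul, Finset.mul_sum]
  have hl : (Uᵀ * W * U) a c =
      ∑ j, ∑ i, ∑ r ∈ J, (N : ℝ)⁻¹ * (collision ω r i j * (U i a * U j c)) := by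
    simp only [Matrix.mul_apply, hS, Matrix.transpose_apply, Finset.sum_mul, Finset.mul_sum]
    refine Finset.sum_congr rfl fun j _ => Finset.sum_congr rfl fun i _ =>
      Finset.sum_congr rfl fun r _ => ?_
    ring
  rw [hr, hl, Finset.sum_comm]
  have hc (i : Fin n) : ∑ j, ∑ r ∈ J, (N : ℝ)⁻¹ * (collision ω r i j * (U i a * U j c)) =
      ∑ r ∈ J, ∑ j, (N : ℝ)⁻¹ * (collision ω r i j * (U i a * U j c)) := Finset.sum_comm
  simp only [hc]
  exact Finset.sum_comm

theorem abs_dotProduct_sub_one_le {d : ℕ} (G : Matrix (Fin d) (Fin d) ℝ) (ε : ℝ)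
    (h : ‖G - 1‖ ≤ ε) (x : Fin d → ℝ) : |x ⬝ᵥ G *ᵥ x - x ⬝ᵥ x| ≤ ε * (x ⬝ᵥ x) := by
  have h1 : x ⬝ᵥ G *ᵥ x - x ⬝ᵥ x = x ⬝ᵥ (G - 1) *ᵥ x := by
    rw [Matrix.sub_mulVec, dotProduct_sub, Matrix.one_mulVec]
  have h2 := sq_dotProduct_le x ((G - 1) *ᵥ x)
  have h3 := dotProduct_self_mulVec_le (G - 1) x
  have h0 := dotProduct_self_nonneg_real x
  have hε : 0 ≤ ε := (norm_nonneg _).trans h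
  have h4 : ‖G - 1‖ ^ 2 ≤ ε ^ 2 := pow_le_pow_left₀ (norm_nonneg _) h 2
  rw [h1]
  refine abs_le_of_sq_le_sq ?_ (by positivity)
  calc _ ≤ _ := h2
    _ ≤ (x ⬝ᵥ x) * (ε ^ 2 * (x ⬝ᵥ x)) :=
      mul_le_mul_of_nonneg_left (h3.trans (mul_le_mul_of_nonneg_right h4 h0)) h0
    _ = _ := by ring

/-! ### The parameters and the failure probability -/

/-- The load of a bucket, the expected sum of the squared norms of its rows, is `d / b`. -/
theorem bucket_load_le {μ c₂ C ε d b : ℝ} (hC : 0 < C) (hd : 0 < d) (hε : 0 < ε) (hb : 0 < b)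
    (hbig : C * (d ^ (1 + μ) / ε ^ 2) ≤ c₂ * (1 / ε) * b) :
    d / b ≤ c₂ / C * (ε * d ^ (-μ)) := by
  have hdμ : 0 < d ^ μ := Real.rpow_pos_of_pos hd μ
  rw [Real.rpow_neg hd.le, div_le_iff₀ hb]
  rw [Real.rpow_add hd, Real.rpow_one] at hbig
  have e1 := mul_le_mul_of_nonneg_right hbig (show 0 ≤ ε * (d ^ μ)⁻¹ * ε / C by positivity)
  calc d = C * (d * d ^ μ / ε ^ 2) * (ε * (d ^ μ)⁻¹ * ε / C) := by field_simp
    _ ≤ _ := e1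
    _ = _ := by field_simp

theorem add_log_le_mul_rpow {μ d : ℝ} (hμ : 0 < μ) (hd : 1 ≤ d) :
    6 + 3 * Real.log d ≤ (6 + 12 / μ) * d ^ (μ / 4) := by
  have h1 := Real.log_le_rpow_div (by linarith : 0 ≤ d) (show 0 < μ / 4 by positivity)
  have h2 : 1 ≤ d ^ (μ / 4) := Real.one_le_rpow hd (by positivity)
  have h3 : d ^ (μ / 4) / (μ / 4) = 4 / μ * d ^ (μ / 4) := by field_simp
  rw [h3] at h1
  have h4 : 12 / μ = 3 * (4 / μ) := by ring
  rw [h4]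
  linarith

theorem variance_ratio_le {μ c₂ C ε d b N K T₀ T : ℝ} (hC : 0 < C) (hd : 0 < d) (hε : 0 < ε)
    (hb : 0 < b) (hN : 0 < N) (hc₂ : 0 < c₂) (hK : 1 ≤ K) (hT0 : 0 ≤ T)
    (hr : d / b ≤ c₂ / C * (ε * d ^ (-μ))) (hTd : T ≤ T₀ * d ^ (μ / 4))
    (hN2 : N ≤ c₂ * (1 / ε)) :
    d * T ^ 2 * N / (b * K ^ 2) ≤ c₂ ^ 2 * T₀ ^ 2 / C * d ^ (-(μ / 2)) := by
  have h1 : d * T ^ 2 * N / (b * K ^ 2) ≤ d / b * T ^ 2 * N := by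
    rw [div_le_iff₀ (by positivity)]
    calc d * T ^ 2 * N ≤ d * T ^ 2 * N * K ^ 2 :=
          le_mul_of_one_le_right (by positivity) (one_le_pow₀ hK)
      _ = _ := by field_simp
  have h3 : T ^ 2 ≤ T₀ ^ 2 * d ^ (μ / 2) := by
    calc T ^ 2 ≤ (T₀ * d ^ (μ / 4)) ^ 2 := pow_le_pow_left₀ hT0 hTd 2
      _ = T₀ ^ 2 * d ^ (μ / 2) := by
        rw [mul_pow, ← Real.rpow_natCast (d ^ (μ / 4)), ← Real.rpow_mul hd.le]
        congr 2; push_cast; ring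
  have h4 : d ^ (-μ) * d ^ (μ / 2) = d ^ (-(μ / 2)) := by
    rw [← Real.rpow_add hd]; congr 1; ring
  have h5 : 0 < d ^ (μ / 2) := Real.rpow_pos_of_pos hd _
  have h6 : 0 < d ^ (-μ) := Real.rpow_pos_of_pos hd _
  calc _ ≤ _ := h1
    _ ≤ (c₂ / C * (ε * d ^ (-μ))) * (T₀ ^ 2 * d ^ (μ / 2)) * (c₂ * (1 / ε)) := by gcongr
    _ = c₂ ^ 2 * T₀ ^ 2 / C * (d ^ (-μ) * d ^ (μ / 2)) := by field_simp
    _ = _ := by rw [h4]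

theorem rpow_neg_three {d : ℝ} (hd : 0 < d) : d ^ (-3 : ℝ) = (d * d * d)⁻¹ := by
  rw [Real.rpow_neg hd.le, show (3 : ℝ) = ((3 : ℕ) : ℝ) by norm_num, Real.rpow_natCast]
  congr 1; ring

theorem moment_term_le {μ Z C ε d b N : ℝ} (hZ : 1 ≤ Z) (hC : 16 * Z ≤ C) (hd : 0 < d)
    (hε : 0 < ε) (hb : 0 < b) (hN : 0 < N)
    (hNb : C * (d ^ (1 + μ) / ε ^ 2) ≤ Z * N * b) :
    4 * d / (ε ^ 2 * (N * b)) ≤ 1 / 4 * (d ^ μ)⁻¹ := by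
  have hdμ : 0 < d ^ μ := Real.rpow_pos_of_pos hd μ
  rw [Real.rpow_add hd, Real.rpow_one] at hNb
  rw [div_le_iff₀ (by positivity)]
  have h1 := mul_le_mul_of_nonneg_right hNb (show 0 ≤ ε ^ 2 * (d ^ μ)⁻¹ by positivity)
  have h2 : C * (d * d ^ μ / ε ^ 2) * (ε ^ 2 * (d ^ μ)⁻¹) = C * d := by field_simp
  rw [h2] at h1
  have h4 : Z * (16 * d) ≤ Z * (N * b * ε ^ 2 * (d ^ μ)⁻¹) := by
    calc Z * (16 * d) = 16 * Z * d := by ring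
      _ ≤ C * d := mul_le_mul_of_nonneg_right hC hd.le
      _ ≤ _ := h1
      _ = _ := by ring
  have h5 := le_of_mul_le_mul_left h4 (by linarith)
  linarith

/-- The contribution of the event that some bucket is heavy. -/
theorem heavy_bucket_term_le {μ c₂ C ε d b N : ℝ} (hμ : 0 < μ) (hc₂ : 0 < c₂)
    (hC : 0 < C) (hC' : 128 * Real.exp 1 * c₂ ^ 2 ≤ C) (hcC : c₂ / C ≤ 1)
    (hd : 1 ≤ d) (hε : 0 < ε) (hε1 : ε < 1) (hb : 0 < b) (hN : 0 < N)
    (hr : d / b ≤ c₂ / C * (ε * d ^ (-μ))) (hN2 : N ≤ c₂ * (1 / ε)) :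
    4 * d * (N * b * (8 * Real.exp 1 * (d / b) ^ ((4 + 6 / μ) / 2))) ≤ 1 / 4 * d⁻¹ := by
  have hdp : 0 < d := by linarith
  have he : 0 < Real.exp 1 := Real.exp_pos 1
  have hdneg0 : 0 < d ^ (-μ) := Real.rpow_pos_of_pos hdp _
  have hdb0 : 0 < d / b := by positivity
  have h1 : (d / b) ^ ((4 + 6 / μ) / 2) = d / b * (d / b) ^ (1 + 3 / μ) := by
    rw [← Real.rpow_one_add' hdb0.le (by positivity)]
    congr 1; ring
  have hcε : 0 ≤ c₂ / C * ε := by positivity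
  have hcε1 : c₂ / C * ε ≤ 1 := by
    calc c₂ / C * ε ≤ 1 * 1 := mul_le_mul hcC hε1.le hε.le zero_le_one
      _ = 1 := one_mul 1
  have h2 : (d / b) ^ (1 + 3 / μ) ≤ c₂ / C * ε * d ^ (-3 : ℝ) := by
    have hs : (0 : ℝ) ≤ 1 + 3 / μ := by positivity
    calc (d / b) ^ (1 + 3 / μ) ≤ (c₂ / C * ε * d ^ (-μ)) ^ (1 + 3 / μ) :=
          Real.rpow_le_rpow hdb0.le (hr.trans_eq (by ring)) hs
      _ = (c₂ / C * ε) ^ (1 + 3 / μ) * d ^ (-μ * (1 + 3 / μ)) := by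
          rw [Real.mul_rpow hcε hdneg0.le, ← Real.rpow_mul hdp.le]
      _ ≤ c₂ / C * ε * d ^ (-3 : ℝ) := by
          refine mul_le_mul ?_ ?_ (by positivity) hcε
          · calc (c₂ / C * ε) ^ (1 + 3 / μ) ≤ (c₂ / C * ε) ^ (1 : ℝ) :=
                  Real.rpow_le_rpow_of_exponent_ge' hcε hcε1 zero_le_one
                    (by linarith [show 0 ≤ 3 / μ by positivity])
              _ = _ := Real.rpow_one _
          · refine Real.rpow_le_rpow_of_exponent_le hd ?_
            have : -μ * (1 + 3 / μ) = -μ - 3 := by field_simp; ring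
            linarith
  rw [h1]
  calc 4 * d * (N * b * (8 * Real.exp 1 * (d / b * (d / b) ^ (1 + 3 / μ))))
      = 32 * Real.exp 1 * d * d * N * (d / b) ^ (1 + 3 / μ) := by field_simp; ring
    _ ≤ 32 * Real.exp 1 * d * d * (c₂ * (1 / ε)) * (c₂ / C * ε * d ^ (-3 : ℝ)) := by gcongr
    _ = 1 / 4 * (128 * Real.exp 1 * c₂ ^ 2 / C) * d⁻¹ := by
        rw [rpow_neg_three hdp]; field_simp; ring
    _ ≤ 1 / 4 * 1 * d⁻¹ := by
        gcongr
        rwa [div_le_one hC]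
    _ = _ := by ring

/-- The contribution of the event that half of the sketch has large norm. -/
theorem norm_term_le {d : ℝ} (hd : 0 < d) :
    4 * d * (8 * Real.exp 1 * d * Real.exp (-(6 + 3 * Real.log d))) ≤ 1 / 4 * d⁻¹ := by
  have h1 : Real.exp (-(6 + 3 * Real.log d)) = (Real.exp 1 * Real.exp 1 ^ 5)⁻¹ * (d * d * d)⁻¹ := by
    have h2 : Real.exp 6 = Real.exp 1 * Real.exp 1 ^ 5 := by
      rw [← Real.exp_nat_mul, ← Real.exp_add]; norm_num
    rw [Real.exp_neg, Real.exp_add, mul_inv, ← rpow_neg_three hd, Real.rpow_def_of_pos hd,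
      ← Real.exp_neg (3 * Real.log d), h2]
    congr 2; ring
  have h3 : (128 : ℝ) ≤ Real.exp 1 ^ 5 := by
    calc (128 : ℝ) ≤ 2.7 ^ 5 := by norm_num
      _ ≤ Real.exp 1 ^ 5 := by gcongr; linarith [Real.exp_one_gt_d9]
  rw [h1]
  calc 4 * d * (8 * Real.exp 1 * d * ((Real.exp 1 * Real.exp 1 ^ 5)⁻¹ * (d * d * d)⁻¹))
      = 1 / 4 * (128 / Real.exp 1 ^ 5) * d⁻¹ := by field_simp; ring
    _ ≤ 1 / 4 * 1 * d⁻¹ := by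
        gcongr
        rwa [div_le_one (by positivity)]
    _ = _ := by ring

/-- The contribution of the Bennett inequality for the other half of the rows, given that no bucket
of the first half is heavy and that its norm is moderate. -/
theorem bennett_term_le {μ q d y : ℝ} (hμ : 0 < μ) (hq : 0 < q) (hq1 : q ≤ 1 / (128 * Real.exp 1))
    (hd : 1 ≤ d) (hy : 1 + 6 / μ ≤ y) :
    4 * d * (8 * Real.exp 1 * d * (q * d ^ (-(μ / 2))) ^ y) ≤ 1 / 4 * d⁻¹ := by
  have hdp : 0 < d := by linarith
  have he : 0 < Real.exp 1 := Real.exp_pos 1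
  have hdh : d ^ (-(μ / 2)) ≤ 1 := Real.rpow_le_one_of_one_le_of_nonpos hd (by linarith)
  have hdh0 : 0 < d ^ (-(μ / 2)) := Real.rpow_pos_of_pos hdp _
  have hq1' : q ≤ 1 := hq1.trans (by
    rw [div_le_one (by positivity)]; linarith [Real.add_one_le_exp (1 : ℝ)])
  have hμ6 : 0 < 6 / μ := by positivity
  have h1 : (q * d ^ (-(μ / 2))) ^ y ≤ q * d ^ (-3 : ℝ) := by
    calc (q * d ^ (-(μ / 2))) ^ y ≤ (q * d ^ (-(μ / 2))) ^ (1 + 6 / μ) :=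
          Real.rpow_le_rpow_of_exponent_ge (by positivity) (mul_le_one₀ hq1' hdh0.le hdh) hy
      _ = q ^ (1 + 6 / μ) * d ^ (-(μ / 2) * (1 + 6 / μ)) := by
          rw [Real.mul_rpow hq.le hdh0.le, ← Real.rpow_mul hdp.le]
      _ ≤ q * d ^ (-3 : ℝ) := by
          refine mul_le_mul ?_ ?_ (by positivity) hq.le
          · calc q ^ (1 + 6 / μ) ≤ q ^ (1 : ℝ) :=
                  Real.rpow_le_rpow_of_exponent_ge hq hq1' (by linarith)
              _ = _ := Real.rpow_one _
          · refine Real.rpow_le_rpow_of_exponent_le hd ?_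
            have : -(μ / 2) * (1 + 6 / μ) = -(μ / 2) - 3 := by field_simp; ring
            linarith
  calc 4 * d * (8 * Real.exp 1 * d * (q * d ^ (-(μ / 2))) ^ y)
      ≤ 4 * d * (8 * Real.exp 1 * d * (1 / (128 * Real.exp 1) * d ^ (-3 : ℝ))) := by
        gcongr
        exact h1.trans (mul_le_mul_of_nonneg_right hq1 (Real.rpow_nonneg hdp.le _))
    _ = 1 / 4 * d⁻¹ := by rw [rpow_neg_three hdp]; field_simp; ring

/-- The four contributions to the failure probability, with the parameters chosen in terms of
the constants of the theorem: `K` bounds the signed sum in a bucket, `T` the norm of half of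
the sketch, and `Q` is the ratio in the Bennett bound. -/
theorem failure_terms_le {μ Z c₁ c₂ C ε d b N K T₀ T Q : ℝ} (hμ : 0 < μ) (hZ : 1 ≤ Z)
    (hK : K = 4 + 6 / μ) (hT₀ : T₀ = Real.exp 1 * (6 + 12 / μ))
    (hc₁ : 16 * K * Z * (1 + 6 / μ) ≤ c₁) (hc₂ : 0 < c₂)
    (hC : 16 * Z + 128 * Real.exp 1 * c₂ ^ 2 + Real.exp 1 * c₂ +
      128 * Real.exp 1 * (c₂ ^ 2 * T₀ ^ 2) ≤ C)
    (hd : 1 ≤ d) (hε : 0 < ε) (hε1 : ε < 1) (hb : 0 < b) (hN : 0 < N)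
    (hNb : C * (d ^ (1 + μ) / ε ^ 2) ≤ Z * N * b)
    (hbig : C * (d ^ (1 + μ) / ε ^ 2) ≤ c₂ * (1 / ε) * b)
    (hN1 : c₁ * (1 / ε) ≤ Z * N) (hN2 : N ≤ c₂ * (1 / ε))
    (hT : T = Real.exp 1 * (6 + 3 * Real.log d))
    (hQ : Q = c₂ ^ 2 * T₀ ^ 2 / C * d ^ (-(μ / 2))) :
    d < b ∧ 4 ≤ K * Real.log (b / d) ∧ 2 * Real.exp 1 ≤ T ∧ d * T ^ 2 * N / (b * K ^ 2) ≤ Q ∧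
      Q < 1 ∧ 4 * K ≤ ε / 8 * N * Real.log (1 / Q) ∧
      4 * d / (ε ^ 2 * (N * b)) + 4 * d * (N * b * (8 * Real.exp 1 * (d / b) ^ (K / 2)) +
        8 * Real.exp 1 * d * Real.exp (-(T / Real.exp 1)) +
        8 * Real.exp 1 * d * Q ^ (ε / 8 * N / (2 * K))) ≤ 1 / d ^ min μ 1 := by
  have he : 0 < Real.exp 1 := Real.exp_pos 1
  have he2 : 2 ≤ Real.exp 1 := by linarith [Real.add_one_le_exp (1 : ℝ)]
  have hdp : 0 < d := by linarith
  have hμ6 : 0 < 6 / μ := by positivity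
  have hK4 : 4 ≤ K := by rw [hK]; linarith
  have hT₀p : 0 < T₀ := by rw [hT₀]; positivity
  have t1 : 0 < 128 * Real.exp 1 * c₂ ^ 2 := by positivity
  have t2 : 0 < Real.exp 1 * c₂ := by positivity
  have t3 : 0 < 128 * Real.exp 1 * (c₂ ^ 2 * T₀ ^ 2) := by positivity
  have hC16 : 16 * Z ≤ C := by linarith
  have hC128 : 128 * Real.exp 1 * c₂ ^ 2 ≤ C := by linarith
  have hCe : Real.exp 1 * c₂ ≤ C := by linarith
  have hCT : 128 * Real.exp 1 * (c₂ ^ 2 * T₀ ^ 2) ≤ C := by linarith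
  have hCp : 0 < C := by linarith
  clear hC t1 t2 t3
  have hlogd : 0 ≤ Real.log d := Real.log_nonneg hd
  have hr := bucket_load_le hCp hdp hε hb hbig
  have hc2C : c₂ / C ≤ 1 / Real.exp 1 := by
    rw [div_le_div_iff₀ hCp he]; linarith
  have hexp1 : 1 / Real.exp 1 < 1 := by rw [div_lt_one he]; linarith
  have hrb : d / b ≤ 1 / Real.exp 1 := by
    refine hr.trans (le_trans ?_ hc2C)
    exact mul_le_of_le_one_right (by positivity) (mul_le_one₀ hε1.le
      (Real.rpow_nonneg hdp.le _) (Real.rpow_le_one_of_one_le_of_nonpos hd (by linarith)))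
  have hdb : d < b := by
    rw [← div_lt_one hb]; linarith
  have hlogb : 1 ≤ Real.log (b / d) := by
    rw [Real.le_log_iff_exp_le (by positivity), le_div_iff₀ hdp]
    rw [div_le_div_iff₀ hb he] at hrb
    linarith
  have hTd : T ≤ T₀ * d ^ (μ / 4) := by
    rw [hT, hT₀, mul_assoc]
    exact mul_le_mul_of_nonneg_left (add_log_le_mul_rpow hμ hd) he.le
  have hT0 : 0 ≤ T := by rw [hT]; positivity
  have hQbound := variance_ratio_le hCp hdp hε hb hN hc₂ (by linarith : 1 ≤ K) hT0 hr hTd hN2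
  rw [← hQ] at hQbound
  have hqp : 0 < c₂ ^ 2 * T₀ ^ 2 / C := by positivity
  have hq1 : c₂ ^ 2 * T₀ ^ 2 / C ≤ 1 / (128 * Real.exp 1) := by
    rw [div_le_div_iff₀ hCp (by positivity)]; linarith
  generalize c₂ ^ 2 * T₀ ^ 2 / C = q at hQ hqp hq1
  have hdh0 : 0 < d ^ (-(μ / 2)) := Real.rpow_pos_of_pos hdp _
  have hQp : 0 < Q := by rw [hQ]; positivity
  have hQq : Q ≤ 1 / (128 * Real.exp 1) := by
    rw [hQ]
    exact (mul_le_of_le_one_right hqp.le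
      (Real.rpow_le_one_of_one_le_of_nonpos hd (by linarith))).trans hq1
  have hQ1 : Q < 1 := by
    refine lt_of_le_of_lt hQq ?_
    rw [div_lt_one (by positivity)]; linarith
  have hlogQ : 2 ≤ Real.log (1 / Q) := by
    rw [Real.le_log_iff_exp_le (by positivity), le_div_iff₀ hQp]
    have h1 : Real.exp 2 = Real.exp 1 * Real.exp 1 := by rw [← Real.exp_add]; norm_num
    rw [h1]
    calc Real.exp 1 * Real.exp 1 * Q ≤ Real.exp 1 * Real.exp 1 * (1 / (128 * Real.exp 1)) := by
          gcongr
      _ = Real.exp 1 / 128 := by field_simp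
      _ ≤ 1 := by linarith [Real.exp_one_lt_d9]
  have hεN : 16 * K * (1 + 6 / μ) ≤ ε * N := by
    rw [mul_one_div, div_le_iff₀ hε] at hN1
    have h1 : Z * (16 * K * (1 + 6 / μ)) ≤ Z * (ε * N) := by linarith
    exact le_of_mul_le_mul_left h1 (by linarith)
  have hD1 : d⁻¹ ≤ 1 / d ^ min μ 1 := by
    rw [← one_div]
    refine one_div_le_one_div_of_le (Real.rpow_pos_of_pos hdp _) ?_
    calc d ^ min μ 1 ≤ d ^ (1 : ℝ) := Real.rpow_le_rpow_of_exponent_le hd (min_le_right _ _)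
      _ = d := Real.rpow_one d
  have hDμ : (d ^ μ)⁻¹ ≤ 1 / d ^ min μ 1 := by
    rw [← one_div]
    exact one_div_le_one_div_of_le (Real.rpow_pos_of_pos hdp _)
      (Real.rpow_le_rpow_of_exponent_le hd (min_le_left _ _))
  have hterm1 := moment_term_le hZ hC16 hdp hε hb hN hNb
  have hterm2 := heavy_bucket_term_le hμ hc₂ hCp hC128 (hc2C.trans hexp1.le) hd hε hε1 hb hN hr hN2
  have hterm3 := norm_term_le hdp
  have hterm4 := bennett_term_le hμ hqp hq1 hd
    (show 1 + 6 / μ ≤ ε / 8 * N / (2 * K) by rw [le_div_iff₀ (by positivity)]; linarith)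
  have hTe : T / Real.exp 1 = 6 + 3 * Real.log d := by rw [hT]; field_simp
  rw [← hK] at hterm2
  rw [← hTe] at hterm3
  rw [← hQ] at hterm4
  have hεNK : 2 * K ≤ ε / 8 * N := by
    have : 0 ≤ K * (6 / μ) := by positivity
    linarith
  refine ⟨hdb, ?_, ?_, hQbound, hQ1, ?_, ?_⟩
  · calc 4 ≤ K * 1 := by linarith
      _ ≤ _ := mul_le_mul_of_nonneg_left hlogb (by linarith)
  · rw [hT]; linarith [mul_nonneg he.le hlogd]
  · calc 4 * K ≤ ε / 8 * N * 2 := by linarith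
      _ ≤ _ := mul_le_mul_of_nonneg_left hlogQ (by positivity)
  · rw [mul_add, mul_add]
    linarith

end Assembly

/-! ### Good steps with high probability -/

section Final

/-- If the sketch nearly preserves the geometry of the range of the whitened factor, then the
Newton step with the sketched Hessian is good. -/
theorem goodStep_of_norm_sketchedHessian_sub_one_le {d n : ℕ} {ι : Type*} [Fintype ι]
    {f : Vec d → ℝ} {k M β ε : ℝ} (hf : TwiceDifferentiable f) (hk0 : 0 < k) (hkM : k ≤ M)
    (hk : IsStronglyConvexHess k f) (hM : IsSmoothHess M f) (hβ : 0 < β) (hβ2 : β ≤ 1 / 2)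
    (hε : 0 < ε) (hε1 : ε < 1) (wstar w : Vec d)
    (U : Matrix (Fin n) (Fin d) ℝ) (B : Matrix (Fin d) (Fin d) ℝ) (hU : Uᵀ * U = 1)
    (hH : (U * B)ᵀ * (U * B) = hessian f w) (S : Matrix (Fin n) ι ℝ)
    (hG : ‖sketchedHessian U S - 1‖ ≤ ε) :
    GoodStep f k M β ε wstar w (sketchedHessian (U * B) S) := by
  have hquad (G : Matrix (Fin d) (Fin d) ℝ) (x : Fin d → ℝ) :
      x ⬝ᵥ (Bᵀ * G * B) *ᵥ x = (B *ᵥ x) ⬝ᵥ G *ᵥ (B *ᵥ x) := by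
    rw [Matrix.mul_assoc, ← Matrix.mulVec_mulVec, ← Matrix.mulVec_mulVec, Matrix.dotProduct_mulVec,
      Matrix.vecMul_transpose]
  have hS : sketchedHessian (U * B) S = Bᵀ * sketchedHessian U S * B := by
    simp only [sketchedHessian, Matrix.transpose_mul, Matrix.mul_assoc]
  have hB : hessian f w = Bᵀ * 1 * B := by
    rw [← hH, ← hU]
    simp only [Matrix.transpose_mul, Matrix.mul_assoc]
  have hx (x : Fin d → ℝ) := abs_le.1 (abs_dotProduct_sub_one_le _ ε hG (B *ᵥ x))
  refine goodStep_of_approx hf hk0 hkM hk hM hβ hβ2 hε hε1 wstar w _ ?_ (fun x => ?_) fun x => ?_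
  · simp only [sketchedHessian, Matrix.transpose_mul, Matrix.transpose_transpose, Matrix.mul_assoc]
  · rw [hS, hB, hquad, hquad, Matrix.one_mulVec]
    linarith [(hx x).1]
  · rw [hS, hB, hquad, hquad, Matrix.one_mulVec]
    linarith [(hx x).2]

/-- The sketch of an isometry is an `ε`-isometry except with probability `d ^ (-min μ 1)`. -/
theorem sketchGram_tail_of_parameters {μ Z c₁ c₂ C ε : ℝ} {d n K b : ℕ} (hμ : 0 < μ) (hZ : 1 ≤ Z)
    (hc₁ : 16 * (4 + 6 / μ) * Z * (1 + 6 / μ) ≤ c₁) (hc₂ : 0 < c₂)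
    (hC : 16 * Z + 128 * Real.exp 1 * c₂ ^ 2 + Real.exp 1 * c₂ +
      128 * Real.exp 1 * (c₂ ^ 2 * (Real.exp 1 * (6 + 12 / μ)) ^ 2) ≤ C)
    (hd : 1 ≤ d) (hε : 0 < ε) (hε1 : ε < 1) (hb : 0 < b)
    (U : Matrix (Fin n) (Fin d) ℝ) (hU : Uᵀ * U = 1) (J : Finset (Fin K)) (hJ : J.Nonempty)
    (hNb : C * ((d : ℝ) ^ (1 + μ) / ε ^ 2) ≤ Z * J.card * b)
    (hbig : C * ((d : ℝ) ^ (1 + μ) / ε ^ 2) ≤ c₂ * (1 / ε) * b)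
    (hN1 : c₁ * (1 / ε) ≤ Z * J.card) (hN2 : (J.card : ℝ) ≤ c₂ * (1 / ε)) :
    (unifAvg fun ω : Fin K × Fin n → Fin b × Bool =>
      if ε < ‖sketchGram U J ω - 1‖ then (1 : ℝ) else 0) ≤ 1 / (d : ℝ) ^ min μ 1 := by
  have : NeZero d := ⟨by omega⟩
  have : NeZero b := ⟨hb.ne'⟩
  obtain ⟨h1, h2, h3, h4, h5, h6, h7⟩ := failure_terms_le hμ hZ rfl rfl hc₁ hc₂ hC
    (show (1 : ℝ) ≤ d by exact_mod_cast hd) hε hε1 (show (0 : ℝ) < b by exact_mod_cast hb)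
    (show (0 : ℝ) < J.card by exact_mod_cast hJ.card_pos) hNb hbig hN1 hN2 rfl rfl
  have hK0 : 0 < 4 + 6 / μ := by positivity
  refine le_trans (sketchGram_tail hU J hJ ε _ hε fun η =>
    crossSum_tail hU J hJ η _ _ (ε / 8) _ hK0 (by positivity) ?_ ?_ h3 ?_ h5 h6) ?_
  all_goals simp only [Fintype.card_fin]
  exacts [h1, h2, h4, h7]

end Final

theorem theorem1 (μ ζ : ℝ) (hμ : 0 < μ) (hζ : 0 ≤ ζ) :
    ∃ c₀ : ℝ, 0 < c₀ ∧ ∀ c₁ c₂ : ℝ, c₀ ≤ c₁ → c₁ ≤ c₂ →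
    ∃ C₀ : ℝ, 0 < C₀ ∧ ∀ C : ℝ, C₀ ≤ C →
    ∃ τ : ℝ, 0 < τ ∧
    ∀ (d n N e b : ℕ) (ε : ℝ), 1 ≤ d → 0 < ε → ε < 1 →
      -- the straggler tolerance, the sketch dimension and the number of column blocks
      (e : ℝ) ≤ ζ * (N : ℝ) →
      C * ((d : ℝ) ^ (1 + μ) / ε ^ 2) ≤ (N : ℝ) * (b : ℝ) + (e : ℝ) * (b : ℝ) →
      c₁ * (1 / ε) ≤ (N : ℝ) + (e : ℝ) → (N : ℝ) + (e : ℝ) ≤ c₂ * (1 / ε) →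
    ∀ (f : Vec d → ℝ) (k M β : ℝ),
      TwiceDifferentiable f → 0 < k → k ≤ M →
      IsStronglyConvexHess k f → IsSmoothHess M f → 0 < β → β ≤ 1 / 2 →
    ∀ wstar : Vec d, (∀ x, f wstar ≤ f x) →
    ∀ (w : Vec d) (A : Matrix (Fin n) (Fin d) ℝ), A.transpose * A = hessian f w →
      -- the column blocks that are returned (the others are the stragglers)
    ∀ J : Finset (Fin (N + e)), J.card = N →
      1 - 1 / (d : ℝ) ^ τ ≤
        (overSketchLaw (N + e) n b).real
          {ω | GoodStep f k M β ε wstar w (sketchedHessian A (overSketch N J ω))} := by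
  -- `1 + ζ` bounds the ratio of all blocks to returned blocks; the two constants are those that
  -- `failure_terms_le` asks for
  have hZ : 1 ≤ 1 + ζ := by linarith
  refine ⟨16 * (4 + 6 / μ) * (1 + ζ) * (1 + 6 / μ), by positivity, fun c₁ c₂ hc₁ hc₁₂ => ?_⟩
  have hc₀ : 0 < 16 * (4 + 6 / μ) * (1 + ζ) * (1 + 6 / μ) := by positivity
  have hc₁p : 0 < c₁ := hc₀.trans_le hc₁
  have hc₂ : 0 < c₂ := hc₁p.trans_le hc₁₂
  refine ⟨16 * (1 + ζ) + 128 * Real.exp 1 * c₂ ^ 2 + Real.exp 1 * c₂ +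
      128 * Real.exp 1 * (c₂ ^ 2 * (Real.exp 1 * (6 + 12 / μ)) ^ 2), by positivity, fun C hC => ?_⟩
  have hCp : 0 < C := lt_of_lt_of_le (by positivity) hC
  refine ⟨min μ 1, lt_min hμ one_pos, ?_⟩
  intro d n N e b ε hd hε hε1 he hNb hN1 hN2 f k M β hf hk0 hkM hk hM hβ hβ2 wstar _ w A hA J hJ
  have hdp : (0 : ℝ) < d := by exact_mod_cast hd
  have hNe : 0 < (N : ℝ) + e := lt_of_lt_of_le (by positivity) hN1
  have hNZ : (N : ℝ) + e ≤ (1 + ζ) * N := by linarith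
  -- if no block or no column existed, the size conditions would fail
  have hNp : (0 : ℝ) < N := pos_of_mul_pos_right (hNe.trans_le hNZ) (by linarith)
  have hC' : 0 < C * ((d : ℝ) ^ (1 + μ) / ε ^ 2) := by positivity
  have hNeb : 0 < ((N : ℝ) + e) * b := by linarith
  have hb : 0 < b := by exact_mod_cast pos_of_mul_pos_right hNeb hNe.le
  have hJ0 : J.Nonempty := Finset.card_pos.1 (by rw [hJ]; exact_mod_cast hNp)
  have hb0 : (0 : ℝ) ≤ b := Nat.cast_nonneg b
  obtain ⟨U, B, hU, rfl⟩ := exists_isometry_factor A (hessian f w) hA k hk0 (hk w)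
  have htail := sketchGram_tail_of_parameters (b := b) hμ hZ hc₁ hc₂ hC hd hε hε1 hb U hU J hJ0
    (by rw [hJ]; linarith [mul_le_mul_of_nonneg_right hNZ hb0])
    (by linarith [mul_le_mul_of_nonneg_right hN2 hb0]) (by rw [hJ]; linarith)
    (by rw [hJ]; linarith [(Nat.cast_nonneg e : (0 : ℝ) ≤ e)])
  classical
  have : NeZero b := ⟨hb.ne'⟩
  rw [overSketchLaw_real_eq_unifAvg _ _ _ hb]
  calc 1 - 1 / (d : ℝ) ^ min μ 1
      ≤ 1 - unifAvg fun ω : Fin (N + e) × Fin n → Fin b × Bool =>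
          if ε < ‖sketchGram U J ω - 1‖ then (1 : ℝ) else 0 := sub_le_sub_left htail 1
    _ = unifAvg fun ω : Fin (N + e) × Fin n → Fin b × Bool =>
          1 - if ε < ‖sketchGram U J ω - 1‖ then (1 : ℝ) else 0 := by
        rw [unifAvg_sub, unifAvg_const]
    _ ≤ _ := by
        refine unifAvg_mono fun ω => ?_
        by_cases h : ε < ‖sketchGram U J ω - 1‖
        · rw [if_pos h, sub_self]
          split_ifs <;> norm_num
        · rw [if_neg h, sub_zero, if_pos]
          refine goodStep_of_norm_sketchedHessian_sub_one_le hf hk0 hkM hk hM hβ hβ2 hε hε1 wstar w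
            U B hU hA _ ?_
          rw [sketchedHessian_overSketch U N J hJ ω]
          exact not_lt.1 h
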